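/- Let $\mathbb S^3\subset\mathbb H$ be the unit quaternions, $\mathbb S^2=\mathbb S^3\cap\operatorname{span}\{1,j,k\}$, and let $\pi:\mathbb S^3\to\mathbb S^2$, $\pi(q)=\tilde q\,q$, be the Hopf fibration, where $q\mapsto\tilde q$ is the linear involution that fixes $1,j,k$ and sends $i$ to $-i$. Let $T>0$ and let $\gamma_t:\mathbb S^1\to\mathbb S^2$, $t\in[0,T]$, be a smooth family (smooth on $[0,T]\times\mathbb S^1$) of closed regular curves, each of which traverses its trace exactly once (up to a set of one-dimensional Hausdorff measure zero, every point of the trace has exactly one preimage). Let $\Sigma$ be a compact smooth torus, i.e. a smooth surface diffeomorphic to $\mathbb S^1\times\mathbb S^1$, and let $F_t:\Sigma\to\mathbb S^3$, $t\in[0,T]$, be a smooth family (smooth on $[0,T]\times\Sigma$) of immersions, each of which maps $\Sigma$ simply onto the Hopf torus $\pi^{-1}(\operatorname{trace}(\gamma_t))$. Here "simply" means that $F_t$ induces an isomorphism $H_2(\Sigma;\mathbb Z)\to H_2(F_t(\Sigma);\mathbb Z)$ in singular homology, or (so that Hopf tori with self-intersections are included) that up to a set of two-dimensional Hausdorff measure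 zero every point of $F_t(\Sigma)$ has exactly one preimage. For an immersion $f:\Sigma\to\mathbb S^3$ with metric $g$, second fundamental form $A_f$ in $\mathbb S^3$, mean curvature vector $\vec H_f=g^{ij}(A_f)_{ij}$, trace-free part $A^0_f=A_f-\tfrac12\,g\,\vec H_f$ and $Q(A^0_f)(\phi)=g^{ik}g^{jl}(A^0_f)_{ij}\langle (A^0_f)_{kl},\phi\rangle$, put $$\nabla_{L^2}\mathcal W(f)=\tfrac12\big(\triangle_f^{\perp}\vec H_f+Q(A^0_f)(\vec H_f)\big),$$ where $\triangle_f^\perp$ is the Laplacian of the normal bundle of $f$ in $T\mathbb S^3$. For a regular closed curve $\gamma:\mathbb S^1\to\mathbb S^2$ with curvature vector $\vec\kappa_\gamma$ in $\mathbb S^2$ and normal covariant derivative $\nabla^\perp_{\gamma'/|\gamma'|}$ with respect to arc length put $$\nabla_{L^2}\mathcal E(\gamma)=2\big(\nabla^\perp_{\gamma'/|\gamma'|}\big)^2\vec\kappa_\gamma+|\vec\kappa_\gamma|^2\vec\kappa_\gamma+\vec\kappa_\gamma ,$$ the $L^2$-gradient of $\mathcal E(\gamma)=\int_{\mathbb S^1}1+|\vec\kappa_\gamma|^2\,d\mu_\gamma$.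 Then the following are equivalent. 1. There is a smooth family of diffeomorphisms $\Phi_t:\Sigma\to\Sigma$, $t\in[0,T]$, with $\Phi_0=\mathrm{Id}_\Sigma$, such that $f_t=F_t\circ\Phi_t$ solves the Willmore flow $\partial_t f_t=-\nabla_{L^2}\mathcal W(f_t)$ on $[0,T]\times\Sigma$. 2. There is a smooth family of diffeomorphisms $\sigma_t:\mathbb S^1\to\mathbb S^1$, $t\in[0,T]$, with $\sigma_0=\mathrm{Id}_{\mathbb S^1}$, such that $\tilde\gamma_t=\gamma_t\circ\sigma_t$ solves the elastic energy flow $\partial_t\tilde\gamma_t=-4\,\nabla_{L^2}\mathcal E(\tilde\gamma_t)$ on $[0,T]\times\mathbb S^1$. -/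

import Mathlib

open scoped Manifold ContDiff Quaternion
open Set

universe u

namespace HopfWillmore

noncomputable section

/-! ### Hopf fibration and Hopf tori -/

/-- The unit sphere of the quaternions. -/
def S3 : Set ℍ[ℝ] := {q | ‖q‖ = 1}

/-- The unit sphere of `span {1, j, k}`. -/
def S2 : Set ℍ[ℝ] := {q | ‖q‖ = 1 ∧ q.imI = 0}

/-- The involution fixing `1, j, k` and sending `i` to `-i`. -/
def tilde (q : ℍ[ℝ]) : ℍ[ℝ] := ⟨q.re, -q.imI, q.imJ, q.imK⟩

/-- The Hopf fibration `q ↦ q̃ q`. -/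
def hopf (q : ℍ[ℝ]) : ℍ[ℝ] := tilde q * q

/-- The Hopf torus over (the trace of) a closed curve. -/
def hopfTorus (γ : Circle → ℍ[ℝ]) : Set ℍ[ℝ] := {q | q ∈ S3 ∧ hopf q ∈ range γ}

/-! ### Smooth families, immersions, regular curves -/

/-- Joint smoothness on `[0,T] × M` of a family of maps between manifolds. -/
def SmoothFamily {E H E' H' : Type*} [NormedAddCommGroup E] [NormedSpace ℝ E]
    [TopologicalSpace H] (I : ModelWithCorners ℝ E H)
    [NormedAddCommGroup E'] [NormedSpace ℝ E'] [TopologicalSpace H']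
    (J : ModelWithCorners ℝ E' H')
    {M N : Type*} [TopologicalSpace M] [ChartedSpace H M] [TopologicalSpace N]
    [ChartedSpace H' N] (T : ℝ) (f : ℝ → M → N) : Prop :=
  ContMDiffOn (𝓘(ℝ, ℝ).prod I) J ∞ (fun p : ℝ × M => f p.1 p.2) (Icc 0 T ×ˢ univ)

/-- A closed curve in the angular coordinate `x ↦ γ (e^{ix})`. -/
def lift (γ : Circle → ℍ[ℝ]) (x : ℝ) : ℍ[ℝ] := γ (Circle.exp x)

/-- A regular closed curve in the two-sphere. -/
def IsRegularCurve (γ : Circle → ℍ[ℝ]) : Prop :=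
  (∀ z, γ z ∈ S2) ∧ ∀ x : ℝ, deriv (lift γ) x ≠ 0

/-- The differential is injective at every point. -/
def IsImm {M : Type*} [TopologicalSpace M] [ChartedSpace (EuclideanSpace ℝ (Fin 2)) M]
    (f : M → ℍ[ℝ]) : Prop :=
  ∀ x, Function.Injective (mfderiv (𝓡 2) 𝓘(ℝ, ℍ[ℝ]) f x)

/-- Up to a set of `d`-dimensional Hausdorff measure zero, every point of the image has exactly
one preimage. -/
def CoversOnce (d : ℝ) {X : Type*} (f : X → ℍ[ℝ]) : Prop :=
  letI : MeasurableSpace ℍ[ℝ] := borel ℍ[ℝ]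
  haveI : BorelSpace ℍ[ℝ] := ⟨rfl⟩
  MeasureTheory.Measure.hausdorffMeasure d {z | z ∈ range f ∧ ¬ ∃! x, f x = z} = 0

/-- The map from a space onto the image of a continuous map (lifted to the universe of the
source). -/
def ontoImage {M : Type u} [TopologicalSpace M] (f : C(M, ℍ[ℝ])) :
    C(M, ULift.{u} (range f)) :=
  ⟨fun x => ULift.up ⟨f x, mem_range_self x⟩,
    continuous_uliftUp.comp (f.continuous.subtype_mk _)⟩

/-- Mapping degree `± 1` onto the image: the induced map in singular homology
`H₂(M; ℤ) → H₂(f(M); ℤ)` is an isomorphism. -/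
def HasDegreeOneOntoImage {M : Type u} [TopologicalSpace M] (f : C(M, ℍ[ℝ])) : Prop :=
  CategoryTheory.IsIso
    (((AlgebraicTopology.singularHomologyFunctor (ModuleCat.{u} ℤ) 2).obj
      (ModuleCat.of ℤ (ULift.{u} ℤ))).map (TopCat.ofHom (ontoImage f)))

/-- A map is simple onto its image if it has degree `± 1` in singular homology or, which is the
meaning for a surface with self-intersections, if it covers its image essentially once. -/
def IsSimpleOntoImage {M : Type u} [TopologicalSpace M] (f : M → ℍ[ℝ]) : Prop :=
  (∃ hf : Continuous f, HasDegreeOneOntoImage ⟨f, hf⟩) ∨ CoversOnce 2 f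

/-- A smooth surface diffeomorphic to the standard torus `S¹ × S¹`. -/
def IsSmoothTorus (M : Type*) [TopologicalSpace M]
    [ChartedSpace (EuclideanSpace ℝ (Fin 2)) M] : Prop :=
  Nonempty (Diffeomorph (𝓡 2) ((𝓡 1).prod (𝓡 1)) M (Circle × Circle) ∞)

/-! ### Extrinsic geometry of a parametrized surface `G : ℝ² → S³ ⊆ ℍ` -/

namespace Surface

/-- The `i`-th partial derivative. -/
def pd (i : Fin 2) (V : EuclideanSpace ℝ (Fin 2) → ℍ[ℝ]) (p : EuclideanSpace ℝ (Fin 2)) :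
    ℍ[ℝ] :=
  fderiv ℝ V p (EuclideanSpace.single i 1)

variable (G : EuclideanSpace ℝ (Fin 2) → ℍ[ℝ])

/-- The first fundamental form `g_{ij}`. -/
def metric (p : EuclideanSpace ℝ (Fin 2)) : Matrix (Fin 2) (Fin 2) ℝ :=
  Matrix.of fun i j => inner ℝ (pd i G p) (pd j G p)

/-- The inverse `g^{ij}` of the first fundamental form. -/
def metricInv (p : EuclideanSpace ℝ (Fin 2)) : Matrix (Fin 2) (Fin 2) ℝ := (metric G p)⁻¹

/-- Christoffel symbols `Γ^m_{kl} = g^{mj} ⟨∂_k ∂_l G, ∂_j G⟩`. -/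
def christoffel (m k l : Fin 2) (p : EuclideanSpace ℝ (Fin 2)) : ℝ :=
  ∑ j, metricInv G p m j * inner ℝ (pd k (pd l G) p) (pd j G p)

/-- Orthogonal projection of `ℍ` onto the tangent space of `S³` at `G p`. -/
def projS3 (p : EuclideanSpace ℝ (Fin 2)) (v : ℍ[ℝ]) : ℍ[ℝ] :=
  v - (inner ℝ v (G p) : ℝ) • G p

/-- Orthogonal projection onto the tangent plane of the surface. -/
def projTan (p : EuclideanSpace ℝ (Fin 2)) (v : ℍ[ℝ]) : ℍ[ℝ] :=
  ∑ i, ∑ j, (metricInv G p i j * inner ℝ v (pd j G p)) • pd i G p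

/-- Orthogonal projection onto the normal space of the surface within the tangent space
of `S³`. -/
def perp (p : EuclideanSpace ℝ (Fin 2)) (v : ℍ[ℝ]) : ℍ[ℝ] :=
  projS3 G p v - projTan G p (projS3 G p v)

/-- Second fundamental form `A_{ij}` of the surface in `S³`. -/
def secondFF (i j : Fin 2) (p : EuclideanSpace ℝ (Fin 2)) : ℍ[ℝ] :=
  perp G p (pd i (pd j G) p)

/-- Mean curvature vector: the trace `g^{ij} A_{ij}`. -/
def meanCurv (p : EuclideanSpace ℝ (Fin 2)) : ℍ[ℝ] :=
  ∑ i, ∑ j, metricInv G p i j • secondFF G i j p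

/-- The trace-free part `A⁰_{ij} = A_{ij} - ½ g_{ij} H`. -/
def traceFree (i j : Fin 2) (p : EuclideanSpace ℝ (Fin 2)) : ℍ[ℝ] :=
  secondFF G i j p - (metric G p i j / 2) • meanCurv G p

/-- `Q(A⁰)(φ) = g^{ik} g^{jl} A⁰_{ij} ⟨A⁰_{kl}, φ⟩`. -/
def Q (p : EuclideanSpace ℝ (Fin 2)) (φ : ℍ[ℝ]) : ℍ[ℝ] :=
  ∑ i, ∑ j, ∑ k, ∑ l,
    (metricInv G p i k * metricInv G p j l * inner ℝ (traceFree G k l p) φ) • traceFree G i j p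

/-- The normal covariant derivative `∇^⊥_i V`. -/
def normalDeriv (i : Fin 2) (V : EuclideanSpace ℝ (Fin 2) → ℍ[ℝ])
    (p : EuclideanSpace ℝ (Fin 2)) : ℍ[ℝ] :=
  perp G p (pd i V p)

/-- The normal Laplacian `g^{kl} (∇^⊥_k ∇^⊥_l V - Γ^m_{kl} ∇^⊥_m V)`. -/
def normalLaplacian (V : EuclideanSpace ℝ (Fin 2) → ℍ[ℝ]) (p : EuclideanSpace ℝ (Fin 2)) :
    ℍ[ℝ] :=
  ∑ k, ∑ l, metricInv G p k l •
    (normalDeriv G k (normalDeriv G l V) p - ∑ m, christoffel G m k l p • normalDeriv G m V p)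

/-- The Willmore gradient `½ (Δ^⊥ H + Q(A⁰)(H))` of a parametrized surface. -/
def willmoreGrad (p : EuclideanSpace ℝ (Fin 2)) : ℍ[ℝ] :=
  (1 / 2 : ℝ) • (normalLaplacian G (meanCurv G) p + Q G p (meanCurv G p))

end Surface

/-- The Willmore gradient of an immersed surface `f : M → S³` at `x`, computed in the preferred
chart at `x`. -/
def willmoreGradient {M : Type*} [TopologicalSpace M]
    [ChartedSpace (EuclideanSpace ℝ (Fin 2)) M] (f : M → ℍ[ℝ]) (x : M) : ℍ[ℝ] :=
  Surface.willmoreGrad (f ∘ (extChartAt (𝓡 2) x).symm) (extChartAt (𝓡 2) x x)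

/-- The Willmore flow `∂_t f_t = -∇_{L²} W(f_t)` on `[0,T] × M`. -/
def SolvesWillmoreFlow {M : Type*} [TopologicalSpace M]
    [ChartedSpace (EuclideanSpace ℝ (Fin 2)) M] (T : ℝ) (f : ℝ → M → ℍ[ℝ]) : Prop :=
  ∀ t ∈ Icc 0 T, ∀ x,
    HasDerivWithinAt (fun r => f r x) (-willmoreGradient (f t) x) (Icc 0 T) t

/-! ### Geometry of a parametrized regular curve `c : ℝ → S² ⊆ ℍ` -/

namespace Curve

variable (c : ℝ → ℍ[ℝ])

/-- Derivative with respect to arc length of a vector field along the curve. -/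
def ds (V : ℝ → ℍ[ℝ]) (x : ℝ) : ℍ[ℝ] := ‖deriv c x‖⁻¹ • deriv V x

/-- The unit tangent vector. -/
def tangent (x : ℝ) : ℍ[ℝ] := ds c c x

/-- Covariant derivative in `S²` along the unit tangent. -/
def covDeriv (V : ℝ → ℍ[ℝ]) (x : ℝ) : ℍ[ℝ] :=
  ds c V x - (inner ℝ (ds c V x) (c x) : ℝ) • c x

/-- Normal covariant derivative along the unit tangent. -/
def normalDeriv (V : ℝ → ℍ[ℝ]) (x : ℝ) : ℍ[ℝ] :=
  covDeriv c V x - (inner ℝ (covDeriv c V x) (tangent c x) : ℝ) • tangent c x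

/-- The curvature vector of the curve in `S²`. -/
def curvature (x : ℝ) : ℍ[ℝ] := covDeriv c (tangent c) x

/-- The gradient `2 (∇^⊥)² κ + |κ|² κ + κ` of the elastic energy `∫ 1 + |κ|²`. -/
def elasticGrad (x : ℝ) : ℍ[ℝ] :=
  (2 : ℝ) • normalDeriv c (normalDeriv c (curvature c)) x
    + ‖curvature c x‖ ^ 2 • curvature c x + curvature c x

end Curve

/-- The elastic energy flow with speed factor `a`, that is `∂_t γ_t = -a ∇_{L²} E(γ_t)`,
on `[0,T] × S¹`. -/
def SolvesElasticFlow (a T : ℝ) (γ : ℝ → Circle → ℍ[ℝ]) : Prop :=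
  ∀ t ∈ Icc 0 T, ∀ x : ℝ,
    HasDerivWithinAt (fun r => lift (γ r) x)
      (-(a • Curve.elasticGrad (lift (γ t)) x)) (Icc 0 T) t

end

end HopfWillmore

/-! Conjugation by i, called `twist`, turns the Hopf map into q ↦ star (twist q) * q, so every unit
quaternion satisfies q = twist q * hopf q. Hence left multiplication by `twist (G p)` carries the
frame (c, t, n, i) of a curve c in the two-sphere to an orthonormal frame (position, horizontal,
normal, fibre direction) along any surface G lying over c. Differentiating G = twist G * (c ∘ φ)
gives the structure equations of this frame: horizontal length is half the arc length of c, the mean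
curvature is 2κ, the coframe is parallel (Hopf tori are flat), and |A⁰|² = 2κ² + 2. Therefore the
Willmore gradient is `twist G` times twice the elastic gradient (`willmoreGrad_eq`). The
differential of the Hopf map doubles horizontal vectors (`inner_hopfDeriv`), and the two factors 2
combine to the speed 4 of the elastic flow.

The remaining work concerns parametrizations. Up to reparametrization only normal velocities matter,
so both flows are encoded by normal defects, which vanish simultaneously
(`surfaceDefect_eq_zero_iff`). Over a simple point of γ_t, compactness of the circle forces nearby
curves to pass nearby points only at nearby parameters. A point moving with the surface therefore
projects to a point moving along the curves, and its velocity is known modulo the tangent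
(`inner_velocity_eq`, `surfaceDefect_eq`). Simple points are dense because a connected set of
vanishing length is a point, and continuity extends the equality.

Tangential velocity is removed by `exists_normal_reparametrization`: the required vector field is
periodic on the universal cover, and its flow descends to diffeomorphisms that start at the
identity. Smoothness up to both ends of [0, T] follows from parameter dependence of ODE solutions on
the closed interval. A family with normal velocity and zero defect solves its flow. -/

namespace HopfWillmore

noncomputable section

/-! ### Quaternion algebra of the Hopf fibration -/

/-- The imaginary unit that is orthogonal to `span {1, j, k}`. -/
def unitI : ℍ[ℝ] := ⟨0, 1, 0, 0⟩

@[simp] lemma unitI_re : unitI.re = 0 := rfl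
@[simp] lemma unitI_imI : unitI.imI = 1 := rfl
@[simp] lemma unitI_imJ : unitI.imJ = 0 := rfl
@[simp] lemma unitI_imK : unitI.imK = 0 := rfl
@[simp] lemma tilde_re (q : ℍ[ℝ]) : (tilde q).re = q.re := rfl
@[simp] lemma tilde_imI (q : ℍ[ℝ]) : (tilde q).imI = -q.imI := rfl
@[simp] lemma tilde_imJ (q : ℍ[ℝ]) : (tilde q).imJ = q.imJ := rfl
@[simp] lemma tilde_imK (q : ℍ[ℝ]) : (tilde q).imK = q.imK := rfl

/-- The inner automorphism `q ↦ i q i⁻¹`. -/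
def twist (q : ℍ[ℝ]) : ℍ[ℝ] := -(unitI * q * unitI)

lemma inner_eq (a b : ℍ[ℝ]) :
    inner ℝ a b = a.re * b.re + a.imI * b.imI + a.imJ * b.imJ + a.imK * b.imK := by
  rw [Quaternion.inner_def]; simp

lemma norm_eq_one_iff (a : ℍ[ℝ]) :
    ‖a‖ = 1 ↔ a.re * a.re + a.imI * a.imI + a.imJ * a.imJ + a.imK * a.imK = 1 := by
  rw [← inner_eq, real_inner_self_eq_norm_sq]
  constructor
  · intro h; rw [h]; norm_num
  · intro h
    have h0 := norm_nonneg a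
    nlinarith

lemma unitI_mul_unitI : unitI * unitI = -1 := by
  ext <;> simp

lemma unitI_mul_unitI_assoc (q : ℍ[ℝ]) : q * unitI * unitI = -q := by
  rw [mul_assoc, unitI_mul_unitI]; simp

lemma norm_unitI : ‖unitI‖ = 1 := by
  rw [norm_eq_one_iff]; simp

lemma twist_mul (p q : ℍ[ℝ]) : twist (p * q) = twist p * twist q := by
  ext <;> simp [twist] <;> ring

lemma twist_twist (q : ℍ[ℝ]) : twist (twist q) = q := by
  ext <;> simp [twist]

lemma twist_unitI : twist unitI = unitI := by
  ext <;> simp [twist]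

lemma twist_of_imI {w : ℍ[ℝ]} (hw : w.imI = 0) : twist w = star w := by
  ext <;> simp [twist, hw]

lemma twist_add (p q : ℍ[ℝ]) : twist (p + q) = twist p + twist q := by
  simp [twist, mul_add, add_mul, add_comm]

lemma twist_smul (r : ℝ) (q : ℍ[ℝ]) : twist (r • q) = r • twist q := by
  simp [twist]

lemma unitI_mul_of_imI {w : ℍ[ℝ]} (hw : w.imI = 0) : unitI * w = star w * unitI := by
  ext <;> simp [hw]

/-- `tilde` reverses products, so it is an automorphism followed by conjugation. This exhibits the
Hopf map as a quotient of `q` by `twist q`. -/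
lemma tilde_eq (q : ℍ[ℝ]) : tilde q = star (twist q) := by
  ext <;> simp [twist]

lemma norm_twist (q : ℍ[ℝ]) : ‖twist q‖ = ‖q‖ := by
  simp [twist, norm_unitI]

lemma mul_star_of_norm {q : ℍ[ℝ]} (hq : ‖q‖ = 1) : q * star q = 1 := by
  rw [Quaternion.self_mul_star, Quaternion.normSq_eq_norm_mul_self, hq]; simp

lemma star_mul_of_norm {q : ℍ[ℝ]} (hq : ‖q‖ = 1) : star q * q = 1 := by
  rw [Quaternion.star_mul_self, Quaternion.normSq_eq_norm_mul_self, hq]; simp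

lemma twist_mul_hopf {q : ℍ[ℝ]} (hq : ‖q‖ = 1) : twist q * hopf q = q := by
  rw [hopf, tilde_eq, ← mul_assoc, mul_star_of_norm (by rw [norm_twist, hq]), one_mul]

lemma inner_mul_left_of_norm {L : ℍ[ℝ]} (hL : ‖L‖ = 1) (x y : ℍ[ℝ]) :
    inner ℝ (L * x) (L * y) = (inner ℝ x y : ℝ) := by
  rw [norm_eq_one_iff] at hL
  rw [inner_eq, inner_eq]
  simp only [Quaternion.re_mul, Quaternion.imI_mul, Quaternion.imJ_mul, Quaternion.imK_mul]
  linear_combination (x.re * y.re + x.imI * y.imI + x.imJ * y.imJ + x.imK * y.imK) * hL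

/-- The unit vector completing orthonormal `c, t ∈ span {1, j, k}` to a basis. -/
def binormal (c t : ℍ[ℝ]) : ℍ[ℝ] := -(t * star c * unitI)

/-- Two orthonormal vectors of `span {1, j, k}`. -/
structure IsFrame (c t : ℍ[ℝ]) : Prop where
  imI_left : c.imI = 0
  imI_right : t.imI = 0
  norm_left : ‖c‖ = 1
  norm_right : ‖t‖ = 1
  inner_eq_zero : inner ℝ c t = (0 : ℝ)

namespace IsFrame

variable {c t : ℍ[ℝ]} (h : IsFrame c t)
include h

/-- Polarization of the norm: the left side is twice ⟨c, t⟩. -/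
lemma mul_star_add : c * star t + t * star c = 0 := by
  have h1 := h.inner_eq_zero
  rw [inner_eq] at h1
  ext <;> simp [h.imI_left, h.imI_right] at * <;> linarith

lemma star_mul_add : star c * t + star t * c = 0 := by
  have h1 := h.inner_eq_zero
  rw [inner_eq] at h1
  ext <;> simp [h.imI_left, h.imI_right] at * <;> linarith

lemma mul_star_left : t * star c * c = t := by
  rw [mul_assoc, star_mul_of_norm h.norm_left, mul_one]

lemma mul_star_right : t * star c * t = -c := by
  rw [mul_assoc, eq_neg_of_add_eq_zero_left h.star_mul_add, mul_neg, ← mul_assoc,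
    mul_star_of_norm h.norm_right, one_mul]

omit h in
lemma mul_star_unitI : t * star c * unitI = -binormal c t := by
  simp [binormal]

lemma mul_star_binormal : t * star c * binormal c t = unitI := by
  rw [binormal, mul_neg, ← mul_assoc, ← mul_assoc, h.mul_star_right, neg_mul, neg_mul, neg_neg,
    mul_star_of_norm h.norm_left, one_mul]

lemma mul_unitI_left : c * unitI * c = unitI := by
  rw [mul_assoc, unitI_mul_of_imI h.imI_left, ← mul_assoc, mul_star_of_norm h.norm_left, one_mul]

lemma mul_unitI_right : c * unitI * t = binormal c t := by
  rw [mul_assoc, unitI_mul_of_imI h.imI_right, ← mul_assoc,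
    eq_neg_of_add_eq_zero_left h.mul_star_add, binormal, neg_mul]

lemma binormal_imI : (binormal c t).imI = 0 := by
  have h1 := h.inner_eq_zero
  rw [inner_eq] at h1
  simp [binormal, h.imI_left, h.imI_right] at *
  linarith

lemma binormal_mul_star_unitI : binormal c t * star c * unitI = t := by
  have : unitI * star c = c * unitI := by
    rw [unitI_mul_of_imI (by simp [h.imI_left]), star_star]
  rw [binormal, neg_mul, neg_mul, mul_assoc (t * star c), this, ← mul_assoc, mul_assoc t,
    star_mul_of_norm h.norm_left, mul_one, unitI_mul_unitI_assoc, neg_neg]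

lemma inner_binormal : inner ℝ c (binormal c t) = (0 : ℝ) := by
  rw [inner_eq]
  simp [binormal, h.imI_left, h.imI_right]
  ring

lemma inner_binormal_right : inner ℝ t (binormal c t) = (0 : ℝ) := by
  rw [inner_eq]
  simp [binormal, h.imI_left, h.imI_right]
  ring

lemma norm_binormal : ‖binormal c t‖ = 1 := by
  simp [binormal, norm_unitI, h.norm_left, h.norm_right]

lemma mul_unitI_binormal : c * unitI * binormal c t = -t := by
  have h2 : c * star (binormal c t) = - (binormal c t * star c) := by
    have h1 := h.binormal_imI
    have h3 := h.inner_binormal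
    rw [inner_eq] at h3
    generalize binormal c t = n at *
    ext <;> simp [h.imI_left, h1] at * <;> linarith
  rw [mul_assoc, unitI_mul_of_imI h.binormal_imI, ← mul_assoc, h2, neg_mul,
    h.binormal_mul_star_unitI]

lemma mul_star_mul_left : c * star t * c = -t := by
  rw [eq_neg_of_add_eq_zero_left h.mul_star_add, neg_mul, h.mul_star_left]

lemma mul_star_binormal_mul_left : c * star (binormal c t) * c = -binormal c t := by
  exact IsFrame.mul_star_mul_left ⟨h.imI_left, h.binormal_imI, h.norm_left, h.norm_binormal,
    h.inner_binormal⟩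

/-- Left multiplication by a unit quaternion is an isometry. With `L = twist (G p)` this becomes the
adapted frame of the surface. -/
lemma orthonormal_mul {L : ℍ[ℝ]} (hL : ‖L‖ = 1) :
    Orthonormal ℝ ![L * c, L * t, L * binormal c t, L * unitI] := by
  have h1 := h.inner_eq_zero
  have h2 := h.inner_binormal
  have h3 := h.inner_binormal_right
  have h4 : ∀ w : ℍ[ℝ], inner ℝ w unitI = w.imI := fun w => by rw [inner_eq]; simp
  refine ⟨fun i => ?_, ?_⟩
  · fin_cases i <;> simp [hL, h.norm_left, h.norm_right, h.norm_binormal, norm_unitI]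
  · intro i j hij
    wlog hlt : i < j generalizing i j
    · rw [real_inner_comm]
      exact this hij.symm (lt_of_le_of_ne (not_lt.mp hlt) hij.symm)
    fin_cases i <;> fin_cases j <;> first
      | (exfalso; revert hlt; decide)
      | simp [inner_mul_left_of_norm hL, h1, h2, h3, h4, h.binormal_imI, h.imI_left, h.imI_right]

end IsFrame

lemma orthonormal_expand {v : Fin 4 → ℍ[ℝ]} (hv : Orthonormal ℝ v) (x : ℍ[ℝ]) :
    x = (inner ℝ x (v 0) : ℝ) • v 0 + (inner ℝ x (v 1) : ℝ) • v 1
      + (inner ℝ x (v 2) : ℝ) • v 2 + (inner ℝ x (v 3) : ℝ) • v 3 := by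
  have hspan : ⊤ ≤ Submodule.span ℝ (Set.range v) := by
    have := (basisOfOrthonormalOfCardEqFinrank hv
      (by simp [Quaternion.finrank_eq_four])).span_eq
    rw [coe_basisOfOrthonormalOfCardEqFinrank] at this
    exact this.ge
  have h1 := (OrthonormalBasis.mk hv hspan).sum_repr' x
  simp only [OrthonormalBasis.coe_mk, Fin.sum_univ_four] at h1
  conv_lhs => rw [← h1]
  simp only [real_inner_comm]

end

end HopfWillmore

namespace HopfWillmore

noncomputable section

/-! ### Regular curves in the two-sphere -/

/-- A smooth regular parametrized curve in the unit sphere of `span {1, j, k}`. -/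
structure IsSphereCurve (c : ℝ → ℍ[ℝ]) : Prop where
  contDiff : ContDiff ℝ ∞ c
  norm_eq_one : ∀ x, ‖c x‖ = 1
  imI_eq_zero : ∀ x, (c x).imI = 0
  deriv_ne_zero : ∀ x, deriv c x ≠ 0

namespace Curve

/-- The unit normal of a curve in the two-sphere. -/
def unitNormal (c : ℝ → ℍ[ℝ]) (x : ℝ) : ℍ[ℝ] := binormal (c x) (tangent c x)

/-- The signed curvature. -/
def signedCurv (c : ℝ → ℍ[ℝ]) (x : ℝ) : ℝ := inner ℝ (curvature c x) (unitNormal c x)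

/-- The arc length derivative of a function. -/
def arcDeriv (c : ℝ → ℍ[ℝ]) (f : ℝ → ℝ) (x : ℝ) : ℝ := ‖deriv c x‖⁻¹ * deriv f x

end Curve

open Curve

lemma inner_deriv_eq_zero_of_norm {u : ℝ → ℍ[ℝ]} {u' : ℍ[ℝ]} {x : ℝ} (hu : ∀ y, ‖u y‖ = 1)
    (h : HasDerivAt u u' x) : inner ℝ u' (u x) = (0 : ℝ) := by
  have h1 := h.inner ℝ h
  have h2 : (fun y => inner ℝ (u y) (u y) : ℝ → ℝ) = fun _ => 1 := by
    ext y; rw [real_inner_self_eq_norm_sq, hu, one_pow]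
  rw [h2] at h1
  have h3 := h1.unique (hasDerivAt_const x (1 : ℝ))
  rw [real_inner_comm] at h3
  linarith

lemma imI_deriv_eq_zero {u : ℝ → ℍ[ℝ]} {u' : ℍ[ℝ]} {x : ℝ} (hu : ∀ y, (u y).imI = 0)
    (h : HasDerivAt u u' x) : u'.imI = 0 := by
  have h1 := h.inner ℝ (hasDerivAt_const x unitI)
  have h2 : (fun y => inner ℝ (u y) unitI : ℝ → ℝ) = fun _ => 0 := by
    ext y; rw [inner_eq]; simp [hu]
  rw [h2] at h1
  have h3 := h1.unique (hasDerivAt_const x (0 : ℝ))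
  rw [inner_eq] at h3
  simpa [inner_eq] using h3

instance : StarModule ℝ ℍ[ℝ] where
  star_smul r q := by rw [Quaternion.star_smul, star_trivial r]

lemma contDiff_star : ContDiff ℝ ∞ (fun q : ℍ[ℝ] => star q) :=
  (starL' ℝ (A := ℍ[ℝ])).contDiff

namespace IsSphereCurve

variable {c : ℝ → ℍ[ℝ]} (hc : IsSphereCurve c)
include hc

lemma contDiff_deriv : ContDiff ℝ ∞ (deriv c) :=
  ((contDiff_infty_iff_deriv).1 hc.contDiff).2

lemma speed_pos (x : ℝ) : 0 < ‖deriv c x‖ := norm_pos_iff.2 (hc.deriv_ne_zero x)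

lemma contDiff_speed_inv : ContDiff ℝ ∞ (fun x => ‖deriv c x‖⁻¹) :=
  (hc.contDiff_deriv.norm ℝ hc.deriv_ne_zero).inv fun x => (hc.speed_pos x).ne'

lemma contDiff_ds {V : ℝ → ℍ[ℝ]} (hV : ContDiff ℝ ∞ V) : ContDiff ℝ ∞ (ds c V) :=
  hc.contDiff_speed_inv.smul ((contDiff_infty_iff_deriv).1 hV).2

lemma contDiff_tangent : ContDiff ℝ ∞ (tangent c) := hc.contDiff_ds hc.contDiff

lemma contDiff_covDeriv {V : ℝ → ℍ[ℝ]} (hV : ContDiff ℝ ∞ V) : ContDiff ℝ ∞ (covDeriv c V) :=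
  (hc.contDiff_ds hV).sub (((hc.contDiff_ds hV).inner ℝ hc.contDiff).smul hc.contDiff)

lemma contDiff_curvature : ContDiff ℝ ∞ (curvature c) := hc.contDiff_covDeriv hc.contDiff_tangent

lemma contDiff_unitNormal : ContDiff ℝ ∞ (unitNormal c) :=
  ((hc.contDiff_tangent.mul (contDiff_star.comp hc.contDiff)).mul contDiff_const).neg

lemma contDiff_signedCurv : ContDiff ℝ ∞ (signedCurv c) :=
  hc.contDiff_curvature.inner ℝ hc.contDiff_unitNormal

lemma contDiff_arcDeriv {f : ℝ → ℝ} (hf : ContDiff ℝ ∞ f) : ContDiff ℝ ∞ (arcDeriv c f) :=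
  hc.contDiff_speed_inv.mul ((contDiff_infty_iff_deriv).1 hf).2

omit hc in
lemma _root_.HopfWillmore.hasDerivAt_of_contDiff {E : Type*} [NormedAddCommGroup E]
    [NormedSpace ℝ E] {f : ℝ → E} (hf : ContDiff ℝ ∞ f) (x : ℝ) : HasDerivAt f (deriv f x) x :=
  (hf.differentiable (by simp) x).hasDerivAt

lemma norm_tangent (x : ℝ) : ‖tangent c x‖ = 1 := by
  rw [tangent, ds, norm_smul, norm_inv, norm_norm, inv_mul_cancel₀ (hc.speed_pos x).ne']

lemma deriv_eq (x : ℝ) : deriv c x = ‖deriv c x‖ • tangent c x := by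
  rw [tangent, ds, smul_smul, mul_inv_cancel₀ (hc.speed_pos x).ne', one_smul]

lemma isFrame (x : ℝ) : IsFrame (c x) (tangent c x) where
  imI_left := hc.imI_eq_zero x
  imI_right := by
    simp [tangent, ds, imI_deriv_eq_zero hc.imI_eq_zero (hasDerivAt_of_contDiff hc.contDiff x)]
  norm_left := hc.norm_eq_one x
  norm_right := hc.norm_tangent x
  inner_eq_zero := by
    rw [real_inner_comm, tangent, ds, inner_smul_left,
      inner_deriv_eq_zero_of_norm hc.norm_eq_one (hasDerivAt_of_contDiff hc.contDiff x), mul_zero]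

/-- Expansion in the frame `c, t, n` of `span {1, j, k}`. -/
lemma expand (x : ℝ) {w : ℍ[ℝ]} (hw : w.imI = 0) :
    w = (inner ℝ w (c x) : ℝ) • c x + (inner ℝ w (tangent c x) : ℝ) • tangent c x
      + (inner ℝ w (unitNormal c x) : ℝ) • unitNormal c x := by
  have h := orthonormal_expand ((hc.isFrame x).orthonormal_mul (L := 1) (by simp)) w
  have h4 : inner ℝ w unitI = (0 : ℝ) := by rw [inner_eq]; simp [hw]
  simpa [h4, unitNormal] using h

lemma inner_deriv_tangent (x : ℝ) : inner ℝ (deriv (tangent c) x) (c x) = -‖deriv c x‖ := by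
  have h := (hasDerivAt_of_contDiff hc.contDiff_tangent x).inner ℝ
    (hasDerivAt_of_contDiff hc.contDiff x)
  have h2 : (fun y => inner ℝ (tangent c y) (c y) : ℝ → ℝ) = fun _ => 0 := by
    ext y; rw [real_inner_comm, (hc.isFrame y).inner_eq_zero]
  rw [h2] at h
  have h3 := h.unique (hasDerivAt_const x (0 : ℝ))
  rw [hc.deriv_eq x, inner_smul_right, real_inner_self_eq_norm_sq, hc.norm_tangent] at h3
  simp at h3
  linarith

lemma curvature_imI (x : ℝ) : (curvature c x).imI = 0 := by
  have h := imI_deriv_eq_zero (fun y => (hc.isFrame y).imI_right)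
    (hasDerivAt_of_contDiff hc.contDiff_tangent x)
  simp [curvature, covDeriv, ds, h, hc.imI_eq_zero]

lemma curvature_eq (x : ℝ) : curvature c x = signedCurv c x • unitNormal c x := by
  have h := hc.expand x (hc.curvature_imI x)
  have h1 : inner ℝ (curvature c x) (c x) = (0 : ℝ) := by
    rw [curvature, covDeriv, inner_sub_left, inner_smul_left, real_inner_self_eq_norm_sq,
      hc.norm_eq_one]
    simp
  have h2 : inner ℝ (curvature c x) (tangent c x) = (0 : ℝ) := by
    rw [curvature, covDeriv, inner_sub_left, inner_smul_left, (hc.isFrame x).inner_eq_zero, ds,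
      inner_smul_left, inner_deriv_eq_zero_of_norm hc.norm_tangent
        (hasDerivAt_of_contDiff hc.contDiff_tangent x)]
    simp
  rw [h1, h2] at h
  simpa [signedCurv] using h

/-- First Frenet equation. The summand `-c` is the curvature of the sphere itself, forced by ⟨t, c⟩
= 0. -/
lemma deriv_tangent (x : ℝ) :
    deriv (tangent c) x = ‖deriv c x‖ • (signedCurv c x • unitNormal c x - c x) := by
  have hv := (hc.speed_pos x).ne'
  rw [← hc.curvature_eq, curvature, covDeriv, ds, inner_smul_left, hc.inner_deriv_tangent]
  simp only [conj_trivial, mul_neg, inv_mul_cancel₀ hv, neg_smul, one_smul, sub_neg_eq_add,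
    add_sub_cancel_right, smul_smul, mul_inv_cancel₀ hv]

lemma deriv_unitNormal (x : ℝ) :
    deriv (unitNormal c) x = -((‖deriv c x‖ * signedCurv c x) • tangent c x) := by
  have hF := hc.isFrame x
  have h1 := (((hasDerivAt_of_contDiff hc.contDiff_tangent x).mul
    (hasDerivAt_of_contDiff hc.contDiff x).star).mul (hasDerivAt_const x unitI)).neg
  have h2 : deriv (unitNormal c) x = _ := h1.deriv
  rw [h2, hc.deriv_tangent, hc.deriv_eq x]
  simp only [norm_smul, norm_norm, hc.norm_tangent, mul_one, mul_zero, add_zero]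
  -- For n = -t c̄ i, differentiating c̄ contributes |c'| and the `-c` part of t' contributes -|c'|.
  -- These cancel, and n c̄ i = t leaves the second Frenet equation.
  rw [star_smul, star_trivial ‖deriv c x‖, mul_smul_comm, mul_star_of_norm (hc.norm_tangent x), smul_mul_assoc,
    sub_mul, mul_star_of_norm (hc.norm_eq_one x), add_mul, smul_mul_assoc, smul_mul_assoc,
    sub_mul, smul_mul_assoc, smul_mul_assoc, unitNormal, hF.binormal_mul_star_unitI, smul_sub,
    smul_smul, one_mul, sub_add_cancel]

/-- The derivative of the unit normal is tangential, so the unit normal is parallel in the normal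
bundle and only the coefficient is differentiated. -/
lemma normalDeriv_smul {f : ℝ → ℝ} (hf : ContDiff ℝ ∞ f) (x : ℝ) :
    normalDeriv c (fun y => f y • unitNormal c y) x = arcDeriv c f x • unitNormal c x := by
  have hv := (hc.speed_pos x).ne'
  have hF := hc.isFrame x
  have h1 : deriv (fun y => f y • unitNormal c y) x
      = -((f x * ‖deriv c x‖ * signedCurv c x) • tangent c x) + deriv f x • unitNormal c x := by
    have := ((hasDerivAt_of_contDiff hf x).smul
      (hasDerivAt_of_contDiff hc.contDiff_unitNormal x)).deriv
    change deriv (f • unitNormal c) x = _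
    rw [this, hc.deriv_unitNormal, smul_neg, smul_smul, mul_assoc]
  have hds : ds c (fun y => f y • unitNormal c y) x
      = -((f x * signedCurv c x) • tangent c x) + arcDeriv c f x • unitNormal c x := by
    rw [ds, h1, smul_add, smul_neg, smul_smul, smul_smul, arcDeriv]
    congr 3
    field_simp
  have hcn : inner ℝ (unitNormal c x) (c x) = (0 : ℝ) := by
    rw [real_inner_comm]; exact hF.inner_binormal
  have htn : inner ℝ (unitNormal c x) (tangent c x) = (0 : ℝ) := by
    rw [real_inner_comm]; exact hF.inner_binormal_right
  have htc : inner ℝ (tangent c x) (c x) = (0 : ℝ) := by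
    rw [real_inner_comm]; exact hF.inner_eq_zero
  have hcov : covDeriv c (fun y => f y • unitNormal c y) x
      = -((f x * signedCurv c x) • tangent c x) + arcDeriv c f x • unitNormal c x := by
    rw [covDeriv, hds, inner_add_left, inner_neg_left, inner_smul_left, inner_smul_left, hcn, htc]
    simp
  rw [normalDeriv, hcov, inner_add_left, inner_neg_left, inner_smul_left, inner_smul_left, htn,
    real_inner_self_eq_norm_sq, hc.norm_tangent]
  simp

lemma elasticGrad_eq (x : ℝ) :
    elasticGrad c x = (2 * arcDeriv c (arcDeriv c (signedCurv c)) x + signedCurv c x ^ 3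
      + signedCurv c x) • unitNormal c x := by
  have h1 : curvature c = fun y => signedCurv c y • unitNormal c y := funext hc.curvature_eq
  have h2 : normalDeriv c (curvature c)
      = fun y => arcDeriv c (signedCurv c) y • unitNormal c y := by
    funext y
    rw [h1, hc.normalDeriv_smul hc.contDiff_signedCurv]
  have h3 : ‖curvature c x‖ ^ 2 = signedCurv c x ^ 2 := by
    rw [hc.curvature_eq, norm_smul, unitNormal, (hc.isFrame x).norm_binormal, mul_one,
      Real.norm_eq_abs, sq_abs]
  rw [elasticGrad, h3, h2, hc.normalDeriv_smul (hc.contDiff_arcDeriv hc.contDiff_signedCurv),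
    hc.curvature_eq, smul_smul, smul_smul, ← add_smul, ← add_smul]
  ring_nf

lemma contDiff_elasticGrad : ContDiff ℝ ∞ (elasticGrad c) := by
  have : elasticGrad c = fun x => (2 * arcDeriv c (arcDeriv c (signedCurv c)) x
      + signedCurv c x ^ 3 + signedCurv c x) • unitNormal c x := funext hc.elasticGrad_eq
  rw [this]
  have h := hc.contDiff_signedCurv
  exact (((contDiff_const.mul (hc.contDiff_arcDeriv (hc.contDiff_arcDeriv h))).add
    (h.pow 3)).add h).smul hc.contDiff_unitNormal

end IsSphereCurve

end

end HopfWillmore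

namespace HopfWillmore

noncomputable section

/-! ### Surfaces over a curve in the two-sphere -/

open Curve

namespace Surface

/-- The `i`-th partial derivative of a real function. -/
def pdr (i : Fin 2) (f : EuclideanSpace ℝ (Fin 2) → ℝ) (p : EuclideanSpace ℝ (Fin 2)) : ℝ :=
  fderiv ℝ f p (EuclideanSpace.single i 1)

section Rules

variable {U V : EuclideanSpace ℝ (Fin 2) → ℍ[ℝ]} {f g : EuclideanSpace ℝ (Fin 2) → ℝ}
  {p : EuclideanSpace ℝ (Fin 2)} (i : Fin 2)

lemma pd_congr (h : U =ᶠ[nhds p] V) : pd i U p = pd i V p := by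
  rw [pd, pd, h.fderiv_eq]

lemma pd_mul (hU : DifferentiableAt ℝ U p) (hV : DifferentiableAt ℝ V p) :
    pd i (fun q => U q * V q) p = pd i U p * V p + U p * pd i V p := by
  rw [pd, fderiv_fun_mul' hU hV]
  simp [pd, add_comm]

lemma pd_const (w : ℍ[ℝ]) : pd i (fun _ => w) p = 0 := by
  simp [pd]

lemma pd_add (hU : DifferentiableAt ℝ U p) (hV : DifferentiableAt ℝ V p) :
    pd i (fun q => U q + V q) p = pd i U p + pd i V p := by
  rw [pd, fderiv_fun_add hU hV]
  simp [pd]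

lemma pd_smul (hf : DifferentiableAt ℝ f p) (hV : DifferentiableAt ℝ V p) :
    pd i (fun q => f q • V q) p = pdr i f p • V p + f p • pd i V p := by
  rw [pd, fderiv_fun_smul hf hV]
  simp [pd, pdr, add_comm]

lemma pd_twist (hV : DifferentiableAt ℝ V p) :
    pd i (fun q => twist (V q)) p = twist (pd i V p) := by
  have h1 : (fun q => twist (V q)) = fun q => (-unitI * V q) * unitI := by
    ext1 q; simp [twist]
  rw [h1, pd_mul i (by fun_prop) (by fun_prop), pd_mul i (by fun_prop) hV, pd_const, pd_const]
  simp [twist]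

lemma pd_comp {u : ℝ → ℍ[ℝ]} (hu : DifferentiableAt ℝ u (f p)) (hf : DifferentiableAt ℝ f p) :
    pd i (fun q => u (f q)) p = pdr i f p • deriv u (f p) := by
  have h := hu.hasFDerivAt.comp p hf.hasFDerivAt
  have h1 : fderiv ℝ (fun q => u (f q)) p = _ := h.fderiv
  rw [pd, h1, ContinuousLinearMap.comp_apply, fderiv_eq_smul_deriv, pdr]

lemma pdr_comp {u : ℝ → ℝ} (hu : DifferentiableAt ℝ u (f p)) (hf : DifferentiableAt ℝ f p) :
    pdr i (fun q => u (f q)) p = deriv u (f p) * pdr i f p := by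
  have h := hu.hasDerivAt.comp_hasFDerivAt p hf.hasFDerivAt
  have h1 : fderiv ℝ (fun q => u (f q)) p = _ := h.fderiv
  rw [pdr, h1]
  simp [pdr]

lemma pdr_mul (hf : DifferentiableAt ℝ f p) (hg : DifferentiableAt ℝ g p) :
    pdr i (fun q => f q * g q) p = f p * pdr i g p + g p * pdr i f p := by
  rw [pdr, fderiv_fun_mul hf hg]
  simp [pdr]

end Rules

lemma contDiffOn_pd {V : EuclideanSpace ℝ (Fin 2) → ℍ[ℝ]} {W : Set (EuclideanSpace ℝ (Fin 2))}
    (hW : IsOpen W) (hV : ContDiffOn ℝ ∞ V W) (i : Fin 2) : ContDiffOn ℝ ∞ (pd i V) W :=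
  (hV.fderiv_of_isOpen hW (m := ∞) (by simp)).clm_apply contDiffOn_const

lemma contDiffOn_pdr {f : EuclideanSpace ℝ (Fin 2) → ℝ} {W : Set (EuclideanSpace ℝ (Fin 2))}
    (hW : IsOpen W) (hf : ContDiffOn ℝ ∞ f W) (i : Fin 2) : ContDiffOn ℝ ∞ (pdr i f) W :=
  (hf.fderiv_of_isOpen hW (m := ∞) (by simp)).clm_apply contDiffOn_const

lemma _root_.HopfWillmore.differentiableAt_of_contDiffOn {E F : Type*} [NormedAddCommGroup E]
    [NormedSpace ℝ E] [NormedAddCommGroup F] [NormedSpace ℝ F] {f : E → F} {W : Set E} {p : E}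
    (hW : IsOpen W) (hf : ContDiffOn ℝ ∞ f W) (hp : p ∈ W) : DifferentiableAt ℝ f p :=
  ((hf.contDiffAt (hW.mem_nhds hp)).differentiableAt (by simp))

lemma inner_pd_eq_zero
    {G : EuclideanSpace ℝ (Fin 2) → ℍ[ℝ]} {W : Set (EuclideanSpace ℝ (Fin 2))} (hW : IsOpen W)
    {p : EuclideanSpace ℝ (Fin 2)} (hp : p ∈ W)
    (hG : DifferentiableAt ℝ G p) (hn : ∀ p ∈ W, ‖G p‖ = 1) (i : Fin 2) :
    inner ℝ (pd i G p) (G p) = (0 : ℝ) := by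
  have h1 := (hG.hasFDerivAt.inner ℝ hG.hasFDerivAt).fderiv
  have h2 : (fun y => inner ℝ (G y) (G y) : _ → ℝ) =ᶠ[nhds p] fun _ => 1 := by
    filter_upwards [hW.mem_nhds hp] with y hy
    rw [real_inner_self_eq_norm_sq, hn y hy, one_pow]
  rw [h2.fderiv_eq] at h1
  have h3 := DFunLike.congr_fun h1 (EuclideanSpace.single i 1)
  simp [real_inner_comm] at h3
  rw [pd, real_inner_comm]
  linarith

/-- A parametrized immersed surface in the three-sphere which the Hopf fibration maps to a curve. -/
structure IsHopfSurface (W : Set (EuclideanSpace ℝ (Fin 2)))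
    (G : EuclideanSpace ℝ (Fin 2) → ℍ[ℝ]) (c : ℝ → ℍ[ℝ])
    (φ : EuclideanSpace ℝ (Fin 2) → ℝ) : Prop where
  isOpen : IsOpen W
  contDiffOn : ContDiffOn ℝ ∞ G W
  norm_eq_one : ∀ p ∈ W, ‖G p‖ = 1
  det_ne_zero : ∀ p ∈ W, (metric G p).det ≠ 0
  isSphereCurve : IsSphereCurve c
  contDiffOn_param : ContDiffOn ℝ ∞ φ W
  hopf_eq : ∀ p ∈ W, hopf (G p) = c (φ p)

/-- The horizontal unit tangent field over a curve. -/
def horizontal (G : EuclideanSpace ℝ (Fin 2) → ℍ[ℝ]) (c : ℝ → ℍ[ℝ])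
    (φ : EuclideanSpace ℝ (Fin 2) → ℝ) (p : EuclideanSpace ℝ (Fin 2)) : ℍ[ℝ] :=
  twist (G p) * tangent c (φ p)

/-- The unit normal field over a curve. -/
def normal (G : EuclideanSpace ℝ (Fin 2) → ℍ[ℝ]) (c : ℝ → ℍ[ℝ])
    (φ : EuclideanSpace ℝ (Fin 2) → ℝ) (p : EuclideanSpace ℝ (Fin 2)) : ℍ[ℝ] :=
  twist (G p) * unitNormal c (φ p)

/-- The unit tangent field of the Hopf fibres. -/
def vertical (G : EuclideanSpace ℝ (Fin 2) → ℍ[ℝ]) (p : EuclideanSpace ℝ (Fin 2)) : ℍ[ℝ] :=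
  twist (G p) * unitI

/-- The horizontal component of the differential. -/
def horComp (c : ℝ → ℍ[ℝ]) (φ : EuclideanSpace ℝ (Fin 2) → ℝ) (i : Fin 2)
    (p : EuclideanSpace ℝ (Fin 2)) : ℝ :=
  ‖deriv c (φ p)‖ / 2 * pdr i φ p

/-- The vertical component of the differential. -/
def verComp (G : EuclideanSpace ℝ (Fin 2) → ℍ[ℝ]) (i : Fin 2)
    (p : EuclideanSpace ℝ (Fin 2)) : ℝ :=
  inner ℝ (pd i G p) (vertical G p)

/-! ### Structure equations of the adapted frame and the curvature of Hopf surfaces. -/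

namespace IsHopfSurface

variable {W : Set (EuclideanSpace ℝ (Fin 2))} {G : EuclideanSpace ℝ (Fin 2) → ℍ[ℝ]}
  {c : ℝ → ℍ[ℝ]} {φ : EuclideanSpace ℝ (Fin 2) → ℝ} (h : IsHopfSurface W G c φ)
  {p : EuclideanSpace ℝ (Fin 2)} (hp : p ∈ W)

include h

lemma contDiffOn_twist : ContDiffOn ℝ ∞ (fun p => twist (G p)) W :=
  ((contDiffOn_const.mul h.contDiffOn).mul contDiffOn_const).neg

lemma contDiffOn_horizontal : ContDiffOn ℝ ∞ (horizontal G c φ) W :=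
  h.contDiffOn_twist.mul
    (h.isSphereCurve.contDiff_tangent.comp_contDiffOn h.contDiffOn_param)

lemma contDiffOn_normal : ContDiffOn ℝ ∞ (normal G c φ) W :=
  h.contDiffOn_twist.mul
    (h.isSphereCurve.contDiff_unitNormal.comp_contDiffOn h.contDiffOn_param)

lemma contDiffOn_vertical : ContDiffOn ℝ ∞ (vertical G) W :=
  h.contDiffOn_twist.mul contDiffOn_const

lemma contDiffOn_horComp (i : Fin 2) : ContDiffOn ℝ ∞ (horComp c φ i) W :=
  (((h.isSphereCurve.contDiff_deriv.norm ℝ h.isSphereCurve.deriv_ne_zero).div_const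
    2).comp_contDiffOn h.contDiffOn_param).mul (contDiffOn_pdr h.isOpen h.contDiffOn_param i)

lemma contDiffOn_verComp (i : Fin 2) : ContDiffOn ℝ ∞ (verComp G i) W :=
  (contDiffOn_pd h.isOpen h.contDiffOn i).inner ℝ h.contDiffOn_vertical

include hp

lemma differentiableAt_param : DifferentiableAt ℝ φ p :=
  differentiableAt_of_contDiffOn h.isOpen h.contDiffOn_param hp

lemma differentiableAt : DifferentiableAt ℝ G p :=
  differentiableAt_of_contDiffOn h.isOpen h.contDiffOn hp

lemma differentiableAt_twist : DifferentiableAt ℝ (fun p => twist (G p)) p :=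
  differentiableAt_of_contDiffOn h.isOpen h.contDiffOn_twist hp

lemma norm_twist_eq : ‖twist (G p)‖ = 1 := by rw [norm_twist, h.norm_eq_one p hp]

lemma twist_mul_curve : twist (G p) * c (φ p) = G p := by
  rw [← h.hopf_eq p hp, twist_mul_hopf (h.norm_eq_one p hp)]

lemma orthonormal :
    Orthonormal ℝ ![G p, horizontal G c φ p, normal G c φ p, vertical G p] := by
  have := (h.isSphereCurve.isFrame (φ p)).orthonormal_mul (h.norm_twist_eq hp)
  rwa [h.twist_mul_curve hp] at this

lemma inner_horizontal : inner ℝ (G p) (horizontal G c φ p) = (0 : ℝ) :=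
  (h.orthonormal hp).2 (i := 0) (j := 1) (by decide)

lemma inner_normal : inner ℝ (G p) (normal G c φ p) = (0 : ℝ) :=
  (h.orthonormal hp).2 (i := 0) (j := 2) (by decide)

lemma inner_vertical : inner ℝ (G p) (vertical G p) = (0 : ℝ) :=
  (h.orthonormal hp).2 (i := 0) (j := 3) (by decide)

lemma inner_horizontal_normal : inner ℝ (horizontal G c φ p) (normal G c φ p) = (0 : ℝ) :=
  (h.orthonormal hp).2 (i := 1) (j := 2) (by decide)

lemma inner_horizontal_vertical : inner ℝ (horizontal G c φ p) (vertical G p) = (0 : ℝ) :=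
  (h.orthonormal hp).2 (i := 1) (j := 3) (by decide)

lemma inner_normal_vertical : inner ℝ (normal G c φ p) (vertical G p) = (0 : ℝ) :=
  (h.orthonormal hp).2 (i := 2) (j := 3) (by decide)

lemma inner_horizontal_self : inner ℝ (horizontal G c φ p) (horizontal G c φ p) = (1 : ℝ) := by
  have : ‖horizontal G c φ p‖ = 1 := (h.orthonormal hp).1 1
  rw [real_inner_self_eq_norm_sq, this, one_pow]

lemma inner_normal_self : inner ℝ (normal G c φ p) (normal G c φ p) = (1 : ℝ) := by
  have : ‖normal G c φ p‖ = 1 := (h.orthonormal hp).1 2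
  rw [real_inner_self_eq_norm_sq, this, one_pow]

lemma inner_vertical_self : inner ℝ (vertical G p) (vertical G p) = (1 : ℝ) := by
  have : ‖vertical G p‖ = 1 := (h.orthonormal hp).1 3
  rw [real_inner_self_eq_norm_sq, this, one_pow]

/-- Expansion in the adapted frame. -/
lemma expand (w : ℍ[ℝ]) :
    w = (inner ℝ w (G p) : ℝ) • G p + (inner ℝ w (horizontal G c φ p) : ℝ) • horizontal G c φ p
      + (inner ℝ w (normal G c φ p) : ℝ) • normal G c φ p
      + (inner ℝ w (vertical G p) : ℝ) • vertical G p :=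
  orthonormal_expand (h.orthonormal hp) w

/-- Differentiating `G = twist G * c ∘ φ` expresses ∂G through `twist (∂G) * c`. The map v ↦ twist v
* c keeps the fibre direction and negates the horizontal and normal ones. Hence twice the horizontal
part of ∂G is the lifted derivative of the curve, the normal part vanishes, and the fibre part stays
free. -/
lemma pd_eq (i : Fin 2) :
    pd i G p = horComp c φ i p • horizontal G c φ p + verComp G i p • vertical G p := by
  have hF := h.isSphereCurve.isFrame (φ p)
  have hφ := h.differentiableAt_param hp
  have h1 := h.expand hp (pd i G p)
  rw [inner_pd_eq_zero h.isOpen hp (h.differentiableAt hp) h.norm_eq_one, zero_smul,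
    zero_add] at h1
  set β : ℝ := inner ℝ (pd i G p) (horizontal G c φ p) with hβ
  set δ : ℝ := inner ℝ (pd i G p) (normal G c φ p) with hδ
  change _ = _ + verComp G i p • _ at h1
  set b := verComp G i p with hb
  have h2 : pd i G p = twist (pd i G p) * c (φ p)
      + twist (G p) * (pdr i φ p • deriv c (φ p)) := by
    have hcongr : G =ᶠ[nhds p] fun q => twist (G q) * c (φ q) := by
      filter_upwards [h.isOpen.mem_nhds hp] with y hy using (h.twist_mul_curve hy).symm
    have hcd : DifferentiableAt ℝ c (φ p) :=
      (hasDerivAt_of_contDiff h.isSphereCurve.contDiff _).differentiableAt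
    have h1 : pd i (fun q => twist (G q) * c (φ q)) p = _ :=
      pd_mul i (h.differentiableAt_twist hp) (hcd.comp p hφ)
    rw [pd_twist i (h.differentiableAt hp)] at h1
    change _ = _ + _ * pd i (fun q => c (φ q)) p at h1
    rw [pd_comp i hcd hφ] at h1
    rw [← h1, pd_congr i hcongr]
  have h3 : twist (pd i G p) * c (φ p)
      = -(β • horizontal G c φ p) - δ • normal G c φ p + b • vertical G p := by
    rw [h1, twist_add, twist_add, twist_smul, twist_smul, twist_smul, horizontal, normal, vertical,
      twist_mul, twist_mul, twist_mul, twist_twist, twist_unitI, twist_of_imI hF.imI_right,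
      unitNormal, twist_of_imI hF.binormal_imI]
    have hG : ∀ w, G p * w = twist (G p) * (c (φ p) * w) := fun w => by
      rw [← mul_assoc, h.twist_mul_curve hp]
    simp only [add_mul, smul_mul_assoc, hG]
    rw [mul_assoc (twist (G p)), mul_assoc (twist (G p)), mul_assoc (twist (G p)),
      hF.mul_star_mul_left, hF.mul_star_binormal_mul_left, hF.mul_unitI_left]
    simp [sub_eq_add_neg]
  rw [h3, h.isSphereCurve.deriv_eq, mul_smul_comm, mul_smul_comm, ← horizontal] at h2
  have h4 : (2 * β - pdr i φ p * ‖deriv c (φ p)‖) • horizontal G c φ p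
      + (2 * δ) • normal G c φ p = 0 := by
    have := h1.symm.trans h2
    rw [← sub_eq_zero] at this
    rw [← this]
    module
  have h5 : 2 * β - pdr i φ p * ‖deriv c (φ p)‖ = 0 := by
    have := congrArg (fun w => (inner ℝ w (horizontal G c φ p) : ℝ)) h4
    simpa only [inner_add_left, real_inner_smul_left, h.inner_horizontal_self hp,
      real_inner_comm (horizontal G c φ p) (normal G c φ p), h.inner_horizontal_normal hp,
      mul_zero, add_zero, mul_one, inner_zero_left] using this
  have h6 : δ = 0 := by
    have := congrArg (fun w => (inner ℝ w (normal G c φ p) : ℝ)) h4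
    simpa only [inner_add_left, real_inner_smul_left, h.inner_normal_self hp,
      h.inner_horizontal_normal hp, mul_zero, zero_add, mul_one, inner_zero_left, mul_eq_zero,
      OfNat.ofNat_ne_zero, false_or] using this
  rw [h1, h6, zero_smul, add_zero]
  congr 2
  rw [horComp]
  linarith

omit h hp in
lemma speed_mul_pdr (i : Fin 2) : pdr i φ p * ‖deriv c (φ p)‖ = 2 * horComp c φ i p := by
  rw [horComp]; ring

lemma pd_twist_eq (i : Fin 2) :
    pd i (fun q => twist (G q)) p = twist (G p) *
      (-(horComp c φ i p • (tangent c (φ p) * star (c (φ p))))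
        + verComp G i p • (c (φ p) * unitI)) := by
  have hF := h.isSphereCurve.isFrame (φ p)
  rw [pd_twist i (h.differentiableAt hp), h.pd_eq hp i, twist_add, twist_smul, twist_smul,
    horizontal, vertical, twist_mul, twist_mul, twist_twist, twist_unitI,
    twist_of_imI hF.imI_right, ← smul_neg, ← eq_neg_of_add_eq_zero_left hF.mul_star_add]
  have hG : ∀ w, G p * w = twist (G p) * (c (φ p) * w) := fun w => by
    rw [← mul_assoc, h.twist_mul_curve hp]
  rw [hG, hG]
  simp only [mul_add, mul_smul_comm]

/-- The factor 2 at the curvature appears because the curve is traversed at twice the horizontal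
speed; `verComp` enters through the rotation of the frame along the fibres. As in `pd_vertical`, no
tangential part occurs. -/
lemma pd_horizontal (i : Fin 2) :
    pd i (horizontal G c φ) p
      = (2 * horComp c φ i p * signedCurv c (φ p) + verComp G i p) • normal G c φ p
        - horComp c φ i p • G p := by
  have hF := h.isSphereCurve.isFrame (φ p)
  have hφ := h.differentiableAt_param hp
  have hd : DifferentiableAt ℝ (tangent c) (φ p) :=
    (hasDerivAt_of_contDiff h.isSphereCurve.contDiff_tangent _).differentiableAt
  have h1 : pd i (horizontal G c φ) p = _ :=
    pd_mul i (h.differentiableAt_twist hp) (hd.comp p hφ)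
  rw [h1, h.pd_twist_eq hp]
  change _ + _ * pd i (fun q => tangent c (φ q)) p = _
  rw [pd_comp i hd hφ, h.isSphereCurve.deriv_tangent, smul_smul, speed_mul_pdr, mul_assoc,
    add_mul, neg_mul, smul_mul_assoc, smul_mul_assoc]
  change _ * (-(_ • (_ * _ * tangent c (φ p))) + _ • (_ * _ * tangent c (φ p))) + _ = _
  rw [hF.mul_star_right, hF.mul_unitI_right, ← unitNormal]
  simp only [mul_add, mul_smul_comm, mul_sub, smul_neg, neg_neg, h.twist_mul_curve hp]
  rw [← normal]
  module

lemma pd_normal (i : Fin 2) :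
    pd i (normal G c φ) p
      = -((2 * horComp c φ i p * signedCurv c (φ p) + verComp G i p) • horizontal G c φ p)
        - horComp c φ i p • vertical G p := by
  have hF := h.isSphereCurve.isFrame (φ p)
  have hφ := h.differentiableAt_param hp
  have hd : DifferentiableAt ℝ (unitNormal c) (φ p) :=
    (hasDerivAt_of_contDiff h.isSphereCurve.contDiff_unitNormal _).differentiableAt
  have h1 : pd i (normal G c φ) p = _ :=
    pd_mul i (h.differentiableAt_twist hp) (hd.comp p hφ)
  rw [h1, h.pd_twist_eq hp]
  change _ + _ * pd i (fun q => unitNormal c (φ q)) p = _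
  rw [pd_comp i hd hφ, h.isSphereCurve.deriv_unitNormal, mul_assoc,
    add_mul, neg_mul, smul_mul_assoc, smul_mul_assoc]
  change _ * (-(_ • (_ * _ * unitNormal c (φ p))) + _ • (_ * _ * unitNormal c (φ p))) + _ = _
  rw [unitNormal, hF.mul_star_binormal, hF.mul_unitI_binormal, smul_neg, smul_neg, smul_smul, ← mul_assoc,
    speed_mul_pdr]
  simp only [mul_add, mul_smul_comm, mul_neg]
  rw [← horizontal, ← vertical]
  module

lemma pd_vertical (i : Fin 2) :
    pd i (vertical G) p = horComp c φ i p • normal G c φ p - verComp G i p • G p := by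
  have h1 : pd i (vertical G) p = _ :=
    pd_mul i (h.differentiableAt_twist hp) (differentiableAt_const unitI)
  rw [h1, h.pd_twist_eq hp, pd_const, mul_zero, add_zero, mul_assoc, add_mul, neg_mul,
    smul_mul_assoc, smul_mul_assoc, IsFrame.mul_star_unitI, unitI_mul_unitI_assoc, ← unitNormal]
  simp only [mul_add, mul_smul_comm, mul_neg, smul_neg, neg_neg, h.twist_mul_curve hp]
  rw [← normal]
  module

lemma pd_pd_eq (k l : Fin 2) :
    pd k (pd l G) p = pdr k (horComp c φ l) p • horizontal G c φ p
      + pdr k (verComp G l) p • vertical G p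
      + (2 * signedCurv c (φ p) * horComp c φ k p * horComp c φ l p
        + horComp c φ k p * verComp G l p + verComp G k p * horComp c φ l p) • normal G c φ p
      - (horComp c φ k p * horComp c φ l p + verComp G k p * verComp G l p) • G p := by
  have hcongr : pd l G =ᶠ[nhds p] fun q => horComp c φ l q • horizontal G c φ q
      + verComp G l q • vertical G q := by
    filter_upwards [h.isOpen.mem_nhds hp] with y hy using h.pd_eq hy l
  have d1 := differentiableAt_of_contDiffOn h.isOpen (h.contDiffOn_horComp l) hp
  have d2 := differentiableAt_of_contDiffOn h.isOpen h.contDiffOn_horizontal hp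
  have d3 := differentiableAt_of_contDiffOn h.isOpen (h.contDiffOn_verComp l) hp
  have d4 := differentiableAt_of_contDiffOn h.isOpen h.contDiffOn_vertical hp
  have h1 : pd k (fun q => horComp c φ l q • horizontal G c φ q + verComp G l q • vertical G q) p
      = pd k (fun q => horComp c φ l q • horizontal G c φ q) p
        + pd k (fun q => verComp G l q • vertical G q) p := pd_add k (d1.smul d2) (d3.smul d4)
  rw [pd_congr k hcongr, h1, pd_smul k d1 d2, pd_smul k d3 d4, h.pd_horizontal hp,
    h.pd_vertical hp]
  module

lemma metric_eq (i j : Fin 2) :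
    metric G p i j = horComp c φ i p * horComp c φ j p + verComp G i p * verComp G j p := by
  rw [metric, Matrix.of_apply, h.pd_eq hp i, h.pd_eq hp j]
  simp only [inner_add_left, inner_add_right, real_inner_smul_left, real_inner_smul_right,
    h.inner_horizontal_self hp, h.inner_vertical_self hp, h.inner_horizontal_vertical hp,
    real_inner_comm (horizontal G c φ p) (vertical G p)]
  ring

/-- The metric is the sum of the squares of the two coframe components, and its determinant is the
square of their determinant. So the coframe is nondegenerate and orthonormal for the inverse metric.
-/
lemma inverse_coframe :
    (∑ i, ∑ j, metricInv G p i j * (horComp c φ i p * horComp c φ j p) = 1) ∧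
    (∑ i, ∑ j, metricInv G p i j * (horComp c φ i p * verComp G j p) = 0) ∧
    (∑ i, ∑ j, metricInv G p i j * (verComp G i p * verComp G j p) = 1) := by
  have hd := h.det_ne_zero p hp
  have h2 : metricInv G p = _ := Matrix.inv_def (metric G p)
  rw [Ring.inverse_eq_inv'] at h2
  have h3 : (metric G p).det = (horComp c φ 0 p * verComp G 1 p
      - horComp c φ 1 p * verComp G 0 p) ^ 2 := by
    rw [Matrix.det_fin_two]
    simp only [h.metric_eq hp]
    ring
  have hD : horComp c φ 0 p * verComp G 1 p - horComp c φ 1 p * verComp G 0 p ≠ 0 := by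
    intro h0
    rw [h3, h0] at hd
    simp at hd
  rw [h2, h3, Matrix.adjugate_fin_two]
  simp only [Fin.sum_univ_two, Matrix.smul_apply, Matrix.of_apply, Matrix.cons_val', smul_eq_mul,
    Matrix.cons_val_zero, Matrix.cons_val_one, Matrix.cons_val_fin_one, h.metric_eq hp]
  refine ⟨?_, ?_, ?_⟩ <;> field_simp <;> ring

lemma metricInv_symm (i j : Fin 2) : metricInv G p i j = metricInv G p j i := by
  have h1 : (metric G p).transpose = metric G p := by
    ext i j
    rw [Matrix.transpose_apply, h.metric_eq hp, h.metric_eq hp]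
    ring
  have h2 : (metricInv G p).transpose = metricInv G p := by
    rw [metricInv, Matrix.transpose_nonsing_inv, h1]
  rw [← h2, Matrix.transpose_apply, h2]

lemma inverse_coframe' :
    ∑ i, ∑ j, metricInv G p i j * (verComp G i p * horComp c φ j p) = 0 := by
  rw [Finset.sum_comm, ← (h.inverse_coframe hp).2.1]
  refine Finset.sum_congr rfl fun i _ => Finset.sum_congr rfl fun j _ => ?_
  rw [h.metricInv_symm hp j i]
  ring

/-- The trace of a symmetric form given in the coframe. -/
lemma trace_eq (x y z w : ℝ) :
    ∑ i, ∑ j, metricInv G p i j * (x * (horComp c φ i p * horComp c φ j p)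
      + y * (horComp c φ i p * verComp G j p) + z * (verComp G i p * horComp c φ j p)
      + w * (verComp G i p * verComp G j p)) = x + w := by
  have h1 := h.inverse_coframe hp
  have h2 := h.inverse_coframe' hp
  simp only [Fin.sum_univ_two] at *
  linear_combination x * h1.1 + y * h1.2.1 + z * h2 + w * h1.2.2

lemma projTan_eq (w : ℍ[ℝ]) : projTan G p w
    = (inner ℝ w (horizontal G c φ p) : ℝ) • horizontal G c φ p
      + (inner ℝ w (vertical G p) : ℝ) • vertical G p := by
  have h1 := h.inverse_coframe hp
  have h2 := h.inverse_coframe' hp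
  rw [projTan]
  simp only [h.pd_eq hp, inner_add_right, real_inner_smul_right]
  simp only [Fin.sum_univ_two] at *
  set T := horizontal G c φ p
  set U := vertical G p
  generalize (inner ℝ w T : ℝ) = x
  generalize (inner ℝ w U : ℝ) = y
  obtain ⟨h11, h12, h13⟩ := h1
  match_scalars
  · linear_combination x * h11 + y * h12
  · linear_combination x * h2 + y * h13

lemma perp_eq (w : ℍ[ℝ]) :
    perp G p w = (inner ℝ w (normal G c φ p) : ℝ) • normal G c φ p := by
  rw [perp, h.projTan_eq hp, projS3, inner_sub_left, inner_sub_left, real_inner_smul_left,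
    real_inner_smul_left, h.inner_horizontal hp, h.inner_vertical hp, mul_zero, sub_zero, sub_zero]
  nth_rw 1 [h.expand hp w]
  module

lemma secondFF_eq (i j : Fin 2) : secondFF G i j p
    = (2 * signedCurv c (φ p) * horComp c φ i p * horComp c φ j p
      + horComp c φ i p * verComp G j p + verComp G i p * horComp c φ j p) • normal G c φ p := by
  rw [secondFF, h.perp_eq hp, h.pd_pd_eq hp]
  congr 1
  simp only [inner_sub_left, inner_add_left, real_inner_smul_left, h.inner_normal hp,
    h.inner_horizontal_normal hp, h.inner_normal_self hp,
    real_inner_comm (normal G c φ p) (vertical G p), h.inner_normal_vertical hp]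
  ring

lemma meanCurv_eq : meanCurv G p = (2 * signedCurv c (φ p)) • normal G c φ p := by
  have h1 := h.trace_eq hp (2 * signedCurv c (φ p)) 1 1 0
  rw [add_zero] at h1
  rw [meanCurv, ← h1]
  simp only [h.secondFF_eq hp, Finset.sum_smul, smul_smul]
  refine Finset.sum_congr rfl fun i _ => Finset.sum_congr rfl fun j _ => ?_
  congr 1
  ring

lemma normalDeriv_smul {f : EuclideanSpace ℝ (Fin 2) → ℝ} (hf : DifferentiableAt ℝ f p)
    (i : Fin 2) :
    Surface.normalDeriv G i (fun q => f q • normal G c φ q) p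
      = pdr i f p • normal G c φ p := by
  have d := differentiableAt_of_contDiffOn h.isOpen h.contDiffOn_normal hp
  rw [Surface.normalDeriv, h.perp_eq hp, pd_smul i hf d, h.pd_normal hp]
  congr 1
  simp only [inner_sub_left, inner_add_left, inner_neg_left, real_inner_smul_left,
    h.inner_horizontal_normal hp, h.inner_normal_self hp,
    real_inner_comm (normal G c φ p) (vertical G p), h.inner_normal_vertical hp]
  ring

omit h hp in
lemma _root_.HopfWillmore.Surface.normalDeriv_congr {G : EuclideanSpace ℝ (Fin 2) → ℍ[ℝ]}
    {U V : EuclideanSpace ℝ (Fin 2) → ℍ[ℝ]} {p : EuclideanSpace ℝ (Fin 2)} (i : Fin 2)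
    (hUV : U =ᶠ[nhds p] V) : Surface.normalDeriv G i U p = Surface.normalDeriv G i V p := by
  rw [Surface.normalDeriv, Surface.normalDeriv, pd_congr i hUV]

/-- The derivatives of the horizontal and vertical fields have no tangential part, so the tangential
part of ∂ₖ∂ₗG differentiates only the coefficients. This says that the horizontal coframe is
parallel. -/
lemma christoffel_mul (k l : Fin 2) :
    ∑ m, christoffel G m k l p * horComp c φ m p = pdr k (horComp c φ l) p := by
  have h1 := h.inverse_coframe hp
  have h2 := h.inverse_coframe' hp
  have h3 : ∀ j, inner ℝ (pd k (pd l G) p) (pd j G p)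
      = pdr k (horComp c φ l) p * horComp c φ j p + pdr k (verComp G l) p * verComp G j p := by
    intro j
    rw [h.pd_pd_eq hp, h.pd_eq hp]
    simp only [inner_sub_left, inner_add_left, real_inner_smul_left, inner_add_right,
      real_inner_smul_right, h.inner_horizontal_self hp, h.inner_vertical_self hp,
      h.inner_horizontal_vertical hp, h.inner_horizontal hp, h.inner_vertical hp,
      h.inner_normal_vertical hp, real_inner_comm (horizontal G c φ p) (normal G c φ p),
      h.inner_horizontal_normal hp, real_inner_comm (horizontal G c φ p) (vertical G p)]
    ring
  simp only [christoffel, h3]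
  simp only [Fin.sum_univ_two] at *
  linear_combination pdr k (horComp c φ l) p * h1.1 + pdr k (verComp G l) p * h1.2.1

/-- The factor 2 undoes the half in `horComp`; applied twice it produces the 4 in
`normalLaplacian_eq`. -/
lemma pdr_comp_eq {u : ℝ → ℝ} (hu : ContDiff ℝ ∞ u) (i : Fin 2) :
    pdr i (fun q => u (φ q)) p = 2 * (arcDeriv c u (φ p) * horComp c φ i p) := by
  have hv := (h.isSphereCurve.speed_pos (φ p)).ne'
  rw [pdr_comp i (hasDerivAt_of_contDiff hu _).differentiableAt (h.differentiableAt_param hp),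
    arcDeriv, horComp]
  field_simp

lemma normalLaplacian_eq {u : ℝ → ℝ} (hu : ContDiff ℝ ∞ u) :
    normalLaplacian G (fun q => u (φ q) • normal G c φ q) p
      = (4 * arcDeriv c (arcDeriv c u) (φ p)) • normal G c φ p := by
  have hu1 := h.isSphereCurve.contDiff_arcDeriv hu
  have huφ : ∀ q ∈ W, DifferentiableAt ℝ (fun q => u (φ q)) q := fun q hq =>
    (hasDerivAt_of_contDiff hu _).differentiableAt.comp q (h.differentiableAt_param hq)
  have h1 : ∀ l, ∀ q ∈ W, Surface.normalDeriv G l (fun q => u (φ q) • normal G c φ q) q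
      = (2 * (arcDeriv c u (φ q) * horComp c φ l q)) • normal G c φ q := by
    intro l q hq
    rw [h.normalDeriv_smul hq (huφ q hq), h.pdr_comp_eq hq hu]
  have h2 : ∀ k l, Surface.normalDeriv G k
      (Surface.normalDeriv G l (fun q => u (φ q) • normal G c φ q)) p
      = (4 * arcDeriv c (arcDeriv c u) (φ p) * (horComp c φ k p * horComp c φ l p)
        + 2 * arcDeriv c u (φ p) * pdr k (horComp c φ l) p) • normal G c φ p := by
    intro k l
    have hev : Surface.normalDeriv G l (fun q => u (φ q) • normal G c φ q) =ᶠ[nhds p]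
        fun q => (2 * (arcDeriv c u (φ q) * horComp c φ l q)) • normal G c φ q := by
      filter_upwards [h.isOpen.mem_nhds hp] with q hq using h1 l q hq
    have d1 : DifferentiableAt ℝ (fun q => arcDeriv c u (φ q)) p :=
      (hasDerivAt_of_contDiff hu1 _).differentiableAt.comp p (h.differentiableAt_param hp)
    have d2 := differentiableAt_of_contDiffOn h.isOpen (h.contDiffOn_horComp l) hp
    have d3 : DifferentiableAt ℝ (fun q => arcDeriv c u (φ q) * horComp c φ l q) p := d1.mul d2
    rw [normalDeriv_congr k hev, h.normalDeriv_smul hp (d3.const_mul 2),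
      pdr_mul k (differentiableAt_const _) d3, pdr_mul k d1 d2, h.pdr_comp_eq hp hu1]
    congr 1
    simp [pdr]
    ring
  -- The coframe being parallel, this cancels the derivative of `horComp` in `h2`; the trace then
  -- only meets the square of the horizontal coframe.
  have h3 : ∀ k l, ∑ m, christoffel G m k l p •
        Surface.normalDeriv G m (fun q => u (φ q) • normal G c φ q) p
      = (2 * arcDeriv c u (φ p) * pdr k (horComp c φ l) p) • normal G c φ p := by
    intro k l
    rw [← h.christoffel_mul hp k l, Finset.mul_sum, Finset.sum_smul]
    refine Finset.sum_congr rfl fun m _ => ?_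
    rw [h1 m p hp, smul_smul]
    congr 1
    ring
  have h4 := h.trace_eq hp (4 * arcDeriv c (arcDeriv c u) (φ p)) 0 0 0
  rw [add_zero] at h4
  rw [normalLaplacian, ← h4]
  simp only [h2, h3, Finset.sum_smul]
  refine Finset.sum_congr rfl fun k _ => Finset.sum_congr rfl fun l _ => ?_
  module

lemma traceFree_eq (i j : Fin 2) : traceFree G i j p
    = (signedCurv c (φ p) * (horComp c φ i p * horComp c φ j p - verComp G i p * verComp G j p)
      + horComp c φ i p * verComp G j p + verComp G i p * horComp c φ j p) • normal G c φ p := by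
  rw [traceFree, h.secondFF_eq hp, h.meanCurv_eq hp, h.metric_eq hp]
  module

lemma Q_eq (r : ℝ) : Q G p (r • normal G c φ p)
    = (r * (2 * signedCurv c (φ p) ^ 2 + 2)) • normal G c φ p := by
  have h1 := h.inverse_coframe hp
  have h2 := h.inverse_coframe' hp
  rw [Q]
  simp only [h.traceFree_eq hp, real_inner_smul_left, real_inner_smul_right,
    h.inner_normal_self hp, smul_smul, ← Finset.sum_smul]
  congr 1
  obtain ⟨h11, h12, h13⟩ := h1
  generalize signedCurv c (φ p) = κ
  -- Each full contraction of two products of coframe components factors into two of the traces of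
  -- `inverse_coframe`. With the values 1, 0, 1 the bracket becomes |A⁰|² = 2κ² + 2.
  have key : ∑ i, ∑ j, ∑ k, ∑ l, metricInv G p i k * metricInv G p j l *
      (r * (κ * (horComp c φ k p * horComp c φ l p - verComp G k p * verComp G l p)
        + horComp c φ k p * verComp G l p + verComp G k p * horComp c φ l p)) *
      (κ * (horComp c φ i p * horComp c φ j p - verComp G i p * verComp G j p)
        + horComp c φ i p * verComp G j p + verComp G i p * horComp c φ j p)
      = r * (κ ^ 2 * ((∑ i, ∑ j, metricInv G p i j * (horComp c φ i p * horComp c φ j p)) ^ 2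
          - 2 * (∑ i, ∑ j, metricInv G p i j * (horComp c φ i p * verComp G j p))
            * (∑ i, ∑ j, metricInv G p i j * (horComp c φ i p * verComp G j p))
          + (∑ i, ∑ j, metricInv G p i j * (verComp G i p * verComp G j p)) ^ 2)
        + 2 * (∑ i, ∑ j, metricInv G p i j * (horComp c φ i p * horComp c φ j p))
            * (∑ i, ∑ j, metricInv G p i j * (verComp G i p * verComp G j p))
        + 2 * (∑ i, ∑ j, metricInv G p i j * (horComp c φ i p * verComp G j p)) ^ 2
        + 4 * κ * ((∑ i, ∑ j, metricInv G p i j * (horComp c φ i p * horComp c φ j p))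
            - (∑ i, ∑ j, metricInv G p i j * (verComp G i p * verComp G j p)))
          * (∑ i, ∑ j, metricInv G p i j * (horComp c φ i p * verComp G j p))) := by
    simp only [Fin.sum_univ_two, h.metricInv_symm hp 1 0]
    ring
  simp only [mul_one] at *
  rw [key, h11, h12, h13]
  ring

/-- The coefficient is ½(8κ'' + 2κ(2κ² + 2)) = 2(2κ'' + κ³ + κ), with primes for arc length, which
is twice the elastic one. -/
lemma willmoreGrad_eq :
    willmoreGrad G p = twist (G p) * ((2 : ℝ) • elasticGrad c (φ p)) := by
  have hev : (meanCurv G) =ᶠ[nhds p]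
      fun q => (fun x => 2 * signedCurv c x) (φ q) • normal G c φ q := by
    filter_upwards [h.isOpen.mem_nhds hp] with q hq using h.meanCurv_eq hq
  have hκ := h.isSphereCurve.contDiff_signedCurv
  have hκ1 := h.isSphereCurve.contDiff_arcDeriv hκ
  have h1 : normalLaplacian G (meanCurv G) p = normalLaplacian G
      (fun q => (fun x => 2 * signedCurv c x) (φ q) • normal G c φ q) p := by
    -- The formula for the mean curvature holds on a neighbourhood, so it may be differentiated
    -- twice.
    have hev2 : ∀ l, Surface.normalDeriv G l (meanCurv G) =ᶠ[nhds p] Surface.normalDeriv G l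
      (fun q => (fun x => 2 * signedCurv c x) (φ q) • normal G c φ q) := fun l => by
      filter_upwards [hev.eventually_nhds] with q hq using normalDeriv_congr l hq
    rw [normalLaplacian, normalLaplacian]
    simp only [fun k l => normalDeriv_congr (G := G) k (hev2 l), fun m => (hev2 m).eq_of_nhds]
  have harc : ∀ {f : ℝ → ℝ}, ContDiff ℝ ∞ f →
      arcDeriv c (fun x => 2 * f x) = fun x => 2 * arcDeriv c f x := by
    intro f hf
    funext x
    rw [arcDeriv, deriv_const_mul _ (hasDerivAt_of_contDiff hf x).differentiableAt, arcDeriv]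
    ring
  rw [willmoreGrad, h1, h.normalLaplacian_eq hp (contDiff_const.mul hκ), h.meanCurv_eq hp,
    h.Q_eq hp, harc hκ, harc hκ1, h.isSphereCurve.elasticGrad_eq, smul_smul, mul_smul_comm,
    ← normal]
  module

end IsHopfSurface

end Surface

end

end HopfWillmore

namespace HopfWillmore

noncomputable section

/-! ### Ordinary differential equations on `[0, T]`, depending smoothly on parameters -/

open Filter Topology Function NNReal

namespace TimeODE

/-- Tube lemma: compactness of `[0, T]` makes continuity in the parameter uniform in time. -/
lemma eventually_forall_Icc_dist_lt {P F : Type*} [TopologicalSpace P] [PseudoMetricSpace F]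
    {T : ℝ} {g : ℝ → P → F} (hg : ContinuousOn (uncurry g) (Icc 0 T ×ˢ univ)) (x₀ : P) {ε : ℝ}
    (hε : 0 < ε) : ∀ᶠ x in 𝓝 x₀, ∀ t ∈ Icc 0 T, dist (g t x) (g t x₀) < ε := by
  have h1 : Continuous fun z : P × Icc (0 : ℝ) T => g z.2 z.1 :=
    hg.comp_continuous (f := fun z : P × Icc (0 : ℝ) T => ((z.2 : ℝ), z.1)) (by fun_prop)
      fun z => ⟨z.2.2, mem_univ _⟩
  have h2 : Continuous fun z : P × Icc (0 : ℝ) T => g z.2 x₀ :=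
    h1.comp (f := fun z : P × Icc (0 : ℝ) T => (x₀, z.2)) (by fun_prop)
  have h3 : ∀ᶠ x in 𝓝 x₀, ∀ t ∈ (univ : Set (Icc (0 : ℝ) T)), dist (g t x) (g t x₀) < ε := by
    refine isCompact_univ.eventually_forall_of_forall_eventually fun t _ => ?_
    exact (h1.dist h2).continuousAt.eventually_lt continuousAt_const (by simpa using hε)
  filter_upwards [h3] with x hx t ht using hx ⟨t, ht⟩ (mem_univ _)

lemma exists_bound_Icc {F : Type*} [SeminormedAddCommGroup F] {T : ℝ} {g : ℝ → F}
    (hg : ContinuousOn g (Icc 0 T)) : ∃ C : ℝ, 0 ≤ C ∧ ∀ t ∈ Icc 0 T, ‖g t‖ ≤ C := by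
  obtain ⟨C, hC⟩ := isCompact_Icc.exists_bound_of_continuousOn hg
  exact ⟨max C 0, le_max_right _ _, fun t ht => (hC t ht).trans (le_max_left _ _)⟩

lemma continuousOn_slice {P F : Type*} [TopologicalSpace P] [TopologicalSpace F]
    {T : ℝ} {g : ℝ → P → F} (hg : ContinuousOn (uncurry g) (Icc 0 T ×ˢ univ)) (x : P) :
    ContinuousOn (fun t => g t x) (Icc 0 T) :=
  hg.comp (f := fun t : ℝ => (t, x)) (by fun_prop) fun t ht => ⟨ht, mem_univ _⟩

lemma continuousOn_uncurry {P F : Type*} [TopologicalSpace P] [PseudoMetricSpace F] {T : ℝ}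
    {A : ℝ → P → F} (hA : ∀ x, ContinuousOn (fun t => A t x) (Icc 0 T))
    (hunif : ∀ x₀, ∀ η > 0, ∀ᶠ x in 𝓝 x₀, ∀ t ∈ Icc 0 T, dist (A t x) (A t x₀) < η) :
    ContinuousOn (uncurry A) (Icc 0 T ×ˢ univ) := by
  rintro ⟨t₀, x₀⟩ ⟨ht₀, -⟩
  rw [ContinuousWithinAt, Metric.tendsto_nhds]
  intro η hη
  have h1 : ∀ᶠ z : ℝ × P in 𝓝[Icc 0 T ×ˢ univ] (t₀, x₀),
      ∀ t ∈ Icc 0 T, dist (A t z.2) (A t x₀) < η / 2 :=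
    ((continuous_snd.tendsto (t₀, x₀)).eventually (hunif x₀ (η / 2) (by positivity))).filter_mono
      nhdsWithin_le_nhds
  have h2 : ∀ᶠ z : ℝ × P in 𝓝[Icc 0 T ×ˢ univ] (t₀, x₀), dist (A z.1 x₀) (A t₀ x₀) < η / 2 := by
    have h3 : Tendsto (fun z : ℝ × P => z.1) (𝓝[Icc 0 T ×ˢ univ] (t₀, x₀)) (𝓝[Icc 0 T] t₀) :=
      tendsto_nhdsWithin_of_tendsto_nhds_of_eventually_within _
        ((continuous_fst.tendsto (t₀, x₀)).mono_left nhdsWithin_le_nhds)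
        (eventually_mem_nhdsWithin.mono fun z hz => hz.1)
    exact (h3.eventually ((hA x₀ t₀ ht₀).eventually (Metric.ball_mem_nhds _ (by positivity))))
  filter_upwards [h1, h2, eventually_mem_nhdsWithin] with z hz1 hz2 hz3
  calc dist (A z.1 z.2) (A t₀ x₀) ≤ dist (A z.1 z.2) (A z.1 x₀) + dist (A z.1 x₀) (A t₀ x₀) :=
        dist_triangle _ _ _
    _ < η / 2 + η / 2 := add_lt_add (hz1 z.1 hz3.1) hz2
    _ = η := by ring

variable {E : Type*} [NormedAddCommGroup E] [NormedSpace ℝ E]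

lemma hasDerivWithinAt_Ici {T t : ℝ} {f : ℝ → E} {f' : E} (ht : t ∈ Ico 0 T)
    (h : HasDerivWithinAt f f' (Icc 0 T) t) : HasDerivWithinAt f f' (Ici t) t :=
  h.mono_of_mem_nhdsWithin (Icc_mem_nhdsGE_of_mem ht)

lemma gronwallBound_le {δ K ε t T : ℝ} (hδ : 0 ≤ δ) (hK : 0 ≤ K) (hε : 0 ≤ ε) (ht : 0 ≤ t)
    (htT : t ≤ T) : gronwallBound δ K ε t ≤ (δ + ε * T) * Real.exp (K * T) := by
  refine (gronwallBound_mono hδ hε hK htT).trans ?_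
  have hT : 0 ≤ T := ht.trans htT
  rcases hK.eq_or_lt with rfl | hK'
  · simp [gronwallBound_K0]
  · rw [gronwallBound_of_K_ne_0 hK'.ne']
    change δ * Real.exp (K * T) + ε / K * (Real.exp (K * T) - 1) ≤ _
    rw [add_mul]
    refine add_le_add le_rfl ?_
    -- Yields exp y - 1 ≤ y exp y for y = KT, which removes the division by K.
    have h1 := Real.add_one_le_exp (-(K * T))
    have h2 : Real.exp (K * T) * Real.exp (-(K * T)) = 1 := by rw [← Real.exp_add]; simp
    have h3 := Real.exp_pos (K * T)
    rw [div_mul_eq_mul_div, div_le_iff₀ hK']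
    have h4 : Real.exp (K * T) - 1 ≤ T * Real.exp (K * T) * K := by nlinarith
    nlinarith

lemma dist_le_of_approx {v : ℝ → E → E} {s : ℝ → Set E} {K : ℝ≥0} {f g g' : ℝ → E} {T ε δ : ℝ}
    (hε : 0 ≤ ε)
    (hv : ∀ t ∈ Icc 0 T, LipschitzOnWith K (v t) (s t))
    (hf : ∀ t ∈ Icc 0 T, HasDerivWithinAt f (v t (f t)) (Icc 0 T) t)
    (hfs : ∀ t ∈ Icc 0 T, f t ∈ s t)
    (hg : ∀ t ∈ Icc 0 T, HasDerivWithinAt g (g' t) (Icc 0 T) t)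
    (hg' : ∀ t ∈ Icc 0 T, dist (g' t) (v t (g t)) ≤ ε)
    (hgs : ∀ t ∈ Icc 0 T, g t ∈ s t) (h0 : dist (f 0) (g 0) ≤ δ) :
    ∀ t ∈ Icc 0 T, dist (f t) (g t) ≤ (δ + ε * T) * Real.exp (K * T) := by
  intro t ht
  have h := dist_le_of_approx_trajectories_ODE_of_mem (v := v) (s := s) (K := K) (f := f) (g := g)
    (f' := fun t => v t (f t)) (g' := g') (a := 0) (b := T) (εf := 0) (εg := ε) (δ := δ)
    (fun t ht => hv t (Ico_subset_Icc_self ht))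
    (fun t ht => (hf t ht).continuousWithinAt)
    (fun t ht => hasDerivWithinAt_Ici ht (hf t (Ico_subset_Icc_self ht)))
    (fun t ht => by simp) (fun t ht => hfs t (Ico_subset_Icc_self ht))
    (fun t ht => (hg t ht).continuousWithinAt)
    (fun t ht => hasDerivWithinAt_Ici ht (hg t (Ico_subset_Icc_self ht)))
    (fun t ht => hg' t (Ico_subset_Icc_self ht)) (fun t ht => hgs t (Ico_subset_Icc_self ht)) h0
    t ht
  rw [zero_add, sub_zero] at h
  exact h.trans (gronwallBound_le (dist_nonneg.trans h0) K.2 hε ht.1 ht.2)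

lemma solution_unique {X : ℝ → E → E} {K : ℝ≥0} {T : ℝ} {f g : ℝ → E}
    (hL : ∀ t ∈ Icc 0 T, LipschitzWith K (X t))
    (hf : ∀ t ∈ Icc 0 T, HasDerivWithinAt f (X t (f t)) (Icc 0 T) t)
    (hg : ∀ t ∈ Icc 0 T, HasDerivWithinAt g (X t (g t)) (Icc 0 T) t) (h0 : f 0 = g 0) :
    ∀ t ∈ Icc 0 T, f t = g t := by
  intro t ht
  have h := dist_le_of_approx (s := fun _ => univ) le_rfl (fun t ht => (hL t ht).lipschitzOnWith)
    hf (fun _ _ => mem_univ _) hg (fun t _ => (dist_self _).le) (fun _ _ => mem_univ _)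
    (dist_le_zero.2 h0) t ht
  exact dist_le_zero.1 (by simpa using h)

/-- A field bounded by B moves a point by at most BT, so the Picard–Lindelöf theorem on a ball of
this radius reaches all of `[0, T]`. -/
lemma exists_solution [CompleteSpace E] {X : ℝ → E → E} {T B : ℝ} {K : ℝ≥0} (hT : 0 ≤ T)
    (hL : ∀ t ∈ Icc 0 T, LipschitzWith K (X t)) (hc : ∀ x, ContinuousOn (fun t => X t x) (Icc 0 T))
    (hB : ∀ t ∈ Icc 0 T, ∀ x, ‖X t x‖ ≤ B) (x₀ : E) :
    ∃ α : ℝ → E, α 0 = x₀ ∧ ∀ t ∈ Icc 0 T, HasDerivWithinAt α (X t (α t)) (Icc 0 T) t := by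
  have hB0 : 0 ≤ B := (norm_nonneg _).trans (hB 0 ⟨le_rfl, hT⟩ 0)
  have h : IsPicardLindelof X (⟨0, le_rfl, hT⟩ : Icc (0 : ℝ) T) x₀ (B.toNNReal * T.toNNReal) 0
      B.toNNReal K :=
    { lipschitzOnWith := fun t ht => (hL t ht).lipschitzOnWith
      continuousOn := fun x _ => hc x
      norm_le := fun t ht x _ => by rw [Real.coe_toNNReal _ hB0]; exact hB t ht x
      mul_max_le := by simp [hT, hB0] }
  exact h.exists_eq_forall_mem_Icc_hasDerivWithinAt₀

/-- A linear equation has a solution on all of `[0, T]`. -/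
lemma exists_solution_linear [FiniteDimensional ℝ E] {A : ℝ → E →L[ℝ] E} {T : ℝ} (hT : 0 ≤ T)
    (hA : ContinuousOn A (Icc 0 T)) (v₀ : E) :
    ∃ α : ℝ → E, α 0 = v₀ ∧ ∀ t ∈ Icc 0 T, HasDerivWithinAt α (A t (α t)) (Icc 0 T) t := by
  have : CompleteSpace E := FiniteDimensional.complete ℝ E
  obtain ⟨l, hl0, hl⟩ := exists_bound_Icc hA
  -- Grönwall bound for solutions starting at `v₀`, plus 1 for positivity. The linear field is cut
  -- off beyond this radius to become bounded and Lipschitz.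
  set R : ℝ := ‖v₀‖ * Real.exp (l * T) + 1 with hR
  have hRpos : 0 < R := by positivity
  let χ : ContDiffBump (0 : E) := ⟨R, R + 1, hRpos, by linarith⟩
  have hχc : HasCompactSupport fun w : E => χ w • w := χ.hasCompactSupport.smul_right
  have hχd : ContDiff ℝ 1 fun w : E => χ w • w := χ.contDiff.smul contDiff_id
  obtain ⟨C, hC⟩ := ContDiff.lipschitzWith_of_hasCompactSupport hχc hχd one_ne_zero
  have hχb : ∀ w : E, ‖χ w • w‖ ≤ R + 1 := by
    intro w
    by_cases hw : ‖w‖ < R + 1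
    · rw [norm_smul, Real.norm_of_nonneg χ.nonneg]
      nlinarith [χ.le_one (x := w), χ.nonneg (x := w), norm_nonneg w]
    · rw [χ.zero_of_le_dist (by rw [dist_zero_right]; exact not_lt.1 hw)]
      simp only [zero_smul, norm_zero]
      linarith
  have hsol := exists_solution (X := fun t w => A t (χ w • w)) (B := l * (R + 1))
    (K := l.toNNReal * C) hT (fun t ht => ?_) (fun x => ?_) (fun t ht x => ?_) v₀
  obtain ⟨α, hα0, hα⟩ := hsol
  · refine ⟨α, hα0, fun t ht => ?_⟩
    -- The truncated equation obeys the same growth bound, so its solution never leaves the region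
    -- where the cutoff is 1.
    have hb := norm_le_gronwallBound_of_norm_deriv_right_le (f := α)
      (f' := fun t => A t (χ (α t) • α t)) (δ := ‖v₀‖) (K := l) (ε := 0) (a := 0) (b := T)
      (fun t ht => (hα t ht).continuousWithinAt)
      (fun t ht => hasDerivWithinAt_Ici ht (hα t (Ico_subset_Icc_self ht))) (by rw [hα0])
      (fun t ht => ?_) t ht
    · rw [sub_zero] at hb
      have hb' := hb.trans (gronwallBound_le (norm_nonneg _) hl0 le_rfl ht.1 ht.2)
      have h1 : χ (α t) = 1 := χ.one_of_mem_closedBall (by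
        rw [mem_closedBall_zero_iff]
        change ‖α t‖ ≤ R
        simp at hb'
        linarith)
      have := hα t ht
      rwa [h1, one_smul] at this
    · refine ((A t).le_opNorm _).trans ?_
      rw [add_zero, norm_smul, Real.norm_of_nonneg χ.nonneg]
      refine mul_le_mul (hl t (Ico_subset_Icc_self ht)) ?_ (mul_nonneg χ.nonneg (norm_nonneg _)) hl0
      exact mul_le_of_le_one_left (norm_nonneg _) χ.le_one
  · refine ((A t).lipschitz.comp hC).weaken ?_
    gcongr
    rw [← NNReal.coe_le_coe, Real.coe_toNNReal _ hl0]
    exact hl t ht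
  · exact hA.clm_apply continuousOn_const
  · refine ((A t).le_opNorm _).trans ?_
    exact mul_le_mul (hl t ht) (hχb x) (norm_nonneg _) hl0

variable {P : Type*} [NormedAddCommGroup P] [NormedSpace ℝ P]

omit [NormedSpace ℝ P] in
/-- Solutions of linear equations depend continuously on parameters. -/
lemma continuousOn_linear {L : ℝ → P → E →L[ℝ] E} {A : ℝ → P → E} {T : ℝ}
    (hL : ContinuousOn (uncurry L) (Icc 0 T ×ˢ univ))
    (hA : ∀ x, ∀ t ∈ Icc 0 T, HasDerivWithinAt (fun s => A s x) (L t x (A t x)) (Icc 0 T) t)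
    (hA0 : Continuous (A 0)) : ContinuousOn (uncurry A) (Icc 0 T ×ˢ univ) := by
  refine continuousOn_uncurry (fun x t ht => (hA x t ht).continuousWithinAt) fun x₀ => ?_
  rcases lt_or_ge T 0 with hT | hT
  · simp [Icc_eq_empty_of_lt hT]
  obtain ⟨l, hl0, hl⟩ := exists_bound_Icc (continuousOn_slice hL x₀)
  have hAc : ContinuousOn (fun t => A t x₀) (Icc 0 T) := fun t ht => (hA x₀ t ht).continuousWithinAt
  obtain ⟨C, hC0, hC⟩ := exists_bound_Icc hAc
  intro η hη
  set M := (1 + C * T) * Real.exp ((l + 1) * T) with hM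
  have hMpos : 0 < M := by positivity
  -- The solution at `x₀` solves the equation at `x` with defect ε C. The bound 1 keeps the
  -- Lipschitz constant below l + 1, and the other bound makes the final distance at most η / 2.
  set ε := min 1 (η / (2 * M)) with hε
  have hεpos : 0 < ε := by positivity
  filter_upwards [eventually_forall_Icc_dist_lt hL x₀ hεpos,
    (hA0.tendsto x₀).eventually (Metric.ball_mem_nhds _ hεpos)] with x hx hx0 t ht
  have h := dist_le_of_approx (v := fun t w => L t x w) (s := fun _ => univ)
    (K := (l + 1).toNNReal) (f := fun t => A t x) (g := fun t => A t x₀)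
    (g' := fun t => L t x₀ (A t x₀)) (T := T) (ε := ε * C) (δ := ε) (by positivity)
    (fun t ht => ?_) (hA x) (fun _ _ => mem_univ _) (hA x₀) (fun t ht => ?_)
    (fun _ _ => mem_univ _) (le_of_lt hx0) t ht
  · refine lt_of_le_of_lt h ?_
    rw [Real.coe_toNNReal _ (by positivity)]
    have : (ε + ε * C * T) * Real.exp ((l + 1) * T) = ε * M := by rw [hM]; ring
    rw [this]
    calc ε * M ≤ η / (2 * M) * M := by gcongr; exact min_le_right _ _
      _ = η / 2 := by field_simp
      _ < η := by linarith
  · refine ((L t x).lipschitz.weaken ?_).lipschitzOnWith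
    rw [← NNReal.coe_le_coe, Real.coe_toNNReal _ (by positivity), coe_nnnorm]
    have h1 := hx t ht
    rw [dist_eq_norm] at h1
    have h2 := norm_sub_norm_le (L t x) (L t x₀)
    have h3 : ε ≤ 1 := min_le_left _ _
    linarith [hl t ht]
  · rw [dist_eq_norm, ← sub_apply]
    refine ((L t x₀ - L t x).le_opNorm _).trans ?_
    have h1 := (hx t ht).le
    rw [dist_comm, dist_eq_norm] at h1
    exact mul_le_mul h1 (hC t ht) (norm_nonneg _) hεpos.le

lemma contDiff_slice {T : ℝ} {n : WithTop ℕ∞} {F : Type*} [NormedAddCommGroup F]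
    [NormedSpace ℝ F] {X : ℝ → E → F}
    (hX : ContDiffOn ℝ n (uncurry X) (Icc 0 T ×ˢ univ)) {t : ℝ} (ht : t ∈ Icc 0 T) :
    ContDiff ℝ n (X t) := by
  rw [← contDiffOn_univ]
  exact hX.comp (f := fun x : E => (t, x)) (by fun_prop) fun x _ => ⟨ht, mem_univ _⟩

lemma contDiffOn_fderiv_slice {F : Type*} [NormedAddCommGroup F]
    [NormedSpace ℝ F] {X : ℝ → E → F} {T : ℝ}
    (hX : ContDiffOn ℝ ∞ (uncurry X) (Icc 0 T ×ˢ univ)) :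
    ContDiffOn ℝ ∞ (uncurry fun t x => fderiv ℝ (X t) x) (Icc 0 T ×ˢ univ) := by
  rintro ⟨t, x⟩ hz
  have h1 : ContDiffWithinAt ℝ ∞ (uncurry fun (z : ℝ × E) (y : E) => X z.1 y)
      ((Icc 0 T ×ˢ univ) ×ˢ univ) ((t, x), x) := by
    have := hX.comp (f := fun w : (ℝ × E) × E => (w.1.1, w.2)) (s := (Icc 0 T ×ˢ univ) ×ˢ univ)
      (by fun_prop) fun w hw => ⟨hw.1.1, mem_univ _⟩
    exact this ((t, x), x) ⟨hz, mem_univ _⟩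
  have h2 := ContDiffWithinAt.fderivWithin (m := ∞) (g := fun z : ℝ × E => z.2) h1
    contDiffWithinAt_snd uniqueDiffOn_univ (by simp) hz (fun _ _ => mem_univ _)
  simpa [fderivWithin_univ, uncurry_def] using h2

/-- Differentiability of solutions with respect to a parameter; the derivative solves the
linearized equation. -/
lemma hasFDerivAt_param {X : ℝ → E → E} {u : ℝ → P → E} {A : ℝ → P → P →L[ℝ] E} {T : ℝ}
    (hX : ContDiffOn ℝ ∞ (uncurry X) (Icc 0 T ×ˢ univ))
    (hu : ∀ x, ∀ t ∈ Icc 0 T, HasDerivWithinAt (fun s => u s x) (X t (u t x)) (Icc 0 T) t)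
    (huc : ContinuousOn (uncurry u) (Icc 0 T ×ˢ univ)) {x : P}
    (hA : ∀ t ∈ Icc 0 T, HasDerivWithinAt (fun s => A s x)
      ((fderiv ℝ (X t) (u t x)).comp (A t x)) (Icc 0 T) t)
    (hA0 : HasFDerivAt (u 0) (A 0 x) x) {t : ℝ} (ht : t ∈ Icc 0 T) :
    HasFDerivAt (u t) (A t x) x := by
  have hT : 0 ≤ T := ht.1.trans ht.2
  have hDX := (contDiffOn_fderiv_slice hX).continuousOn
  have hAc : ContinuousOn (fun t => A t x) (Icc 0 T) := fun t ht => (hA t ht).continuousWithinAt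
  have huxc : ContinuousOn (fun t => u t x) (Icc 0 T) := continuousOn_slice huc x
  have hd : ∀ t ∈ Icc 0 T, ∀ y, HasFDerivAt (X t) (fderiv ℝ (X t) y) y := fun t ht y =>
    (((contDiff_slice hX ht).differentiable (by simp)) y).hasFDerivAt
  have hg : ContinuousOn (uncurry fun (t : ℝ) (y : E) => fderiv ℝ (X t) (u t x + y))
      (Icc 0 T ×ˢ univ) := by
    refine hDX.comp (f := fun z : ℝ × E => (z.1, u z.1 x + z.2)) ?_ fun z hz => ⟨hz.1, mem_univ _⟩
    refine continuousOn_fst.prodMk (ContinuousOn.add ?_ continuousOn_snd)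
    exact huxc.comp continuousOn_fst fun z hz => hz.1
  have hg0 : ContinuousOn (fun t => fderiv ℝ (X t) (u t x)) (Icc 0 T) := by
    have := continuousOn_slice hg 0
    simpa using this
  obtain ⟨k, hk0, hk⟩ := exists_bound_Icc hg0
  obtain ⟨C, hC0, hC⟩ := exists_bound_Icc hAc
  -- Used with ε = 1 for a Lipschitz constant on the tube, and with small ε for the linearization
  -- error.
  have htube : ∀ ε > 0, ∃ r > 0, ∀ t ∈ Icc 0 T, ∀ y ∈ Metric.closedBall (u t x) r,
      ‖fderiv ℝ (X t) y - fderiv ℝ (X t) (u t x)‖ ≤ ε := by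
    intro ε hε
    obtain ⟨r, hr, hr'⟩ := Metric.eventually_nhds_iff.1 (eventually_forall_Icc_dist_lt hg 0 hε)
    refine ⟨r / 2, by positivity, fun t ht y hy => ?_⟩
    have h1 : dist (y - u t x) 0 < r := by
      rw [dist_zero_right, ← dist_eq_norm]
      exact lt_of_le_of_lt hy (by linarith)
    have h2 := hr' h1 t ht
    rw [add_sub_cancel, add_zero, dist_eq_norm] at h2
    exact h2.le
  obtain ⟨r₁, hr₁, htube₁⟩ := htube 1 one_pos
  rw [hasFDerivAt_iff_isLittleO_nhds_zero, Asymptotics.isLittleO_iff]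
  intro η hη
  set M := (1 + C * T) * Real.exp ((k + 1) * T) with hM
  have hMpos : 0 < M := by positivity
  set ε := η / M with hε
  have hεpos : 0 < ε := by positivity
  obtain ⟨r₂, hr₂, htube₂⟩ := htube ε hεpos
  set r := min r₁ r₂ with hr
  have hrpos : 0 < r := lt_min hr₁ hr₂
  have e1 : ∀ᶠ h in 𝓝 (0 : P), ∀ t ∈ Icc 0 T, dist (u t (x + h)) (u t x) < r := by
    have : Tendsto (fun h : P => x + h) (𝓝 0) (𝓝 x) := by
      have : Continuous fun h : P => x + h := by fun_prop
      simpa using this.tendsto 0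
    exact this.eventually (eventually_forall_Icc_dist_lt huc x hrpos)
  have e2 : ∀ᶠ h in 𝓝 (0 : P), C * ‖h‖ < r := by
    have : Continuous fun h : P => C * ‖h‖ := by fun_prop
    exact this.continuousAt.eventually_lt continuousAt_const (by simpa using hrpos)
  have e3 := Asymptotics.isLittleO_iff.1 (hasFDerivAt_iff_isLittleO_nhds_zero.1 hA0) hεpos
  filter_upwards [e1, e2, e3] with h h1 h2 h3
  have hAh : ∀ t ∈ Icc 0 T, ‖A t x h‖ ≤ C * ‖h‖ := fun t ht =>
    ((A t x).le_opNorm h).trans (by gcongr; exact hC t ht)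
  have hmem : ∀ t ∈ Icc 0 T, u t x + A t x h ∈ Metric.closedBall (u t x) r := fun t ht => by
    rw [mem_closedBall_iff_norm, add_sub_cancel_left]
    exact (hAh t ht).trans h2.le
  -- The expansion `u t x + A t x h` solves the equation with defect ε C ‖h‖ and initial error ε
  -- ‖h‖, so it stays within ε M ‖h‖ = η ‖h‖ of the true solution.
  have hfin := dist_le_of_approx (v := X) (s := fun t => Metric.closedBall (u t x) r)
    (K := (k + 1).toNNReal) (f := fun t => u t (x + h))
    (g := fun t => u t x + A t x h)
    (g' := fun t => X t (u t x) + fderiv ℝ (X t) (u t x) (A t x h)) (T := T) (ε := ε * (C * ‖h‖))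
    (δ := ε * ‖h‖) (by positivity) (fun t ht => ?_) (hu (x + h)) (fun t ht => (h1 t ht).le)
    (fun t ht => ?_) (fun t ht => ?_) hmem ?_ t ht
  · rw [dist_eq_norm] at hfin
    rw [sub_sub]
    refine hfin.trans (le_of_eq ?_)
    rw [Real.coe_toNNReal _ (by positivity)]
    have : (ε * ‖h‖ + ε * (C * ‖h‖) * T) * Real.exp ((k + 1) * T) = ε * M * ‖h‖ := by
      rw [hM]; ring
    rw [this, hε, div_mul_cancel₀ _ hMpos.ne']
  · refine (convex_closedBall _ _).lipschitzOnWith_of_nnnorm_hasFDerivWithin_le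
      (fun y _ => (hd t ht y).hasFDerivWithinAt) fun y hy => ?_
    rw [← NNReal.coe_le_coe, Real.coe_toNNReal _ (by positivity), coe_nnnorm]
    have h4 := htube₁ t ht y (Metric.closedBall_subset_closedBall (min_le_left _ _) hy)
    have h5 := norm_sub_norm_le (fderiv ℝ (X t) y) (fderiv ℝ (X t) (u t x))
    linarith [hk t ht]
  · refine (hu x t ht).add ?_
    have := (hA t ht).clm_apply (hasDerivWithinAt_const t (Icc 0 T) h)
    simpa using this
  · have h4 := (convex_closedBall (u t x) r).norm_image_sub_le_of_norm_hasFDerivWithin_le'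
      (f := X t) (f' := fun y => fderiv ℝ (X t) y) (φ := fderiv ℝ (X t) (u t x)) (C := ε)
      (fun y _ => (hd t ht y).hasFDerivWithinAt)
      (fun y hy => htube₂ t ht y (Metric.closedBall_subset_closedBall (min_le_right _ _) hy))
      (Metric.mem_closedBall_self hrpos.le) (hmem t ht)
    rw [add_sub_cancel_left] at h4
    rw [dist_comm, dist_eq_norm, ← sub_sub]
    refine h4.trans ?_
    gcongr
    exact hAh t ht
  · rw [dist_eq_norm, ← sub_sub]
    exact h3

end TimeODE

end

end HopfWillmore

/-! ### Joint smoothness in time and parameter, and flows of vector fields. -/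

namespace HopfWillmore

noncomputable section

open Filter Topology Function NNReal

namespace TimeODE

/-- An increment splits into a time step at fixed `x` and a space step at the new time. The mean
value inequality and continuity of `A` control the latter. -/
lemma hasFDerivWithinAt_uncurry {E P : Type*} [NormedAddCommGroup E] [NormedSpace ℝ E]
    [NormedAddCommGroup P] [NormedSpace ℝ P] {u d : ℝ → P → E} {A : ℝ → P → P →L[ℝ] E} {T : ℝ}
    (hd : ∀ x, ∀ t ∈ Icc 0 T, HasDerivWithinAt (fun s => u s x) (d t x) (Icc 0 T) t)
    (hA : ∀ t ∈ Icc 0 T, ∀ x, HasFDerivAt (u t) (A t x) x)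
    (hAc : ContinuousOn (uncurry A) (Icc 0 T ×ˢ univ)) {t : ℝ} (ht : t ∈ Icc 0 T) (x : P) :
    HasFDerivWithinAt (uncurry u) ((ContinuousLinearMap.fst ℝ ℝ P).smulRight (d t x)
      + (A t x).comp (ContinuousLinearMap.snd ℝ ℝ P)) (Icc 0 T ×ˢ univ) (t, x) := by
  rw [hasFDerivWithinAt_iff_isLittleO, Asymptotics.isLittleO_iff]
  intro ε hε
  have h1 := Asymptotics.isLittleO_iff.1 (hasDerivWithinAt_iff_isLittleO.1 (hd x t ht))
    (half_pos hε)
  have h1' : ∀ᶠ z : ℝ × P in 𝓝[Icc 0 T ×ˢ univ] (t, x),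
      ‖u z.1 x - u t x - (z.1 - t) • d t x‖ ≤ ε / 2 * ‖z.1 - t‖ := by
    have h3 : Tendsto (fun z : ℝ × P => z.1) (𝓝[Icc 0 T ×ˢ univ] (t, x)) (𝓝[Icc 0 T] t) :=
      tendsto_nhdsWithin_of_tendsto_nhds_of_eventually_within _
        ((continuous_fst.tendsto (t, x)).mono_left nhdsWithin_le_nhds)
        (eventually_mem_nhdsWithin.mono fun z hz => hz.1)
    exact h3.eventually h1
  have h2 : ∀ᶠ z : ℝ × P in 𝓝[Icc 0 T ×ˢ univ] (t, x), ‖A z.1 z.2 - A t x‖ < ε / 2 := by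
    have := (hAc (t, x) ⟨ht, mem_univ _⟩).eventually (Metric.ball_mem_nhds _ (half_pos hε))
    filter_upwards [this] with z hz
    rwa [dist_eq_norm] at hz
  obtain ⟨r, hr, hball⟩ := Metric.mem_nhdsWithin_iff.1 h2
  filter_upwards [h1', eventually_mem_nhdsWithin,
    mem_nhdsWithin_of_mem_nhds (Metric.ball_mem_nhds (t, x) hr)] with z hz1 hz2 hz3
  rw [← ball_prod_same] at hz3
  obtain ⟨hzt, hzx⟩ := hz3
  have h4 := (convex_ball x r).norm_image_sub_le_of_norm_hasFDerivWithin_le'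
    (f := u z.1) (f' := A z.1) (φ := A t x) (C := ε / 2)
    (fun y _ => (hA z.1 hz2.1 y).hasFDerivWithinAt)
    (fun y hy => le_of_lt (show ‖A z.1 y - A t x‖ < ε / 2 from hball (a := (z.1, y))
      ⟨by rw [← ball_prod_same]; exact ⟨hzt, hy⟩, hz2.1, mem_univ _⟩))
    (Metric.mem_ball_self hr) hzx
  have h5 : uncurry u z - uncurry u (t, x) - ((ContinuousLinearMap.fst ℝ ℝ P).smulRight (d t x)
      + (A t x).comp (ContinuousLinearMap.snd ℝ ℝ P)) (z - (t, x))
      = (u z.1 z.2 - u z.1 x - A t x (z.2 - x)) + (u z.1 x - u t x - (z.1 - t) • d t x) := by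
    simp [uncurry]
    abel
  rw [h5]
  refine (norm_add_le _ _).trans ((add_le_add h4 hz1).trans ?_)
  have h6 : ‖z.1 - t‖ ≤ ‖z - (t, x)‖ := norm_fst_le (z - (t, x))
  have h7 : ‖z.2 - x‖ ≤ ‖z - (t, x)‖ := norm_snd_le (z - (t, x))
  nlinarith

/-- The pair (u, ∂ₓu) again solves a smooth equation, on E × (P →L[ℝ] E), so a bound on the
regularity of all solutions improves by one order. This is why `E` is quantified inside the
induction. -/
theorem contDiffOn_nat_param {P : Type} [NormedAddCommGroup P] [NormedSpace ℝ P]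
    [FiniteDimensional ℝ P] {T : ℝ} (hT : 0 ≤ T) (k : ℕ) :
    ∀ {E : Type} [NormedAddCommGroup E] [NormedSpace ℝ E] [FiniteDimensional ℝ E]
      {X : ℝ → E → E} {u : ℝ → P → E}
      (_ : ContDiffOn ℝ ∞ (uncurry X) (Icc 0 T ×ˢ univ))
      (_ : ∀ x, ∀ t ∈ Icc 0 T, HasDerivWithinAt (fun s => u s x) (X t (u t x)) (Icc 0 T) t)
      (_ : ContinuousOn (uncurry u) (Icc 0 T ×ˢ univ)) (_ : ContDiff ℝ ∞ (u 0)),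
      ContDiffOn ℝ k (uncurry u) (Icc 0 T ×ˢ univ) := by
  induction k with
  | zero =>
    intro E _ _ _ X u hX hu huc hu0
    exact contDiffOn_zero.2 huc
  | succ k ih =>
    intro E _ _ _ X u hX hu huc hu0
    have hDX := contDiffOn_fderiv_slice hX
    have hgraph : ContinuousOn (fun z : ℝ × P => (z.1, u z.1 z.2)) (Icc 0 T ×ˢ univ) :=
      continuousOn_fst.prodMk huc
    have hDXu : ContinuousOn (uncurry fun t x => fderiv ℝ (X t) (u t x)) (Icc 0 T ×ˢ univ) :=
      hDX.continuousOn.comp hgraph fun z hz => ⟨hz.1, mem_univ _⟩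
    have hL : ContinuousOn (uncurry fun t x => ContinuousLinearMap.compL ℝ P E E
        (fderiv ℝ (X t) (u t x))) (Icc 0 T ×ˢ univ) :=
      (ContinuousLinearMap.compL ℝ P E E).continuous.comp_continuousOn hDXu
    choose A hA0 hA using fun x => exists_solution_linear hT (continuousOn_slice hL x)
      (fderiv ℝ (u 0) x)
    have hdu0 : ContDiff ℝ ∞ (fderiv ℝ (u 0)) := hu0.fderiv_right (by simp)
    have hAc : ContinuousOn (uncurry fun t x => A x t) (Icc 0 T ×ˢ univ) :=
      continuousOn_linear hL hA (by
        have : (fun x => A x 0) = fderiv ℝ (u 0) := funext hA0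
        rw [this]; exact hdu0.continuous)
    have hderiv : ∀ t ∈ Icc 0 T, ∀ x, HasFDerivAt (u t) (A x t) x := fun t ht x =>
      hasFDerivAt_param (A := fun t x => A x t) hX hu huc (hA x)
        (by rw [hA0]; exact ((hu0.differentiable (by simp)) x).hasFDerivAt) ht
    have hX₂ : ContDiffOn ℝ ∞ (uncurry fun (t : ℝ) (y : E × (P →L[ℝ] E)) =>
        (X t y.1, (fderiv ℝ (X t) y.1).comp y.2)) (Icc 0 T ×ˢ univ) := by
      have hm : MapsTo (fun z : ℝ × E × (P →L[ℝ] E) => (z.1, z.2.1)) (Icc 0 T ×ˢ univ)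
          (Icc 0 T ×ˢ univ) := fun z hz => ⟨hz.1, mem_univ _⟩
      have h1 := hX.comp (f := fun z : ℝ × E × (P →L[ℝ] E) => (z.1, z.2.1)) (by fun_prop) hm
      have h2 := hDX.comp (f := fun z : ℝ × E × (P →L[ℝ] E) => (z.1, z.2.1)) (by fun_prop) hm
      exact h1.prodMk (h2.clm_comp (by fun_prop))
    have hpair := ih (u := fun t x => (u t x, A x t)) hX₂
      (fun x t ht => (hu x t ht).prodMk (hA x t ht)) (huc.prodMk hAc)
      (by
        have : (fun x => (u 0 x, A x 0)) = fun x => (u 0 x, fderiv ℝ (u 0) x) := by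
          funext x; rw [hA0]
        rw [this]
        exact hu0.prodMk hdu0)
    have huk : ContDiffOn ℝ k (uncurry u) (Icc 0 T ×ˢ univ) := contDiff_fst.comp_contDiffOn hpair
    have hAk : ContDiffOn ℝ k (uncurry fun t x => A x t) (Icc 0 T ×ˢ univ) :=
      contDiff_snd.comp_contDiffOn hpair
    have hXk : ContDiffOn ℝ k (uncurry fun t x => X t (u t x)) (Icc 0 T ×ˢ univ) :=
      (hX.of_le (by exact_mod_cast le_top)).comp (contDiffOn_fst.prodMk huk)
        fun z hz => ⟨hz.1, mem_univ _⟩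
    have : ((k + 1 : ℕ) : WithTop ℕ∞) = (k : WithTop ℕ∞) + 1 := by norm_cast
    rw [this, contDiffOn_succ_iff_hasFDerivWithinAt (by simp)]
    rintro ⟨t, x⟩ hz
    refine ⟨Icc 0 T ×ˢ univ, by rw [insert_eq_of_mem hz]; exact self_mem_nhdsWithin, by simp,
      fun z => (ContinuousLinearMap.fst ℝ ℝ P).smulRight (X z.1 (u z.1 z.2))
        + (A z.2 z.1).comp (ContinuousLinearMap.snd ℝ ℝ P), ?_, ?_⟩
    · rintro ⟨s, y⟩ hs
      exact hasFDerivWithinAt_uncurry (A := fun t x => A x t) (d := fun t x => X t (u t x)) hu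
        hderiv hAc hs.1 y
    · exact (contDiffOn_const.smulRight hXk).add (hAk.clm_comp contDiffOn_const)

/-- Solutions of a smooth ordinary differential equation on `[0, T]` with smooth initial values
are smooth in time and parameter. -/
theorem contDiffOn_param {P E : Type} [NormedAddCommGroup P] [NormedSpace ℝ P]
    [FiniteDimensional ℝ P] [NormedAddCommGroup E] [NormedSpace ℝ E] [FiniteDimensional ℝ E]
    {T : ℝ} (hT : 0 ≤ T) {X : ℝ → E → E} {u : ℝ → P → E}
    (hX : ContDiffOn ℝ ∞ (uncurry X) (Icc 0 T ×ˢ univ))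
    (hu : ∀ x, ∀ t ∈ Icc 0 T, HasDerivWithinAt (fun s => u s x) (X t (u t x)) (Icc 0 T) t)
    (huc : ContinuousOn (uncurry u) (Icc 0 T ×ˢ univ)) (hu0 : ContDiff ℝ ∞ (u 0)) :
    ContDiffOn ℝ ∞ (uncurry u) (Icc 0 T ×ˢ univ) :=
  contDiffOn_infty.2 fun k => contDiffOn_nat_param hT k hX hu huc hu0

variable {E : Type} [NormedAddCommGroup E] [NormedSpace ℝ E] [FiniteDimensional ℝ E]

/-- The flow of a bounded Lipschitz smooth time-dependent vector field. -/
theorem exists_flow {X : ℝ → E → E} {T B : ℝ} {K : ℝ≥0} (hT : 0 ≤ T)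
    (hX : ContDiffOn ℝ ∞ (uncurry X) (Icc 0 T ×ˢ univ))
    (hL : ∀ t ∈ Icc 0 T, LipschitzWith K (X t)) (hB : ∀ t ∈ Icc 0 T, ∀ x, ‖X t x‖ ≤ B) :
    ∃ Φ : ℝ → E → E, ContDiffOn ℝ ∞ (uncurry Φ) (Icc 0 T ×ˢ univ) ∧ (∀ x, Φ 0 x = x) ∧
      ∀ x, ∀ t ∈ Icc 0 T, HasDerivWithinAt (fun s => Φ s x) (X t (Φ t x)) (Icc 0 T) t := by
  have : CompleteSpace E := FiniteDimensional.complete ℝ E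
  choose α hα0 hα using fun x => exists_solution hT hL (continuousOn_slice hX.continuousOn) hB x
  refine ⟨fun t x => α x t, contDiffOn_param hT hX hα ?_ ?_, hα0, hα⟩
  · refine continuousOn_uncurry (fun x t ht => (hα x t ht).continuousWithinAt) fun x₀ η hη => ?_
    have hM : 0 < Real.exp (K * T) := Real.exp_pos _
    filter_upwards [Metric.ball_mem_nhds x₀ (div_pos hη hM)] with x hx t ht
    have h := dist_le_of_approx (v := X) (s := fun _ => univ) (ε := 0) (δ := dist x x₀) le_rfl
      (fun t ht => (hL t ht).lipschitzOnWith) (hα x) (fun _ _ => mem_univ _) (hα x₀)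
      (fun t _ => (dist_self _).le) (fun _ _ => mem_univ _) (by rw [hα0, hα0]) t ht
    refine h.trans_lt ?_
    rw [zero_mul, add_zero]
    exact (lt_div_iff₀ hM).1 hx
  · have : (fun x => α x 0) = id := funext hα0
    rw [this]
    exact contDiff_id

/-- The time `t` map of a flow has a smooth inverse. -/
theorem exists_flow_inverse {X : ℝ → E → E} {T B : ℝ} {K : ℝ≥0}
    (hX : ContDiffOn ℝ ∞ (uncurry X) (Icc 0 T ×ˢ univ))
    (hL : ∀ t ∈ Icc 0 T, LipschitzWith K (X t)) (hB : ∀ t ∈ Icc 0 T, ∀ x, ‖X t x‖ ≤ B)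
    {Φ : ℝ → E → E} (hΦ0 : ∀ x, Φ 0 x = x)
    (hΦ : ∀ x, ∀ t ∈ Icc 0 T, HasDerivWithinAt (fun s => Φ s x) (X t (Φ t x)) (Icc 0 T) t)
    {t : ℝ} (ht : t ∈ Icc 0 T) :
    ∃ Ψ : E → E, ContDiff ℝ ∞ Ψ ∧ (∀ x, Ψ (Φ t x) = x) ∧ ∀ x, Φ t (Ψ x) = x := by
  have hmaps : ∀ s ∈ Icc 0 t, t - s ∈ Icc 0 T := fun s hs =>
    ⟨by linarith [hs.2], by linarith [hs.1, ht.2]⟩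
  have hsub : Icc 0 t ⊆ Icc 0 T := Icc_subset_Icc_right ht.2
  -- The inverse is the time `t` map of the time-reversed field; uniqueness of solutions shows that
  -- the two maps undo each other.
  have hY : ContDiffOn ℝ ∞ (uncurry fun s x => -X (t - s) x) (Icc 0 t ×ˢ univ) :=
    (hX.comp (f := fun z : ℝ × E => (t - z.1, z.2)) (by fun_prop)
      fun z hz => ⟨hmaps z.1 hz.1, mem_univ _⟩).neg
  have hYL : ∀ s ∈ Icc 0 t, LipschitzWith K fun x => -X (t - s) x := fun s hs =>
    (hL _ (hmaps s hs)).neg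
  obtain ⟨Ψ, hΨc, hΨ0, hΨ⟩ := exists_flow ht.1 hY hYL
    fun s hs x => by rw [norm_neg]; exact hB _ (hmaps s hs) x
  have hrev : ∀ {f : ℝ → E} {f' : E} {S : ℝ} {s : ℝ}, Icc 0 t ⊆ Icc 0 S → s ∈ Icc 0 t →
      HasDerivWithinAt f f' (Icc 0 S) (t - s) →
      HasDerivWithinAt (fun r => f (t - r)) (-f') (Icc 0 t) s := by
    intro f f' S s hS hs hf
    have h1 : HasDerivWithinAt (fun r => t - r) (-1) (Icc 0 t) s :=
      (hasDerivWithinAt_id s _).const_sub t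
    have h2 := hf.scomp s h1 (fun r hr => hS ⟨by linarith [hr.2], by linarith [hr.1]⟩)
    rw [neg_one_smul] at h2
    exact h2
  have htt : t ∈ Icc 0 t := ⟨ht.1, le_rfl⟩
  refine ⟨Ψ t, contDiff_slice hΨc htt, fun x => ?_, fun x => ?_⟩
  · have h := solution_unique hYL (hΨ (Φ t x)) (g := fun s => Φ (t - s) x)
      (fun s hs => hrev hsub hs (hΦ x (t - s) (hmaps s hs))) (by simp [hΨ0]) t htt
    rw [h, sub_self, hΦ0]
  · have h := solution_unique (fun s hs => hL s (hsub hs)) (T := t)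
      (f := fun s => Φ s (Ψ t x)) (g := fun s => Ψ (t - s) x)
      (fun s hs => (hΦ _ s (hsub hs)).mono hsub) (fun s hs => ?_) (by simp [hΦ0]) t htt
    · change Φ t (Ψ t x) = _ at h
      rw [h, sub_self, hΨ0]
    · have h1 := hrev le_rfl hs (hΨ x (t - s) ⟨by linarith [hs.2], by linarith [hs.1]⟩)
      simpa using h1

end TimeODE

end

end HopfWillmore

namespace HopfWillmore

noncomputable section

/-! ### Lattice covers and the descent of periodic flows -/

open Filter Topology Function NNReal

section Cover

variable {E E' H M : Type*} [NormedAddCommGroup E] [NormedSpace ℝ E] [NormedAddCommGroup E']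
  [NormedSpace ℝ E'] [TopologicalSpace H] {I : ModelWithCorners ℝ E' H} [TopologicalSpace M]
  [ChartedSpace H M]

/-- A smooth covering of a manifold by a vector space, with compact quotient by a group of
translations. -/
structure IsLatticeCover (I : ModelWithCorners ℝ E' H) (P : E → M) : Prop where
  contMDiff : ContMDiff 𝓘(ℝ, E) I ∞ P
  surjective : Surjective P
  exists_section : ∀ x, ∃ s : M → E, ContMDiffAt I 𝓘(ℝ, E) ∞ s (P x) ∧ s (P x) = x ∧
    (∀ᶠ m in 𝓝 (P x), P (s m) = m) ∧ ∀ᶠ y in 𝓝 x, s (P y) = y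
  deck : ∀ x y z, P x = P y → P (z + (x - y)) = P z
  exists_compact : ∃ K : Set E, IsCompact K ∧ ∀ x, ∃ y ∈ K, P y = P x

namespace IsLatticeCover

variable {P : E → M} (hP : IsLatticeCover I P)
include hP

/-- The map of the quotient that is induced by a map of the cover. -/
def descend (g : E → E) (m : M) : M := P (g (surjInv hP.surjective m))

lemma descend_apply {g : E → E} (hg : ∀ x y, P x = P y → P (g x) = P (g y)) (x : E) :
    hP.descend g (P x) = P (g x) :=
  hg _ _ (surjInv_eq hP.surjective (P x))

lemma contMDiff_descend {g : E → E} (hg : ∀ x y, P x = P y → P (g x) = P (g y))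
    (hgd : ContDiff ℝ ∞ g) : ContMDiff I I ∞ (hP.descend g) := by
  intro m
  obtain ⟨x, rfl⟩ := hP.surjective m
  obtain ⟨s, hs, hsx, hPs, -⟩ := hP.exists_section x
  have h1 : ContMDiffAt I I ∞ (fun m => P (g (s m))) (P x) :=
    (hP.contMDiff _).comp _ ((hgd.contMDiff _).comp _ hs)
  refine h1.congr_of_eventuallyEq ?_
  filter_upwards [hPs] with m' hm'
  rw [← hP.descend_apply hg, hm']

/-- A smooth periodic function on the cover is bounded on `[0, T]`. -/
lemma exists_bound {F : Type*} [SeminormedAddCommGroup F] {T : ℝ} {X : ℝ → E → F}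
    (hX : ContinuousOn (uncurry X) (Icc 0 T ×ˢ univ))
    (hper : ∀ t ∈ Icc 0 T, ∀ x y, P x = P y → X t x = X t y) :
    ∃ C : ℝ, 0 ≤ C ∧ ∀ t ∈ Icc 0 T, ∀ x, ‖X t x‖ ≤ C := by
  obtain ⟨K, hK, hKP⟩ := hP.exists_compact
  obtain ⟨C, hC⟩ := (isCompact_Icc.prod hK).exists_bound_of_continuousOn
    (hX.mono (prod_mono_right (subset_univ K)))
  refine ⟨max C 0, le_max_right _ _, fun t ht x => ?_⟩
  obtain ⟨y, hy, hyx⟩ := hKP x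
  rw [hper t ht x y hyx.symm]
  exact (hC (t, y) ⟨ht, hy⟩).trans (le_max_left _ _)

/-- A function constant on the fibres of P is invariant under translation by `x - y`. -/
lemma fderiv_periodic {F : Type*} [NormedAddCommGroup F] [NormedSpace ℝ F] {f : E → F}
    (hf : ∀ x y, P x = P y → f x = f y) {x y : E} (hxy : P x = P y) :
    fderiv ℝ f x = fderiv ℝ f y := by
  have h1 : f = fun z => f (z + (x - y)) := by
    funext z
    exact (hf _ _ (hP.deck x y z hxy)).symm
  conv_rhs => rw [h1, fderiv_comp_add_right, add_sub_cancel]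

end IsLatticeCover

lemma smoothFamily_iff {T : ℝ} {N : Type*} [TopologicalSpace N] {H' E'' : Type*}
    [NormedAddCommGroup E''] [NormedSpace ℝ E''] [TopologicalSpace H']
    {J : ModelWithCorners ℝ E'' H'} [ChartedSpace H' N] {f : ℝ → M → N} :
    SmoothFamily I J T f ↔
      ContMDiffOn (𝓘(ℝ, ℝ).prod I) J ∞ (uncurry f) (Icc 0 T ×ˢ univ) := Iff.rfl

/-- The lift of a smooth family to the cover. -/
lemma IsLatticeCover.contDiffOn_lift {P : E → M} (hP : IsLatticeCover I P) {T : ℝ}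
    {F : Type*} [NormedAddCommGroup F] [NormedSpace ℝ F] {f : ℝ → M → F}
    (hf : SmoothFamily I 𝓘(ℝ, F) T f) :
    ContDiffOn ℝ ∞ (uncurry fun t x => f t (P x)) (Icc 0 T ×ˢ univ) := by
  rw [← contMDiffOn_iff_contDiffOn]
  have h1 : ContMDiff 𝓘(ℝ, ℝ × E) (𝓘(ℝ, ℝ).prod I) ∞ fun z : ℝ × E => (z.1, P z.2) :=
    contDiff_fst.contMDiff.prodMk (hP.contMDiff.comp contDiff_snd.contMDiff)
  exact (smoothFamily_iff.1 hf).comp h1.contMDiffOn fun z hz => ⟨hz.1, mem_univ _⟩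

end Cover

section Flow

variable {E : Type} [NormedAddCommGroup E] [NormedSpace ℝ E] [FiniteDimensional ℝ E]
  {E' H M : Type*} [NormedAddCommGroup E'] [NormedSpace ℝ E'] [TopologicalSpace H]
  {I : ModelWithCorners ℝ E' H} [TopologicalSpace M] [ChartedSpace H M]

/-- The flow of a periodic vector field descends to a smooth family of diffeomorphisms. -/
theorem IsLatticeCover.exists_flow {P : E → M} (hP : IsLatticeCover I P) {T : ℝ} (hT : 0 ≤ T)
    {X : ℝ → E → E} (hX : ContDiffOn ℝ ∞ (uncurry X) (Icc 0 T ×ˢ univ))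
    (hper : ∀ t ∈ Icc 0 T, ∀ x y, P x = P y → X t x = X t y) :
    ∃ (Φ : ℝ → Diffeomorph I I M M ∞) (φ : ℝ → E → E), SmoothFamily I I T (fun t => Φ t) ∧
      (∀ m, Φ 0 m = m) ∧ (∀ t ∈ Icc 0 T, ∀ x, Φ t (P x) = P (φ t x)) ∧
      ContDiffOn ℝ ∞ (uncurry φ) (Icc 0 T ×ˢ univ) ∧
      (∀ t ∈ Icc 0 T, ∀ x, Injective (fderiv ℝ (φ t) x)) ∧
      ∀ x, ∀ t ∈ Icc 0 T, HasDerivWithinAt (fun s => φ s x) (X t (φ t x)) (Icc 0 T) t := by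
  obtain ⟨B, -, hB⟩ := hP.exists_bound hX.continuousOn hper
  obtain ⟨k, hk0, hk⟩ := hP.exists_bound (TimeODE.contDiffOn_fderiv_slice hX).continuousOn
    fun t ht x y hxy => hP.fderiv_periodic (hper t ht) hxy
  have hL : ∀ t ∈ Icc 0 T, LipschitzWith k.toNNReal (X t) := fun t ht =>
    lipschitzWith_of_nnnorm_fderiv_le ((TimeODE.contDiff_slice hX ht).differentiable (by simp))
      fun x => by
        rw [← NNReal.coe_le_coe, Real.coe_toNNReal _ hk0, coe_nnnorm]
        exact hk t ht x
  obtain ⟨φ, hφ, hφ0, hφd⟩ := TimeODE.exists_flow hT hX hL hB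
  -- Translations by periods take solutions to solutions, so by uniqueness the flow commutes with
  -- them.
  have hshift : ∀ t ∈ Icc 0 T, ∀ x y, P x = P y → ∀ z, φ t (z + (x - y)) = φ t z + (x - y) := by
    intro t ht x y hxy z
    refine TimeODE.solution_unique hL (hφd _) (g := fun s => φ s z + (x - y)) (fun s hs => ?_)
      (by simp [hφ0]) t ht
    rw [hper s hs _ _ (hP.deck x y (φ s z) hxy)]
    exact (hφd z s hs).add_const _
  have hcompat : ∀ t ∈ Icc 0 T, ∀ x y, P x = P y → P (φ t x) = P (φ t y) := by
    intro t ht x y hxy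
    have h := hshift t ht x y hxy y
    rw [add_sub_cancel] at h
    rw [h, hP.deck x y _ hxy]
  have hdiffeo : ∀ t, ∃ D : Diffeomorph I I M M ∞, t ∈ Icc 0 T → ∀ x, D (P x) = P (φ t x) := by
    intro t
    by_cases ht : t ∈ Icc 0 T
    swap
    -- Default value at times outside `[0, T]`, where nothing is required.
    · exact ⟨Diffeomorph.refl I M ∞, fun h => absurd h ht⟩
    obtain ⟨ψ, hψ, hψφ, hφψ⟩ := TimeODE.exists_flow_inverse hX hL hB hφ0 hφd ht
    have hcompat' : ∀ x y, P x = P y → P (ψ x) = P (ψ y) := by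
      intro x y hxy
      have h := hshift t ht x y hxy (ψ y)
      rw [hφψ, add_sub_cancel] at h
      rw [← h, hψφ, hP.deck x y _ hxy]
    refine ⟨⟨⟨hP.descend (φ t), hP.descend ψ, fun m => ?_, fun m => ?_⟩, ?_, ?_⟩, fun _ x => ?_⟩
    · obtain ⟨x, rfl⟩ := hP.surjective m
      rw [hP.descend_apply (hcompat t ht), hP.descend_apply hcompat', hψφ]
    · obtain ⟨x, rfl⟩ := hP.surjective m
      rw [hP.descend_apply hcompat', hP.descend_apply (hcompat t ht), hφψ]
    · exact hP.contMDiff_descend (hcompat t ht) (TimeODE.contDiff_slice hφ ht)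
    · exact hP.contMDiff_descend hcompat' hψ
    · exact hP.descend_apply (hcompat t ht) x
  choose Φ hΦ using hdiffeo
  refine ⟨Φ, φ, ?_, fun m => ?_, fun t ht => hΦ t ht, hφ, fun t ht x => ?_, hφd⟩
  · rw [smoothFamily_iff]
    rintro ⟨t, m⟩ ⟨ht, -⟩
    obtain ⟨x, rfl⟩ := hP.surjective m
    obtain ⟨s, hs, hsx, hPs, -⟩ := hP.exists_section x
    have h1 : ContMDiffWithinAt (𝓘(ℝ, ℝ).prod I) 𝓘(ℝ, ℝ × E) ∞ (fun z : ℝ × M => (z.1, s z.2))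
        (Icc 0 T ×ˢ univ) (t, P x) :=
      contMDiffWithinAt_fst.prodMk_space (ContMDiffAt.comp_contMDiffWithinAt (t, P x)
        (f := fun z : ℝ × M => z.2) (g := s) hs contMDiffWithinAt_snd)
    have h2 : ContMDiffWithinAt 𝓘(ℝ, ℝ × E) 𝓘(ℝ, E) ∞ (uncurry φ) (Icc 0 T ×ˢ univ) (t, s (P x)) :=
      hφ.contMDiffOn _ ⟨ht, mem_univ _⟩
    have h3 : ContMDiffWithinAt (𝓘(ℝ, ℝ).prod I) I ∞ (fun z : ℝ × M => P (φ z.1 (s z.2)))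
        (Icc 0 T ×ˢ univ) (t, P x) :=
      ContMDiffAt.comp_contMDiffWithinAt (t, P x) (g := P) (f := fun z : ℝ × M => φ z.1 (s z.2))
        (hP.contMDiff _) (ContMDiffWithinAt.comp (t, P x) (g := uncurry φ)
          (f := fun z : ℝ × M => (z.1, s z.2)) h2 h1 fun z hz => ⟨hz.1, mem_univ _⟩)
    refine h3.congr_of_eventuallyEq ?_ ?_
    · have h4 : ∀ᶠ z : ℝ × M in 𝓝[Icc 0 T ×ˢ univ] (t, P x), P (s z.2) = z.2 :=
        ((continuous_snd.tendsto (t, P x)).eventually hPs).filter_mono nhdsWithin_le_nhds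
      filter_upwards [h4, eventually_mem_nhdsWithin] with z hz1 hz2
      change Φ z.1 z.2 = P (φ z.1 (s z.2))
      rw [← hΦ z.1 hz2.1, hz1]
    · change Φ t (P x) = P (φ t (s (P x)))
      rw [hsx, hΦ t ht]
  · obtain ⟨x, rfl⟩ := hP.surjective m
    rw [hΦ 0 ⟨le_rfl, hT⟩, hφ0]
  · obtain ⟨ψ, hψ, hψφ, -⟩ := TimeODE.exists_flow_inverse hX hL hB hφ0 hφd ht
    have h1 := ((hψ.differentiable (by simp) (φ t x)).hasFDerivAt).comp x
      ((TimeODE.contDiff_slice hφ ht).differentiable (by simp) x).hasFDerivAt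
    have h2 : ψ ∘ φ t = id := funext hψφ
    rw [h2] at h1
    have h3 := h1.unique (hasFDerivAt_id x)
    intro v w hvw
    have h4 := congrArg (fderiv ℝ ψ (φ t x)) hvw
    rwa [← ContinuousLinearMap.comp_apply, ← ContinuousLinearMap.comp_apply, h3] at h4

end Flow

end

end HopfWillmore

namespace HopfWillmore

noncomputable section

open Filter Topology Function NNReal

/-! ### Reparametrization with normal velocity -/

namespace TimeODE

variable {E V : Type*} [NormedAddCommGroup E] [NormedSpace ℝ E] [NormedAddCommGroup V]
  [NormedSpace ℝ V] {f : ℝ → E → V} {T : ℝ}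

/-- The time derivative of a family on `[0, T]`. -/
def timeDeriv (T : ℝ) (f : ℝ → E → V) (t : ℝ) (x : E) : V :=
  derivWithin (fun s => f s x) (Icc 0 T) t

lemma hasDerivWithinAt_timeDeriv (hf : ContDiffOn ℝ ∞ (uncurry f) (Icc 0 T ×ˢ univ)) {t : ℝ}
    (ht : t ∈ Icc 0 T) (x : E) :
    HasDerivWithinAt (fun s => f s x) (timeDeriv T f t x) (Icc 0 T) t := by
  have h1 : ContDiffOn ℝ ∞ (fun s => f s x) (Icc 0 T) :=
    hf.comp (f := fun s : ℝ => (s, x)) (by fun_prop) fun s hs => ⟨hs, mem_univ _⟩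
  exact (h1.differentiableOn (by simp) t ht).hasDerivWithinAt

lemma hasFDerivAt_slice (hf : ContDiffOn ℝ ∞ (uncurry f) (Icc 0 T ×ˢ univ)) {t : ℝ}
    (ht : t ∈ Icc 0 T) (x : E) : HasFDerivAt (f t) (fderiv ℝ (f t) x) x :=
  ((contDiff_slice hf ht).differentiable (by simp) x).hasFDerivAt

lemma hasFDerivWithinAt_total (hf : ContDiffOn ℝ ∞ (uncurry f) (Icc 0 T ×ˢ univ)) {t : ℝ}
    (ht : t ∈ Icc 0 T) (x : E) :
    HasFDerivWithinAt (uncurry f) ((ContinuousLinearMap.fst ℝ ℝ E).smulRight (timeDeriv T f t x)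
      + (fderiv ℝ (f t) x).comp (ContinuousLinearMap.snd ℝ ℝ E)) (Icc 0 T ×ˢ univ) (t, x) :=
  hasFDerivWithinAt_uncurry (fun x _ ht => hasDerivWithinAt_timeDeriv hf ht x)
    (fun _ ht x => hasFDerivAt_slice hf ht x) (contDiffOn_fderiv_slice hf).continuousOn ht x

lemma uniqueDiffOn_slab (hT : 0 < T) : UniqueDiffOn ℝ (Icc 0 T ×ˢ (univ : Set E)) :=
  (uniqueDiffOn_Icc hT).prod uniqueDiffOn_univ

lemma contDiffOn_timeDeriv (hT : 0 < T) (hf : ContDiffOn ℝ ∞ (uncurry f) (Icc 0 T ×ˢ univ)) :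
    ContDiffOn ℝ ∞ (uncurry (timeDeriv T f)) (Icc 0 T ×ˢ univ) := by
  have h1 := (hf.fderivWithin (uniqueDiffOn_slab hT) (m := ∞) (by simp)).clm_apply
    (contDiffOn_const (c := ((1 : ℝ), (0 : E))))
  refine h1.congr fun z hz => ?_
  obtain ⟨t, x⟩ := z
  rw [(hasFDerivWithinAt_total hf hz.1 x).fderivWithin (uniqueDiffOn_slab hT _ hz)]
  simp [uncurry]

/-- The velocity of a moving point of a family. -/
lemma hasDerivWithinAt_along (hf : ContDiffOn ℝ ∞ (uncurry f) (Icc 0 T ×ˢ univ)) {t : ℝ}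
    (ht : t ∈ Icc 0 T) {y : ℝ → E} {y' : E} (hy : HasDerivWithinAt y y' (Icc 0 T) t) :
    HasDerivWithinAt (fun s => f s (y s)) (timeDeriv T f t (y t) + fderiv ℝ (f t) (y t) y')
      (Icc 0 T) t := by
  have h1 : HasDerivWithinAt (fun s => (s, y s)) ((1 : ℝ), y') (Icc 0 T) t :=
    (hasDerivWithinAt_id t _).prodMk hy
  have hm : MapsTo (fun s => (s, y s)) (Icc 0 T) (Icc 0 T ×ˢ (univ : Set E)) :=
    fun s hs => ⟨hs, mem_univ _⟩
  have h2 := HasFDerivWithinAt.comp_hasDerivWithinAt t (f := fun s => (s, y s))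
    (hasFDerivWithinAt_total hf ht (y t)) h1 hm
  have h3 : ((ContinuousLinearMap.fst ℝ ℝ E).smulRight (timeDeriv T f t (y t))
      + (fderiv ℝ (f t) (y t)).comp (ContinuousLinearMap.snd ℝ ℝ E)) ((1 : ℝ), y')
      = timeDeriv T f t (y t) + fderiv ℝ (f t) (y t) y' := by simp
  rw [h3] at h2
  exact h2

end TimeODE

open TimeODE

variable {E : Type} [NormedAddCommGroup E] [NormedSpace ℝ E] [FiniteDimensional ℝ E]
  {V : Type*} [NormedAddCommGroup V] [InnerProductSpace ℝ V] [FiniteDimensional ℝ V]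

/-- The inner product as a continuous bilinear map. -/
def innerB (V : Type*) [NormedAddCommGroup V] [InnerProductSpace ℝ V] [FiniteDimensional ℝ V] :
    V →L[ℝ] V →L[ℝ] ℝ := (innerₗ V).toContinuousBilinearMap

/-- The pull-back of the inner product. -/
def gram (D : E →L[ℝ] V) : E →L[ℝ] E →L[ℝ] ℝ :=
  ((ContinuousLinearMap.compL ℝ E V ℝ).flip D).comp ((innerB V).comp D)

omit [FiniteDimensional ℝ E] in
lemma gram_apply (D : E →L[ℝ] V) (x y : E) : gram D x y = inner ℝ (D x) (D y) := rfl

/-- For injective D the Gram form is positive definite, hence injective into the dual space, which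
has the same dimension. -/
lemma exists_gram_equiv {D : E →L[ℝ] V} (hD : Injective D) :
    ∃ e : E ≃L[ℝ] (E →L[ℝ] ℝ), (e : E →L[ℝ] E →L[ℝ] ℝ) = gram D := by
  have hinj : Injective (gram D : E →ₗ[ℝ] (E →L[ℝ] ℝ)) := by
    rw [← LinearMap.ker_eq_bot, LinearMap.ker_eq_bot']
    intro x hx
    have h1 : gram D x x = 0 := by
      have : gram D x = 0 := hx
      rw [this]; rfl
    rw [gram_apply, inner_self_eq_zero] at h1
    exact hD (by rw [h1, map_zero])
  have hfin : Module.finrank ℝ E = Module.finrank ℝ (E →L[ℝ] ℝ) := by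
    rw [← (LinearMap.toContinuousLinearMap (𝕜 := ℝ) (E := E) (F' := ℝ)).finrank_eq]
    exact (Subspace.dual_finrank_eq).symm
  refine ⟨(LinearEquiv.ofInjectiveOfFinrankEq _ hinj hfin).toContinuousLinearEquiv, ?_⟩
  ext x y
  rfl

/-- The tangential correction which makes a velocity `w` normal to the range of `D`. -/
def tangentialCorrection (D : E →L[ℝ] V) (w : V) : E :=
  -((gram D).inverse ((innerB V w).comp D))

lemma inner_add_tangentialCorrection {D : E →L[ℝ] V} (hD : Injective D) (w : V) (v : E) :
    inner ℝ (w + D (tangentialCorrection D w)) (D v) = (0 : ℝ) := by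
  obtain ⟨e, he⟩ := exists_gram_equiv hD
  have h1 : gram D ((gram D).inverse ((innerB V w).comp D)) = (innerB V w).comp D := by
    rw [← he, ContinuousLinearMap.inverse_equiv]
    simp
  have h2 : gram D ((gram D).inverse ((innerB V w).comp D)) v = inner ℝ w (D v) := by
    rw [h1]; rfl
  rw [inner_add_left, tangentialCorrection, map_neg, inner_neg_left, ← gram_apply, h2,
    add_neg_cancel]

/-- The Gram form is invertible by injectivity, and inversion is smooth at invertible operators. -/
lemma contDiffOn_tangentialCorrection {X : Type*} [NormedAddCommGroup X] [NormedSpace ℝ X]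
    {D : X → E →L[ℝ] V} {w : X → V} {s : Set X} (hD : ContDiffOn ℝ ∞ D s)
    (hw : ContDiffOn ℝ ∞ w s) (hinj : ∀ x ∈ s, Injective (D x)) :
    ContDiffOn ℝ ∞ (fun x => tangentialCorrection (D x) (w x)) s := by
  have : CompleteSpace E := FiniteDimensional.complete ℝ E
  have hg : ContDiffOn ℝ ∞ (fun x => gram (D x)) s := by
    have h1 : ContDiffOn ℝ ∞ (fun x => (ContinuousLinearMap.compL ℝ E V ℝ).flip (D x)) s :=
      ContDiff.comp_contDiffOn (g := fun D : E →L[ℝ] V => (ContinuousLinearMap.compL ℝ E V ℝ).flip D)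
        (ContinuousLinearMap.contDiff _) hD
    have h2 : ContDiffOn ℝ ∞ (fun x => (innerB V).comp (D x)) s := contDiffOn_const.clm_comp hD
    exact h1.clm_comp h2
  have hinv : ContDiffOn ℝ ∞ (fun x => (gram (D x)).inverse) s := by
    intro x hx
    obtain ⟨e, he⟩ := exists_gram_equiv (hinj x hx)
    have h3 : ContDiffAt ℝ ∞ ContinuousLinearMap.inverse (gram (D x)) := by
      rw [← he]; exact contDiffAt_map_inverse e
    exact h3.comp_contDiffWithinAt x (hg x hx)
  have hb : ContDiffOn ℝ ∞ (fun x => (innerB V (w x)).comp (D x)) s :=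
    ((innerB V).contDiff.comp_contDiffOn hw).clm_comp hD
  exact (hinv.clm_apply hb).neg

variable {E' H M : Type*} [NormedAddCommGroup E'] [NormedSpace ℝ E'] [TopologicalSpace H]
  {I : ModelWithCorners ℝ E' H} [TopologicalSpace M] [ChartedSpace H M]

/-- A smooth family of immersions can be reparametrized so that it moves in normal direction. -/
theorem IsLatticeCover.exists_normal_reparametrization {P : E → M} (hP : IsLatticeCover I P)
    {T : ℝ} (hT : 0 < T) {F : ℝ → M → V} (hF : SmoothFamily I 𝓘(ℝ, V) T F)
    (himm : ∀ t ∈ Icc 0 T, ∀ x, Injective (fderiv ℝ (fun y => F t (P y)) x)) :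
    ∃ Φ : ℝ → Diffeomorph I I M M ∞, SmoothFamily I I T (fun t => Φ t) ∧ (∀ m, Φ 0 m = m) ∧
      ∀ t ∈ Icc 0 T, ∀ x, Injective (fderiv ℝ (fun y => F t (Φ t (P y))) x) ∧
        ∃ d, HasDerivWithinAt (fun r => F r (Φ r (P x))) d (Icc 0 T) t ∧
          ∀ v, inner ℝ d (fderiv ℝ (fun y => F t (Φ t (P y))) x v) = (0 : ℝ) := by
  set f : ℝ → E → V := fun t x => F t (P x) with hf
  have hfs : ContDiffOn ℝ ∞ (uncurry f) (Icc 0 T ×ˢ univ) := hP.contDiffOn_lift hF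
  -- A point moving with velocity X in the cover has image velocity ∂ₜf + Df(X), and X is chosen to
  -- make this orthogonal to the range of Df. It is built from f alone, hence periodic.
  set X : ℝ → E → E := fun t x => tangentialCorrection (fderiv ℝ (f t) x) (timeDeriv T f t x)
    with hX
  have hXs : ContDiffOn ℝ ∞ (uncurry X) (Icc 0 T ×ˢ univ) :=
    contDiffOn_tangentialCorrection (contDiffOn_fderiv_slice hfs) (contDiffOn_timeDeriv hT hfs)
      fun z hz => himm z.1 hz.1 z.2
  have hfper : ∀ t x y, P x = P y → f t x = f t y := fun t x y h => by simp only [hf, h]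
  have hper : ∀ t ∈ Icc 0 T, ∀ x y, P x = P y → X t x = X t y := by
    intro t _ x y hxy
    have h1 : timeDeriv T f t x = timeDeriv T f t y := by
      simp only [timeDeriv, hfper _ x y hxy]
    simp only [hX, hP.fderiv_periodic (hfper t) hxy, h1]
  obtain ⟨Φ, φ, hΦs, hΦ0, hΦφ, hφ, hφinj, hφd⟩ := hP.exists_flow hT.le hXs hper
  refine ⟨Φ, hΦs, hΦ0, fun t ht x => ?_⟩
  have hchain : fderiv ℝ (fun y => F t (Φ t (P y))) x =
      (fderiv ℝ (f t) (φ t x)).comp (fderiv ℝ (φ t) x) := by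
    have h1 : (fun y => F t (Φ t (P y))) = f t ∘ φ t := by
      funext y
      simp only [hf, hΦφ t ht, comp_apply]
    rw [h1, fderiv_comp _ ((contDiff_slice hfs ht).differentiable (by simp) _)
      ((contDiff_slice hφ ht).differentiable (by simp) _)]
  rw [hchain]
  refine ⟨(himm t ht _).comp (hφinj t ht x),
    timeDeriv T f t (φ t x) + fderiv ℝ (f t) (φ t x) (X t (φ t x)), ?_, fun v =>
    inner_add_tangentialCorrection (himm t ht _) _ _⟩
  have h1 := hasDerivWithinAt_along hfs ht (hφd x t ht)
  refine h1.congr (fun s hs => ?_) ?_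
  · simp only [hf, hΦφ s hs]
  · simp only [hf, hΦφ t ht]

end

end HopfWillmore

namespace HopfWillmore

noncomputable section

open Filter Topology Function NNReal

/-! ### The universal covers of the circle and of the torus -/

attribute [local instance] finrank_real_complex_fact' in
lemma contMDiff_coe_circle : ContMDiff (𝓡 1) 𝓘(ℝ, ℂ) ∞ (fun z : Circle => (z : ℂ)) :=
  contMDiff_coe_sphere (E := ℂ) (n := 1)

/-- The section at `x` adds to `x` the principal angle of m / exp x. It is smooth near exp x and
inverts the exponential on (x - π, x + π). -/
lemma isLatticeCover_circle : IsLatticeCover (𝓡 1) (fun x : ℝ => Circle.exp x) where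
  contMDiff := contMDiff_circleExp
  surjective := Circle.exp_surjective
  exists_section := by
    intro x
    have hslit : ((Circle.exp x : ℂ) / (Circle.exp x : ℂ)) ∈ Complex.slitPlane := by
      rw [div_self (Circle.coe_ne_zero _)]; exact Complex.one_mem_slitPlane
    have hexp : ∀ m : Circle, Circle.exp (x + (Complex.log ((m : ℂ) / (Circle.exp x : ℂ))).im) = m := by
      intro m
      rw [Complex.log_im, ← Circle.coe_div, Circle.exp_add, Circle.exp_arg, mul_div_cancel]
    refine ⟨fun m => x + (Complex.log ((m : ℂ) / (Circle.exp x : ℂ))).im, ?_, ?_, ?_, ?_⟩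
    · have h1 : ContDiffAt ℝ ∞ (fun w : ℂ => x + (Complex.log (w / (Circle.exp x : ℂ))).im)
          (Circle.exp x) := by
        have h2 : ContDiffAt ℝ ∞ (fun w : ℂ => Complex.log (w / (Circle.exp x : ℂ)))
            (Circle.exp x) := by
          have h3 : ContDiffAt ℝ ∞ Complex.log ((Circle.exp x : ℂ) / (Circle.exp x : ℂ)) :=
            (Complex.contDiffAt_log hslit).restrict_scalars ℝ
          exact ContDiffAt.comp (Circle.exp x : ℂ) (f := fun w : ℂ => w / (Circle.exp x : ℂ)) h3
            (contDiffAt_id.div_const _)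
        exact contDiffAt_const.add (Complex.imCLM.contDiff.contDiffAt.comp _ h2)
      exact h1.contMDiffAt.comp (Circle.exp x) (contMDiff_coe_circle _)
    · simp
    · exact Eventually.of_forall hexp
    · have h4 : ∀ᶠ y in 𝓝 x, y ∈ Ioo (x - Real.pi) (x + Real.pi) :=
        Ioo_mem_nhds (by linarith [Real.pi_pos]) (by linarith [Real.pi_pos])
      filter_upwards [h4] with y hy
      rw [← Circle.coe_div, ← Circle.exp_sub, Complex.log_im, Circle.arg_exp (by linarith [hy.1])
        (by linarith [hy.2])]
      ring
  deck := by
    intro x y z h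
    rw [Circle.exp_add, Circle.exp_sub, h, div_self', mul_one]
  exists_compact := ⟨Icc (-Real.pi) Real.pi, isCompact_Icc, fun x =>
    ⟨Complex.arg (Circle.exp x), ⟨(Complex.neg_pi_lt_arg _).le, Complex.arg_le_pi _⟩,
      Circle.exp_arg _⟩⟩

section Torus

variable {M : Type*} [TopologicalSpace M] [ChartedSpace (EuclideanSpace ℝ (Fin 2)) M]
  (e : Diffeomorph (𝓡 2) ((𝓡 1).prod (𝓡 1)) M (Circle × Circle) ∞)

/-- The universal cover of a torus. -/
def torusCover (v : EuclideanSpace ℝ (Fin 2)) : M := e.symm (Circle.exp (v 0), Circle.exp (v 1))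

lemma torusCover_eq_iff {v w : EuclideanSpace ℝ (Fin 2)} : torusCover e v = torusCover e w ↔
    Circle.exp (v 0) = Circle.exp (w 0) ∧ Circle.exp (v 1) = Circle.exp (w 1) := by
  rw [← Prod.mk.injEq]
  exact e.symm.injective.eq_iff

lemma contDiff_coord (i : Fin 2) : ContDiff ℝ ∞ fun v : EuclideanSpace ℝ (Fin 2) => v i :=
  (EuclideanSpace.proj i : EuclideanSpace ℝ (Fin 2) →L[ℝ] ℝ).contDiff

lemma contDiff_toLp_pair : ContDiff ℝ ∞ fun p : ℝ × ℝ => !₂[p.1, p.2] := by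
  rw [contDiff_euclidean]
  intro i
  fin_cases i
  · exact contDiff_fst
  · exact contDiff_snd

lemma isLatticeCover_torus : IsLatticeCover (𝓡 2) (torusCover e) where
  contMDiff := e.symm.contMDiff.comp
    ((contMDiff_circleExp.comp (contDiff_coord 0).contMDiff).prodMk
      (contMDiff_circleExp.comp (contDiff_coord 1).contMDiff))
  surjective := by
    intro m
    obtain ⟨x, hx⟩ := Circle.exp_surjective (e m).1
    obtain ⟨y, hy⟩ := Circle.exp_surjective (e m).2
    refine ⟨!₂[x, y], ?_⟩
    simp [torusCover, hx, hy]
  exists_section := by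
    intro v
    obtain ⟨s, hs, hsx, hPs, hsP⟩ := isLatticeCover_circle.exists_section (v 0)
    obtain ⟨r, hr, hrx, hPr, hrP⟩ := isLatticeCover_circle.exists_section (v 1)
    have he : e (torusCover e v) = (Circle.exp (v 0), Circle.exp (v 1)) := e.apply_symm_apply _
    refine ⟨fun m => !₂[s (e m).1, r (e m).2], ?_, ?_, ?_, ?_⟩
    · have h1 : ContMDiffAt (𝓡 2) 𝓘(ℝ, ℝ) ∞ (fun m => s (e m).1) (torusCover e v) := by
        refine ContMDiffAt.comp (torusCover e v) (g := s) (f := fun m => (e m).1) ?_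
          (contMDiff_fst.comp e.contMDiff _)
        rw [he]; exact hs
      have h2 : ContMDiffAt (𝓡 2) 𝓘(ℝ, ℝ) ∞ (fun m => r (e m).2) (torusCover e v) := by
        refine ContMDiffAt.comp (torusCover e v) (g := r) (f := fun m => (e m).2) ?_
          (contMDiff_snd.comp e.contMDiff _)
        rw [he]; exact hr
      exact (contDiff_toLp_pair.contMDiff _).comp (torusCover e v) (h1.prodMk_space h2)
    · ext i
      fin_cases i
      · simp [he, hsx]
      · simp [he, hrx]
    · have h1 : ∀ᶠ m in 𝓝 (torusCover e v), Circle.exp (s (e m).1) = (e m).1 := by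
        have h2 : Tendsto (fun m => (e m).1) (𝓝 (torusCover e v)) (𝓝 (Circle.exp (v 0))) := by
          have h3 := (continuous_fst.comp e.continuous).tendsto (torusCover e v)
          rwa [comp_apply, he] at h3
        exact h2.eventually hPs
      have h2 : ∀ᶠ m in 𝓝 (torusCover e v), Circle.exp (r (e m).2) = (e m).2 := by
        have h2 : Tendsto (fun m => (e m).2) (𝓝 (torusCover e v)) (𝓝 (Circle.exp (v 1))) := by
          have h3 := (continuous_snd.comp e.continuous).tendsto (torusCover e v)
          rwa [comp_apply, he] at h3
        exact h2.eventually hPr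
      filter_upwards [h1, h2] with m hm1 hm2
      simp [torusCover, hm1, hm2]
    · have h1 := ((contDiff_coord 0).continuous.tendsto v).eventually hsP
      have h2 := ((contDiff_coord 1).continuous.tendsto v).eventually hrP
      filter_upwards [h1, h2] with w hw1 hw2
      have hew : e (torusCover e w) = (Circle.exp (w 0), Circle.exp (w 1)) := e.apply_symm_apply _
      ext i
      fin_cases i
      · simp [hew, hw1]
      · simp [hew, hw2]
  deck := by
    intro x y z h
    rw [torusCover_eq_iff] at h ⊢
    exact ⟨isLatticeCover_circle.deck _ _ _ h.1, isLatticeCover_circle.deck _ _ _ h.2⟩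
  exists_compact := by
    obtain ⟨K, hK, hKP⟩ := isLatticeCover_circle.exists_compact
    refine ⟨(fun p : ℝ × ℝ => !₂[p.1, p.2]) '' K ×ˢ K,
      (hK.prod hK).image contDiff_toLp_pair.continuous, fun v => ?_⟩
    obtain ⟨x, hx, hxv⟩ := hKP (v 0)
    obtain ⟨y, hy, hyv⟩ := hKP (v 1)
    exact ⟨!₂[x, y], ⟨(x, y), ⟨hx, hy⟩, rfl⟩, (torusCover_eq_iff e).2 ⟨by simpa using hxv,
      by simpa using hyv⟩⟩

end Torus

end

end HopfWillmore

namespace HopfWillmore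

noncomputable section

open Filter Topology Function NNReal

/-! ### Smoothness and normality of the Willmore gradient -/

namespace Surface

variable {G : EuclideanSpace ℝ (Fin 2) → ℍ[ℝ]} {p : EuclideanSpace ℝ (Fin 2)}

lemma fderiv_eq_sum (v : EuclideanSpace ℝ (Fin 2)) :
    fderiv ℝ G p v = ∑ i, v i • pd i G p := by
  have h1 : v = ∑ i, v i • EuclideanSpace.single i (1 : ℝ) := by
    ext j
    fin_cases j <;> simp
  conv_lhs => rw [h1]
  simp only [map_sum, map_smul, pd]

/-- A null vector of the metric has image of length zero under the differential. -/
lemma det_metric_ne_zero (hinj : Injective (fderiv ℝ G p)) : (metric G p).det ≠ 0 := by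
  intro h
  obtain ⟨v, hv, hgv⟩ := Matrix.exists_mulVec_eq_zero_iff.2 h
  have h1 : ∑ i, v i * (metric G p).mulVec v i = 0 := by simp [hgv]
  have h2 : inner ℝ (fderiv ℝ G p (WithLp.toLp 2 v)) (fderiv ℝ G p (WithLp.toLp 2 v)) = (0 : ℝ) := by
    rw [fderiv_eq_sum, ← h1]
    simp only [Matrix.mulVec, dotProduct, metric, Matrix.of_apply, Fin.sum_univ_two,
      inner_add_left, inner_add_right, real_inner_smul_left, real_inner_smul_right]
    ring
  rw [inner_self_eq_zero] at h2
  have h3 : WithLp.toLp 2 v = (0 : EuclideanSpace ℝ (Fin 2)) := hinj (by rw [h2, map_zero])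
  exact hv (by simpa using congrArg WithLp.ofLp h3)

section Normal

variable (hdet : (metric G p).det ≠ 0) (hnorm : ‖G p‖ = 1)
  (htan : ∀ i, inner ℝ (pd i G p) (G p) = (0 : ℝ))
include hdet in
lemma sum_metric_mul_metricInv (k j : Fin 2) :
    ∑ i, metric G p k i * metricInv G p i j = (1 : Matrix (Fin 2) (Fin 2) ℝ) k j := by
  rw [metricInv, ← Matrix.mul_apply, Matrix.mul_nonsing_inv _ (isUnit_iff_ne_zero.2 hdet)]

include htan in
lemma inner_projTan (v : ℍ[ℝ]) : inner ℝ (projTan G p v) (G p) = (0 : ℝ) := by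
  simp only [projTan, sum_inner, real_inner_smul_left, htan, mul_zero, Finset.sum_const_zero]

include hnorm in
lemma inner_projS3 (v : ℍ[ℝ]) : inner ℝ (projS3 G p v) (G p) = (0 : ℝ) := by
  rw [projS3, inner_sub_left, real_inner_smul_left, real_inner_self_eq_norm_sq, hnorm]
  ring

include hnorm htan in
lemma inner_perp_self (v : ℍ[ℝ]) : inner ℝ (perp G p v) (G p) = (0 : ℝ) := by
  rw [perp, inner_sub_left, inner_projTan htan, inner_projS3 hnorm, sub_zero]

include hdet in
lemma inner_perp_pd (k : Fin 2) (v : ℍ[ℝ]) : inner ℝ (perp G p v) (pd k G p) = (0 : ℝ) := by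
  rw [perp]
  set w := projS3 G p v
  have h0 := sum_metric_mul_metricInv hdet k 0
  have h1 := sum_metric_mul_metricInv hdet k 1
  have hs : ∀ i, inner ℝ (pd i G p) (pd k G p) = metric G p k i := fun i =>
    real_inner_comm _ _
  simp only [Fin.sum_univ_two] at h0 h1
  simp only [projTan, Fin.sum_univ_two, inner_sub_left, inner_add_left, real_inner_smul_left, hs]
  have h2 : inner ℝ w (pd k G p) = (1 : Matrix (Fin 2) (Fin 2) ℝ) k 0 * inner ℝ w (pd 0 G p)
      + (1 : Matrix (Fin 2) (Fin 2) ℝ) k 1 * inner ℝ w (pd 1 G p) := by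
    obtain rfl | rfl : k = 0 ∨ k = 1 := by omega
    · simp
    · simp
  rw [h2, ← h0, ← h1]
  ring

lemma perp_eq_self {v : ℍ[ℝ]} (hv : inner ℝ v (G p) = (0 : ℝ))
    (hvt : ∀ i, inner ℝ v (pd i G p) = (0 : ℝ)) : perp G p v = v := by
  have h1 : projS3 G p v = v := by rw [projS3, hv, zero_smul, sub_zero]
  rw [perp, h1, projTan]
  simp [hvt]

/-- The Willmore gradient is orthogonal to all vectors that are orthogonal to the normal space. -/
lemma inner_willmoreGrad {x : ℍ[ℝ]} (hx : ∀ v, inner ℝ (perp G p v) x = (0 : ℝ)) :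
    inner ℝ (willmoreGrad G p) x = (0 : ℝ) := by
  simp only [willmoreGrad, normalLaplacian, Q, traceFree, meanCurv, secondFF, normalDeriv,
    inner_add_left, inner_sub_left, sum_inner, real_inner_smul_left, hx, mul_zero,
    Finset.sum_const_zero, sub_zero, add_zero]

end Normal

section Smooth

variable {W : Set (EuclideanSpace ℝ (Fin 2))} (hW : IsOpen W) (hG : ContDiffOn ℝ ∞ G W)
  (hdet : ∀ p ∈ W, (metric G p).det ≠ 0)
include hW hG

lemma contDiffOn_metric (i j : Fin 2) : ContDiffOn ℝ ∞ (fun p => metric G p i j) W :=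
  (contDiffOn_pd hW hG i).inner ℝ (contDiffOn_pd hW hG j)

include hdet

lemma contDiffOn_metricInv (i j : Fin 2) : ContDiffOn ℝ ∞ (fun p => metricInv G p i j) W := by
  have hm := contDiffOn_metric hW hG
  have h1 : ContDiffOn ℝ ∞ (fun p => (metric G p).det) W := by
    simp only [Matrix.det_fin_two]
    exact ((hm 0 0).mul (hm 1 1)).sub ((hm 0 1).mul (hm 1 0))
  have h2 : ContDiffOn ℝ ∞ (fun p => (metric G p).adjugate i j) W := by
    simp only [Matrix.adjugate_fin_two]
    fin_cases i <;> fin_cases j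
    · exact hm 1 1
    · exact (hm 0 1).neg
    · exact (hm 1 0).neg
    · exact hm 0 0
  refine ((h1.fun_inv hdet).mul h2).congr fun p _ => ?_
  rw [metricInv, Matrix.inv_def, Ring.inverse_eq_inv', Matrix.smul_apply, smul_eq_mul]

lemma contDiffOn_perp {V : EuclideanSpace ℝ (Fin 2) → ℍ[ℝ]} (hV : ContDiffOn ℝ ∞ V W) :
    ContDiffOn ℝ ∞ (fun p => perp G p (V p)) W := by
  have h1 : ContDiffOn ℝ ∞ (fun p => projS3 G p (V p)) W := hV.sub ((hV.inner ℝ hG).smul hG)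
  refine h1.sub (ContDiffOn.sum fun i _ => ContDiffOn.sum fun j _ => ?_)
  exact ((contDiffOn_metricInv hW hG hdet i j).mul (h1.inner ℝ (contDiffOn_pd hW hG j))).smul
    (contDiffOn_pd hW hG i)

lemma contDiffOn_normalDeriv {V : EuclideanSpace ℝ (Fin 2) → ℍ[ℝ]} (hV : ContDiffOn ℝ ∞ V W)
    (i : Fin 2) : ContDiffOn ℝ ∞ (normalDeriv G i V) W :=
  contDiffOn_perp hW hG hdet (contDiffOn_pd hW hV i)

lemma contDiffOn_secondFF (i j : Fin 2) : ContDiffOn ℝ ∞ (secondFF G i j) W :=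
  contDiffOn_normalDeriv hW hG hdet (contDiffOn_pd hW hG j) i

lemma contDiffOn_meanCurv : ContDiffOn ℝ ∞ (meanCurv G) W :=
  ContDiffOn.sum fun i _ => ContDiffOn.sum fun j _ =>
    (contDiffOn_metricInv hW hG hdet i j).smul (contDiffOn_secondFF hW hG hdet i j)

lemma contDiffOn_traceFree (i j : Fin 2) : ContDiffOn ℝ ∞ (traceFree G i j) W :=
  (contDiffOn_secondFF hW hG hdet i j).sub
    (((contDiffOn_metric hW hG i j).div_const 2).smul (contDiffOn_meanCurv hW hG hdet))

lemma contDiffOn_christoffel (m k l : Fin 2) : ContDiffOn ℝ ∞ (christoffel G m k l) W :=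
  ContDiffOn.sum fun j _ => (contDiffOn_metricInv hW hG hdet m j).mul
    ((contDiffOn_pd hW (contDiffOn_pd hW hG l) k).inner ℝ (contDiffOn_pd hW hG j))

lemma contDiffOn_willmoreGrad : ContDiffOn ℝ ∞ (willmoreGrad G) W := by
  have hH := contDiffOn_meanCurv hW hG hdet
  have hg := contDiffOn_metricInv hW hG hdet
  have hN := fun l => contDiffOn_normalDeriv hW hG hdet hH l
  have hA := contDiffOn_traceFree hW hG hdet
  refine ContDiffOn.smul (contDiffOn_const (c := (1 / 2 : ℝ))) (ContDiffOn.add ?_ ?_)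
  · exact ContDiffOn.sum fun k _ => ContDiffOn.sum fun l _ => (hg k l).smul
      ((contDiffOn_normalDeriv hW hG hdet (hN l) k).sub (ContDiffOn.sum fun m _ =>
        (contDiffOn_christoffel hW hG hdet m k l).smul (hN m)))
  · exact ContDiffOn.sum fun i _ => ContDiffOn.sum fun j _ => ContDiffOn.sum fun k _ =>
      ContDiffOn.sum fun l _ => (((hg i k).mul (hg j l)).mul ((hA k l).inner ℝ hH)).smul (hA i j)

end Smooth

end Surface

/-! ### Differentials in charts and in covers -/

section Differential

variable {E E' H M V : Type*} [NormedAddCommGroup E] [NormedSpace ℝ E] [NormedAddCommGroup E']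
  [NormedSpace ℝ E'] [TopologicalSpace H] {I : ModelWithCorners ℝ E' H} [TopologicalSpace M]
  [ChartedSpace H M] [NormedAddCommGroup V] [NormedSpace ℝ V]

namespace IsLatticeCover

variable {P : E → M} (hP : IsLatticeCover I P)
include hP

/-- The local section is a left inverse of P near `x` and a right inverse near `P x`. The chain rule
gives injectivity here and surjectivity in `mfderiv_surjective`. -/
lemma mfderiv_injective (x : E) : Injective (mfderiv 𝓘(ℝ, E) I P x) := by
  obtain ⟨s, hs, -, -, hsP⟩ := hP.exists_section x
  have h1 := (hs.mdifferentiableAt (by simp)).hasMFDerivAt.comp x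
    ((hP.contMDiff x).mdifferentiableAt (by simp)).hasMFDerivAt
  have h2 : HasMFDerivAt 𝓘(ℝ, E) 𝓘(ℝ, E) (s ∘ P) x (ContinuousLinearMap.id ℝ E) :=
    (hasMFDerivAt_id x).congr_of_eventuallyEq hsP
  have h3 := hasMFDerivAt_unique h1 h2
  intro v w hvw
  have h4 := congrArg (mfderiv I 𝓘(ℝ, E) s (P x)) hvw
  have h5 : ∀ v, mfderiv I 𝓘(ℝ, E) s (P x) (mfderiv 𝓘(ℝ, E) I P x v) = v := fun v =>
    DFunLike.congr_fun h3 v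
  rwa [h5, h5] at h4

lemma mfderiv_surjective (x : E) : Surjective (mfderiv 𝓘(ℝ, E) I P x) := by
  obtain ⟨s, hs, hsx, hPs, -⟩ := hP.exists_section x
  have h0 : HasMFDerivAt 𝓘(ℝ, E) I P (s (P x)) (mfderiv 𝓘(ℝ, E) I P x : E →L[ℝ] E') := by
    rw [hsx]
    exact ((hP.contMDiff x).mdifferentiableAt (by simp)).hasMFDerivAt
  have h1 := h0.comp (P x) (hs.mdifferentiableAt (by simp)).hasMFDerivAt
  have h2 : HasMFDerivAt I I (P ∘ s) (P x) (ContinuousLinearMap.id ℝ (TangentSpace I (P x))) :=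
    (hasMFDerivAt_id (P x)).congr_of_eventuallyEq hPs
  have h3 := hasMFDerivAt_unique h1 h2
  intro v
  exact ⟨mfderiv I 𝓘(ℝ, E) s (P x) v, DFunLike.congr_fun h3 v⟩

lemma fderiv_lift_apply {f : M → V} {x : E} (hf : MDifferentiableAt I 𝓘(ℝ, V) f (P x)) (v : E) :
    fderiv ℝ (fun y => f (P y)) x v = mfderiv I 𝓘(ℝ, V) f (P x) (mfderiv 𝓘(ℝ, E) I P x v) := by
  have h1 := mfderiv_comp x hf ((hP.contMDiff x).mdifferentiableAt (by simp))
  rw [mfderiv_eq_fderiv] at h1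
  exact DFunLike.congr_fun h1 v

lemma injective_fderiv_lift {f : M → V} {x : E} (hf : MDifferentiableAt I 𝓘(ℝ, V) f (P x))
    (hinj : Injective (mfderiv I 𝓘(ℝ, V) f (P x))) :
    Injective (fderiv ℝ (fun y => f (P y)) x) := by
  intro v w hvw
  rw [hP.fderiv_lift_apply hf, hP.fderiv_lift_apply hf] at hvw
  exact hP.mfderiv_injective x (hinj hvw)

lemma injective_mfderiv {f : M → V} {x : E} (hf : MDifferentiableAt I 𝓘(ℝ, V) f (P x))
    (hinj : Injective (fderiv ℝ (fun y => f (P y)) x)) :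
    Injective (mfderiv I 𝓘(ℝ, V) f (P x)) := by
  intro v w hvw
  obtain ⟨v, rfl⟩ := hP.mfderiv_surjective x v
  obtain ⟨w, rfl⟩ := hP.mfderiv_surjective x w
  rw [hinj ((hP.fderiv_lift_apply hf v).trans (hvw.trans (hP.fderiv_lift_apply hf w).symm))]

lemma inner_mfderiv_eq_zero {V : Type*} [NormedAddCommGroup V] [InnerProductSpace ℝ V]
    {f : M → V} {x : E} (hf : MDifferentiableAt I 𝓘(ℝ, V) f (P x)) {d : V}
    (hd : ∀ v, inner ℝ d (fderiv ℝ (fun y => f (P y)) x v) = (0 : ℝ)) (v : TangentSpace I (P x)) :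
    inner ℝ d (mfderiv I 𝓘(ℝ, V) f (P x) v : V) = (0 : ℝ) := by
  obtain ⟨v, rfl⟩ := hP.mfderiv_surjective x v
  exact (congrArg (fun w : V => inner ℝ d w) (hP.fderiv_lift_apply hf v)).symm.trans (hd v)

end IsLatticeCover

variable [IsManifold I ∞ M]

lemma contDiffOn_chart {f : M → V} (hf : ContMDiff I 𝓘(ℝ, V) ∞ f) (q : M) :
    ContDiffOn ℝ ∞ (f ∘ (extChartAt I q).symm) (extChartAt I q).target :=
  contMDiffOn_iff_contDiffOn.1 (hf.comp_contMDiffOn (contMDiffOn_extChartAt_symm q))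

variable [I.Boundaryless]

lemma fderiv_chart_apply {f : M → V} (hf : ContMDiff I 𝓘(ℝ, V) ∞ f) (q : M) {p : E'}
    (hp : p ∈ (extChartAt I q).target) (v : E') :
    fderiv ℝ (f ∘ (extChartAt I q).symm) p v = mfderiv I 𝓘(ℝ, V) f ((extChartAt I q).symm p)
      (mfderiv 𝓘(ℝ, E') I (extChartAt I q).symm p v) := by
  have h0 : MDifferentiableAt 𝓘(ℝ, E') I (extChartAt I q).symm p :=
    ((contMDiffOn_extChartAt_symm (n := ∞) q).contMDiffAt
      ((isOpen_extChartAt_target q).mem_nhds hp)).mdifferentiableAt (by simp)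
  have h1 := mfderiv_comp p ((hf _).mdifferentiableAt (by simp)) h0
  rw [mfderiv_eq_fderiv] at h1
  exact DFunLike.congr_fun h1 v

lemma injective_fderiv_chart {f : M → V} (hf : ContMDiff I 𝓘(ℝ, V) ∞ f) (q : M) {p : E'}
    (hp : p ∈ (extChartAt I q).target)
    (hinj : Injective (mfderiv I 𝓘(ℝ, V) f ((extChartAt I q).symm p))) :
    Injective (fderiv ℝ (f ∘ (extChartAt I q).symm) p) := by
  have h1 : Injective (mfderiv 𝓘(ℝ, E') I (extChartAt I q).symm p) := by
    have : IsManifold I 1 M := IsManifold.of_le (n := ∞) (by simp)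
    have h2 := (isInvertible_mfderivWithin_extChartAt_symm hp).injective
    rwa [I.range_eq_univ, mfderivWithin_univ] at h2
  intro v w hvw
  rw [fderiv_chart_apply hf q hp, fderiv_chart_apply hf q hp] at hvw
  exact h1 (hinj hvw)

end Differential

end

end HopfWillmore

namespace HopfWillmore

noncomputable section

open Filter Topology Function NNReal

/-! ### The differential of the Hopf fibration -/

/-- The involution `tilde` as a continuous linear map. -/
def tildeL : ℍ[ℝ] →L[ℝ] ℍ[ℝ] :=
  LinearMap.toContinuousLinearMap
    { toFun := tilde
      map_add' := fun a b => by ext <;> simp [add_comm]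
      map_smul' := fun r a => by ext <;> simp }

/-- The differential of the Hopf fibration. -/
def hopfDeriv (q : ℍ[ℝ]) : ℍ[ℝ] →L[ℝ] ℍ[ℝ] :=
  (ContinuousLinearMap.mul ℝ ℍ[ℝ]) (tilde q) + ((ContinuousLinearMap.mul ℝ ℍ[ℝ]).flip q).comp tildeL

lemma hopfDeriv_apply (q v : ℍ[ℝ]) : hopfDeriv q v = tilde q * v + tilde v * q := rfl

lemma contDiff_hopf : ContDiff ℝ ∞ hopf := tildeL.contDiff.mul contDiff_id

lemma hasFDerivAt_hopf (q : ℍ[ℝ]) : HasFDerivAt hopf (hopfDeriv q) q := by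
  have h1 := (tildeL.hasFDerivAt (x := q)).mul' (hasFDerivAt_id q)
  refine h1.congr_fderiv ?_
  ext v : 1
  rfl

/-- `tilde` is an isometry fixing `n` and exchanging the two terms of the product rule, so both
contribute equally. -/
lemma inner_hopfDeriv (q v : ℍ[ℝ]) {n : ℍ[ℝ]} (hn : n.imI = 0) :
    inner ℝ (hopfDeriv q v) n = (2 * inner ℝ v (twist q * n) : ℝ) := by
  rw [hopfDeriv_apply, inner_eq, inner_eq]
  simp [twist, hn]
  ring

/-- The second imaginary unit. -/
def unitJ : ℍ[ℝ] := ⟨0, 0, 1, 0⟩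

@[simp] lemma unitJ_re : unitJ.re = 0 := rfl
@[simp] lemma unitJ_imI : unitJ.imI = 0 := rfl
@[simp] lemma unitJ_imJ : unitJ.imJ = 1 := rfl
@[simp] lemma unitJ_imK : unitJ.imK = 0 := rfl

/-- By `inner_hopfDeriv` a vector in the kernel is orthogonal to `twist q` times 1, j and k, which
leaves only the fibre direction. -/
lemma eq_smul_of_hopfDeriv_eq_zero {q v : ℍ[ℝ]} (hq : ‖q‖ = 1) (h : hopfDeriv q v = 0) :
    ∃ r : ℝ, v = r • (twist q * unitI) := by
  have hL : ‖twist q‖ = 1 := by rw [norm_twist, hq]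
  set u := star (twist q) * v with hu
  have hv : v = twist q * u := by rw [hu, ← mul_assoc, mul_star_of_norm hL, one_mul]
  have h1 : ∀ n : ℍ[ℝ], n.imI = 0 → inner ℝ u n = (0 : ℝ) := by
    intro n hn
    have h2 := inner_hopfDeriv q v hn
    rw [h, inner_zero_left, hv, inner_mul_left_of_norm hL] at h2
    linarith
  have h2 := h1 1 (by simp)
  have h3 := h1 unitJ (by simp)
  have h4 := h1 (unitI * unitJ) (by simp)
  rw [inner_eq] at h2 h3 h4
  simp at h2 h3 h4
  refine ⟨u.imI, ?_⟩
  rw [hv, ← mul_smul_comm]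
  congr 1
  ext <;> simp [h2, h3, h4]

/-- For w ≠ -1 the preimage is 1 + w, normalized: `tilde` fixes it, and (1 + w)² = (2 + 2 Re w) w
for unit w. For w = -1 the preimage is j. -/
lemma exists_hopf_eq {w : ℍ[ℝ]} (hw : w ∈ S2) : ∃ q ∈ S3, hopf q = w := by
  obtain ⟨hn, hi⟩ := hw
  have hn' := (norm_eq_one_iff w).1 hn
  rw [hi] at hn'
  by_cases h : w.re = -1
  · refine ⟨unitJ, (norm_eq_one_iff _).2 (by simp), ?_⟩
    rw [h] at hn'
    have hJ : w.imJ = 0 := by nlinarith [mul_self_nonneg w.imJ, mul_self_nonneg w.imK]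
    have hK : w.imK = 0 := by nlinarith [mul_self_nonneg w.imJ, mul_self_nonneg w.imK]
    ext <;> simp [hopf, h, hi, hJ, hK]
  · have hpos : 0 < 2 + 2 * w.re := by
      have h1 : -1 ≤ w.re := by nlinarith [mul_self_nonneg w.imJ, mul_self_nonneg w.imK]
      have h2 : -1 < w.re := lt_of_le_of_ne h1 (Ne.symm h)
      linarith
    set r : ℝ := (Real.sqrt (2 + 2 * w.re))⁻¹ with hr
    have hr2 : r * r * (2 + 2 * w.re) = 1 := by
      rw [hr, ← mul_inv, Real.mul_self_sqrt hpos.le, inv_mul_cancel₀ hpos.ne']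
    refine ⟨r • (1 + w), (norm_eq_one_iff _).2 ?_, ?_⟩
    · simp [hi]
      linear_combination (r * r) * hn' + hr2
    · ext
      · simp [hopf, hi]
        linear_combination (r * r) * (-hn') + w.re * hr2
      · simp [hopf, hi]; ring
      · simp [hopf, hi]
        linear_combination w.imJ * hr2
      · simp [hopf, hi]
        linear_combination w.imK * hr2

/-! ### Connected sets of vanishing length -/

/-- The distance to `x` is 1-Lipschitz and its values on `s` fill the interval from 0 to `dist x y`,
whose length must then vanish. -/
lemma _root_.IsPreconnected.subsingleton_of_hausdorffMeasure_eq_zero {X : Type*} [MetricSpace X]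
    [MeasurableSpace X] [BorelSpace X] {s : Set X} (hs : IsPreconnected s)
    (h : MeasureTheory.Measure.hausdorffMeasure 1 s = 0) : s.Subsingleton := by
  intro x hx y hy
  have h1 : Icc 0 (dist x y) ⊆ dist x '' s :=
    ((hs.image (dist x) (by fun_prop)).ordConnected).out ⟨x, hx, dist_self x⟩ ⟨y, hy, rfl⟩
  have h2 := (LipschitzWith.dist_right x).hausdorffMeasure_image_le zero_le_one s
  rw [h, mul_zero, MeasureTheory.hausdorffMeasure_real] at h2
  have h3 := (MeasureTheory.measure_mono h1).trans h2
  rw [Real.volume_Icc, nonpos_iff_eq_zero, ENNReal.ofReal_eq_zero, sub_zero] at h3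
  exact dist_le_zero.1 h3

/-! ### Comparison of velocities -/

/-- If a moving point stays on a moving curve, then their velocities agree up to vectors that are
tangent to the curve. -/
lemma inner_velocity_eq {V : Type*} [NormedAddCommGroup V] [InnerProductSpace ℝ V]
    {S : Set ℝ} {t x : ℝ} [(𝓝[S \ {t}] t).NeBot] {g : ℝ × ℝ → V} {A B : V}
    (hg : HasFDerivWithinAt g ((ContinuousLinearMap.fst ℝ ℝ ℝ).smulRight A
      + (ContinuousLinearMap.snd ℝ ℝ ℝ).smulRight B) (S ×ˢ univ) (t, x))
    (hB : B ≠ 0) {h : ℝ → V} {h' : V} (hh : HasDerivWithinAt h h' S t) {y : ℝ → ℝ}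
    (hy : Tendsto y (𝓝[S] t) (𝓝 x)) (hgh : ∀ᶠ s in 𝓝[S] t, g (s, y s) = h s)
    (h0 : g (t, x) = h t) {n : V} (hn : inner ℝ B n = (0 : ℝ)) :
    inner ℝ h' n = (inner ℝ A n : ℝ) := by
  set u : ℝ → ℝ := fun s => |s - t| + |y s - x| with hu
  have hB' : 0 < ‖B‖ := norm_pos_iff.2 hB
  have hlim : Tendsto (fun s => (s, y s)) (𝓝[S] t) (𝓝[S ×ˢ univ] (t, x)) := by
    rw [nhdsWithin_prod_eq, nhdsWithin_univ]
    exact tendsto_id.prodMk hy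
  set R : ℝ → V := fun s => (s - t) • (A - h') + (y s - x) • B with hR
  -- `R` is the difference of two linearizations of the same moving point, hence of smaller order
  -- than the total increment `u`.
  have hRo : ∀ ε > 0, ∀ᶠ s in 𝓝[S] t, ‖R s‖ ≤ ε * u s := by
    intro ε hε
    have h1 := hlim.eventually (hg.isLittleO.bound (half_pos hε))
    have h2 := (hasDerivWithinAt_iff_isLittleO.1 hh).bound (half_pos hε)
    filter_upwards [h1, h2, hgh] with s hs1 hs2 hs3
    have h4 : R s = (h s - h t - (s - t) • h') - (g (s, y s) - g (t, x)
        - ((ContinuousLinearMap.fst ℝ ℝ ℝ).smulRight A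
          + (ContinuousLinearMap.snd ℝ ℝ ℝ).smulRight B) ((s, y s) - (t, x))) := by
      simp only [hs3, h0, hR, add_apply, ContinuousLinearMap.smulRight_apply,
        ContinuousLinearMap.coe_fst', ContinuousLinearMap.coe_snd', Prod.fst_sub, Prod.snd_sub]
      module
    have h5 : ‖(s, y s) - (t, x)‖ ≤ u s := by
      rw [Prod.norm_def]
      exact max_le (le_add_of_nonneg_right (abs_nonneg _)) (le_add_of_nonneg_left (abs_nonneg _))
    have h6 : ‖s - t‖ ≤ u s := le_add_of_nonneg_right (abs_nonneg _)
    rw [h4]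
    refine (norm_sub_le _ _).trans ?_
    nlinarith
  -- `y` is not assumed differentiable. Since B ≠ 0, half of the term (y s - x) • B absorbs the
  -- error, which bounds y s - x linearly in |s - t|.
  obtain ⟨C, hC⟩ : ∃ C, ∀ᶠ s in 𝓝[S] t, u s ≤ C * |s - t| := by
    refine ⟨1 + (‖B‖ / 2 + ‖A - h'‖) / (‖B‖ / 2), ?_⟩
    filter_upwards [hRo (‖B‖ / 2) (half_pos hB')] with s hs
    have h1 : (y s - x) • B = R s - (s - t) • (A - h') := by simp only [hR]; abel
    have h2 : |y s - x| * ‖B‖ ≤ ‖R s‖ + |s - t| * ‖A - h'‖ := by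
      rw [← Real.norm_eq_abs, ← norm_smul, h1, ← Real.norm_eq_abs, ← norm_smul]
      exact norm_sub_le _ _
    have h3 : |y s - x| * (‖B‖ / 2) ≤ (‖B‖ / 2 + ‖A - h'‖) * |s - t| := by
      simp only [hu] at hs
      nlinarith
    have h4 : |y s - x| ≤ (‖B‖ / 2 + ‖A - h'‖) * |s - t| / (‖B‖ / 2) :=
      (le_div_iff₀ (half_pos hB')).2 h3
    simp only [hu]
    calc |s - t| + |y s - x| ≤ |s - t| + (‖B‖ / 2 + ‖A - h'‖) * |s - t| / (‖B‖ / 2) := by gcongr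
      _ = _ := by ring
  have hC0 : 0 < max C 1 := lt_of_lt_of_le one_pos (le_max_right _ _)
  -- Pairing `R` with `n` removes the unknown multiple of B; then |s - t| is divided out.
  have hsmall : ∀ ε > 0, |inner ℝ (A - h') n| ≤ ε * ‖n‖ := by
    intro ε hε
    have h1 : ∀ᶠ s in 𝓝[S \ {t}] t, |inner ℝ (A - h') n| ≤ ε * ‖n‖ := by
      have hle : 𝓝[S \ {t}] t ≤ 𝓝[S] t := nhdsWithin_mono t sdiff_subset
      filter_upwards [hle hC, hle (hRo (ε / max C 1) (div_pos hε hC0)), self_mem_nhdsWithin]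
        with s hs1 hs2 hs3
      have hst : 0 < |s - t| := abs_pos.2 (sub_ne_zero.2 hs3.2)
      have h2 : inner ℝ (R s) n = (s - t) * inner ℝ (A - h') n := by
        simp only [hR, inner_add_left, real_inner_smul_left, hn, mul_zero, add_zero]
      have h3 : |inner ℝ (R s) n| ≤ ‖R s‖ * ‖n‖ := abs_real_inner_le_norm _ _
      have h4 : ‖R s‖ ≤ ε * |s - t| := by
        refine hs2.trans ?_
        have h5 : u s ≤ max C 1 * |s - t| :=
          hs1.trans (mul_le_mul_of_nonneg_right (le_max_left _ _) hst.le)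
        calc ε / max C 1 * u s ≤ ε / max C 1 * (max C 1 * |s - t|) := by gcongr
          _ = ε * |s - t| := by field_simp
      rw [h2, abs_mul] at h3
      have h6 : |s - t| * |inner ℝ (A - h') n| ≤ |s - t| * (ε * ‖n‖) := by
        refine h3.trans ?_
        have := mul_le_mul_of_nonneg_right h4 (norm_nonneg n)
        linarith
      exact le_of_mul_le_mul_left h6 hst
    exact h1.exists.choose_spec
  have h1 : inner ℝ (A - h') n = (0 : ℝ) := by
    rw [← abs_nonpos_iff]
    refine le_of_forall_pos_le_add fun ε hε => ?_
    have h2 := hsmall (ε / (‖n‖ + 1)) (by positivity)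
    refine h2.trans ?_
    rw [zero_add, div_mul_eq_mul_div, div_le_iff₀ (by positivity)]
    nlinarith [norm_nonneg n]
  rw [inner_sub_left] at h1
  linarith

/-! ### The parameter of a curve as a smooth function of its points -/

/-- The height of c in the direction c'(x) has nonzero derivative at x. Its local inverse recovers
the parameter and extends to the ambient space through the height function. -/
lemma exists_smooth_param {V : Type*} [NormedAddCommGroup V] [InnerProductSpace ℝ V] {c : ℝ → V}
    (hc : ContDiff ℝ ∞ c) {x : ℝ} (hx : deriv c x ≠ 0) :
    ∃ ψ : V → ℝ, (∀ᶠ w in 𝓝 (c x), ContDiffAt ℝ ∞ ψ w) ∧ ∀ᶠ y in 𝓝 x, ψ (c y) = y := by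
  set h : ℝ → ℝ := fun y => inner ℝ (c y) (deriv c x) with hh
  have hsm : ContDiff ℝ ∞ h := hc.inner ℝ contDiff_const
  have hd : ∀ y, HasDerivAt h (deriv h y) y := fun y => (hsm.differentiable (by simp) y).hasDerivAt
  have hdx : deriv h x ≠ 0 := by
    have h1 := ((hc.differentiable (by simp) x).hasDerivAt).inner ℝ
      (hasDerivAt_const x (deriv c x))
    rw [h1.deriv, inner_zero_right, zero_add, inner_self_ne_zero]
    exact hx
  set e := hsm.contDiffAt.toOpenPartialHomeomorph h ((hd x).hasFDerivAt_equiv hdx) (by simp) with he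
  have hxs : x ∈ e.source := hsm.contDiffAt.mem_toOpenPartialHomeomorph_source _ _
  have hcoe : ∀ y, e y = h y := fun y => rfl
  have hdc : Continuous (deriv h) := hsm.continuous_deriv (by simp)
  refine ⟨fun w => e.symm (inner ℝ w (deriv c x)), ?_, ?_⟩
  · have h1 : ∀ᶠ a in 𝓝 (h x), ContDiffAt ℝ ∞ e.symm a := by
      have h2 : ∀ᶠ a in 𝓝 (e x), a ∈ e.target := e.open_target.mem_nhds (e.map_source hxs)
      have h3 : ∀ᶠ a in 𝓝 (e x), deriv h (e.symm a) ≠ 0 := by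
        have h4 : Tendsto (fun a => deriv h (e.symm a)) (𝓝 (e x)) (𝓝 (deriv h x)) := by
          have h5 := e.continuousAt_symm (e.map_source hxs)
          rw [ContinuousAt, e.left_inv hxs] at h5
          exact (hdc.tendsto x).comp h5
        exact h4.eventually_ne hdx
      filter_upwards [h2, h3] with a ha1 ha2
      exact e.contDiffAt_symm_deriv ha2 ha1 (hd _) hsm.contDiffAt
    have h2 : Continuous fun w : V => (inner ℝ w (deriv c x) : ℝ) := by fun_prop
    filter_upwards [(h2.tendsto (c x)).eventually h1] with w hw
    exact ContDiffAt.comp w (g := e.symm) (f := fun w : V => (inner ℝ w (deriv c x) : ℝ)) hw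
      (contDiffAt_id.inner ℝ contDiffAt_const)
  · filter_upwards [e.open_source.mem_nhds hxs] with y hy
    exact e.left_inv hy

/-- A surface over a curve, near a point over which the curve passes only once. -/
lemma exists_isHopfSurface {W : Set (EuclideanSpace ℝ (Fin 2))}
    {G : EuclideanSpace ℝ (Fin 2) → ℍ[ℝ]} (hW : IsOpen W) (hG : ContDiffOn ℝ ∞ G W)
    (hnorm : ∀ p ∈ W, ‖G p‖ = 1) (hdet : ∀ p ∈ W, (Surface.metric G p).det ≠ 0) {c : ℝ → ℍ[ℝ]}
    (hc : IsSphereCurve c) (hrange : ∀ p ∈ W, hopf (G p) ∈ range c)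
    {p : EuclideanSpace ℝ (Fin 2)} (hp : p ∈ W) {x : ℝ} (hx : c x = hopf (G p))
    (honce : ∀ N ∈ 𝓝 x, ∀ᶠ w in 𝓝 (c x), w ∈ range c → ∃ y ∈ N, c y = w) :
    ∃ W' φ, p ∈ W' ∧ φ p = x ∧ Surface.IsHopfSurface W' G c φ := by
  obtain ⟨ψ, hψ, hψc⟩ := exists_smooth_param hc.contDiff (hc.deriv_ne_zero x)
  have hcont : Tendsto (fun p => hopf (G p)) (𝓝 p) (𝓝 (c x)) := by
    rw [hx]
    exact (contDiff_hopf.continuous.tendsto _).comp (hG.continuousOn.continuousAt (hW.mem_nhds hp))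
  have h1 := (hcont.eventually hψ).and ((hcont.eventually (honce _ hψc)).and (hW.mem_nhds hp))
  obtain ⟨W', hW', hW'o, hpW'⟩ := eventually_nhds_iff.1 h1
  -- Near `p` the surface lies over parameters near `x` by `honce`, and there ψ inverts the curve.
  refine ⟨W', fun p => ψ (hopf (G p)), hpW', ?_, hW'o, hG.mono fun q hq => (hW' q hq).2.2,
    fun q hq => hnorm q (hW' q hq).2.2, fun q hq => hdet q (hW' q hq).2.2, hc, fun q hq => ?_,
    fun q hq => ?_⟩
  · change ψ (hopf (G p)) = x
    rw [← hx]; exact hψc.self_of_nhds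
  · have h2 : ContDiffAt ℝ ∞ (fun p => hopf (G p)) q :=
      contDiff_hopf.contDiffAt.comp q (hG.contDiffAt (hW.mem_nhds (hW' q hq).2.2))
    exact ((hW' q hq).1.comp q h2).contDiffWithinAt
  · obtain ⟨-, h2, h3⟩ := hW' q hq
    obtain ⟨y, hy, hyq⟩ := h2 (hrange q h3)
    rw [← hyq, show ψ (c y) = y from hy]

end

end HopfWillmore

namespace HopfWillmore

noncomputable section

open Filter Topology Function NNReal TimeODE

/-! ### Families of curves and of Hopf tori -/

section Slice

variable {E' H M E'' H' N : Type*} [NormedAddCommGroup E'] [NormedSpace ℝ E'] [TopologicalSpace H]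
  {I : ModelWithCorners ℝ E' H} [TopologicalSpace M] [ChartedSpace H M] [NormedAddCommGroup E'']
  [NormedSpace ℝ E''] [TopologicalSpace H'] {J : ModelWithCorners ℝ E'' H'} [TopologicalSpace N]
  [ChartedSpace H' N] {T : ℝ}

lemma SmoothFamily.slice {f : ℝ → M → N} (hf : SmoothFamily I J T f) {t : ℝ} (ht : t ∈ Icc 0 T) :
    ContMDiff I J ∞ (f t) := by
  have h1 : ContMDiff I (𝓘(ℝ, ℝ).prod I) ∞ fun m : M => (t, m) :=
    contMDiff_const.prodMk contMDiff_id
  rw [← contMDiffOn_univ]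
  exact hf.comp h1.contMDiffOn fun m _ => ⟨ht, mem_univ _⟩

lemma SmoothFamily.comp {E₃ H₃ L : Type*} [NormedAddCommGroup E₃] [NormedSpace ℝ E₃]
    [TopologicalSpace H₃] {K : ModelWithCorners ℝ E₃ H₃} [TopologicalSpace L] [ChartedSpace H₃ L]
    {f : ℝ → N → L} {g : ℝ → M → N} (hf : SmoothFamily J K T f) (hg : SmoothFamily I J T g) :
    SmoothFamily I K T (fun t x => f t (g t x)) := by
  have h1 : ContMDiffOn (𝓘(ℝ, ℝ).prod I) (𝓘(ℝ, ℝ).prod J) ∞ (fun p : ℝ × M => (p.1, g p.1 p.2))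
      (Icc 0 T ×ˢ univ) := contMDiffOn_fst.prodMk hg
  exact ContMDiffOn.comp hf h1 fun p hp => ⟨hp.1, mem_univ _⟩

/-- The velocity of a family of maps into a vector space. -/
def velocity {V : Type*} [NormedAddCommGroup V] [NormedSpace ℝ V] (T : ℝ) (f : ℝ → M → V) (t : ℝ)
    (m : M) : V := derivWithin (fun s => f s m) (Icc 0 T) t

variable {E V : Type*} [NormedAddCommGroup E] [NormedSpace ℝ E] [NormedAddCommGroup V]
  [NormedSpace ℝ V] {P : E → M} (hP : IsLatticeCover I P) {f : ℝ → M → V}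
  (hf : SmoothFamily I 𝓘(ℝ, V) T f)
include hP hf

lemma hasDerivWithinAt_velocity {t : ℝ} (ht : t ∈ Icc 0 T) (m : M) :
    HasDerivWithinAt (fun s => f s m) (velocity T f t m) (Icc 0 T) t := by
  obtain ⟨x, rfl⟩ := hP.surjective m
  exact hasDerivWithinAt_timeDeriv (hP.contDiffOn_lift hf) ht x

lemma contMDiff_velocity (hT : 0 < T) {t : ℝ} (ht : t ∈ Icc 0 T) :
    ContMDiff I 𝓘(ℝ, V) ∞ (velocity T f t) := by
  intro m
  obtain ⟨x, rfl⟩ := hP.surjective m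
  obtain ⟨s, hs, -, hPs, -⟩ := hP.exists_section x
  have h1 := contDiff_slice (contDiffOn_timeDeriv hT (hP.contDiffOn_lift hf)) ht
  refine ((h1.contMDiff _).comp (P x) hs).congr_of_eventuallyEq ?_
  filter_upwards [hPs] with m hm
  rw [← hm, comp_apply, hm]
  change velocity T f t m = velocity T f t (P (s m))
  rw [hm]

end Slice

section CurveFamily

variable {T : ℝ} {γ : ℝ → Circle → ℍ[ℝ]} (hγ : SmoothFamily (𝓡 1) 𝓘(ℝ, ℍ[ℝ]) T γ)
  {t : ℝ} (ht : t ∈ Icc 0 T)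

include hγ in
lemma contDiffOn_lift_family :
    ContDiffOn ℝ ∞ (uncurry fun t x => lift (γ t) x) (Icc 0 T ×ˢ univ) :=
  isLatticeCover_circle.contDiffOn_lift hγ

include hγ ht in
lemma isSphereCurve_lift (hreg : IsRegularCurve (γ t)) : IsSphereCurve (lift (γ t)) where
  contDiff := contDiff_slice (contDiffOn_lift_family hγ) ht
  norm_eq_one _ := (hreg.1 _).1
  imI_eq_zero _ := (hreg.1 _).2
  deriv_ne_zero := hreg.2

include hγ ht in
/-- Near a point through which a curve of the family passes only once, the parameters of nearby
curves are close to the original parameter. -/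
lemma eventually_param_mem {x : ℝ} (hx : ∃! z, γ t z = lift (γ t) x) {N : Set ℝ} (hN : N ∈ 𝓝 x) :
    ∀ᶠ q : ℝ × ℍ[ℝ] in 𝓝 (t, lift (γ t) x), q.1 ∈ Icc 0 T → ∀ z, γ q.1 z = q.2 →
      ∃ y ∈ N, Circle.exp y = z := by
  obtain ⟨s, hs, hsx, hPs, -⟩ := isLatticeCover_circle.exists_section x
  have hU : ∀ᶠ z in 𝓝 (Circle.exp x), ∃ y ∈ N, Circle.exp y = z := by
    have h1 : Tendsto s (𝓝 (Circle.exp x)) (𝓝 x) := by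
      have h2 := hs.continuousAt.tendsto
      rwa [hsx] at h2
    filter_upwards [h1 hN, hPs] with z hz1 hz2
    exact ⟨s z, hz1, hz2⟩
  obtain ⟨U, hUN, hUo, hxU⟩ := eventually_nhds_iff.1 hU
  -- By simplicity γ t misses the point on the complement of U. Compactness of this complement makes
  -- the separation persist for nearby times and points.
  have hK : ∀ᶠ q : ℝ × ℍ[ℝ] in 𝓝 (t, lift (γ t) x), ∀ z ∈ Uᶜ, q.1 ∈ Icc 0 T → γ q.1 z ≠ q.2 := by
    refine (hUo.isClosed_compl.isCompact).eventually_forall_of_forall_eventually fun z hz => ?_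
    have hne : γ t z ≠ lift (γ t) x := fun h => hz (by
      rw [hx.unique h (rfl : γ t (Circle.exp x) = _)]
      exact hxU)
    have hcont : ContinuousWithinAt (fun q : (ℝ × ℍ[ℝ]) × Circle => γ q.1.1 q.2 - q.1.2)
        {q | q.1.1 ∈ Icc 0 T} ((t, lift (γ t) x), z) := by
      have h1 : ContinuousWithinAt (fun q : ℝ × Circle => γ q.1 q.2) (Icc 0 T ×ˢ univ) (t, z) :=
        hγ.continuousOn _ ⟨ht, mem_univ _⟩
      have h2 : ContinuousWithinAt (fun q : (ℝ × ℍ[ℝ]) × Circle => (q.1.1, q.2))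
          {q | q.1.1 ∈ Icc 0 T} ((t, lift (γ t) x), z) := by fun_prop
      have h3 : ContinuousWithinAt (fun q : (ℝ × ℍ[ℝ]) × Circle => γ q.1.1 q.2)
          {q | q.1.1 ∈ Icc 0 T} ((t, lift (γ t) x), z) :=
        ContinuousWithinAt.comp (x := ((t, lift (γ t) x), z)) (g := fun q : ℝ × Circle => γ q.1 q.2)
          (f := fun q : (ℝ × ℍ[ℝ]) × Circle => (q.1.1, q.2)) h1 h2 fun q hq => ⟨hq, mem_univ _⟩
      exact h3.sub (by fun_prop)
    have h3 := hcont.eventually_ne (sub_ne_zero.2 hne)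
    rw [eventually_nhdsWithin_iff] at h3
    filter_upwards [h3] with q hq hqt
    exact sub_ne_zero.1 (hq hqt)
  filter_upwards [hK] with q hq hqt z hz
  exact hUN z (by_contra fun h => hq z h hqt hz)

/-- The image is connected and contained in the exceptional set, which has zero length. -/
lemma subsingleton_image_of_coversOnce {c : Circle → ℍ[ℝ]} (hc : CoversOnce 1 c) {X : Type*}
    [TopologicalSpace X] {f : X → ℍ[ℝ]} {U : Set X} (hU : IsPreconnected U) (hf : ContinuousOn f U)
    (hfU : ∀ u ∈ U, f u ∈ range c ∧ ¬ ∃! z, c z = f u) : (f '' U).Subsingleton := by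
  let : MeasurableSpace ℍ[ℝ] := borel ℍ[ℝ]
  have : BorelSpace ℍ[ℝ] := ⟨rfl⟩
  refine (hU.image f hf).subsingleton_of_hausdorffMeasure_eq_zero
    (MeasureTheory.measure_mono_null ?_ hc)
  rintro _ ⟨u, hu, rfl⟩
  exact hfU u hu

include hγ ht in
/-- A regular curve which covers its trace once has a dense set of simple parameters. -/
lemma dense_simple_param (hreg : IsRegularCurve (γ t)) (honce : CoversOnce 1 (γ t)) :
    Dense {x : ℝ | ∃! z, γ t z = lift (γ t) x} := by
  have hc := isSphereCurve_lift hγ ht hreg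
  intro x
  rw [Metric.mem_closure_iff]
  by_contra! h
  obtain ⟨ε, hε, h⟩ := h
  -- If no parameter near `x` were simple, the curve would be constant there, contrary to
  -- regularity.
  have h1 := subsingleton_image_of_coversOnce honce (f := lift (γ t))
    (convex_ball x ε).isPreconnected hc.contDiff.continuous.continuousOn fun y hy =>
      ⟨⟨Circle.exp y, rfl⟩, fun hy' => (h y hy').not_gt (by rwa [dist_comm, ← Metric.mem_ball])⟩
  have h2 : lift (γ t) =ᶠ[𝓝 x] fun _ => lift (γ t) x := by
    filter_upwards [Metric.ball_mem_nhds x hε] with y hy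
    exact h1 ⟨y, hy, rfl⟩ ⟨x, Metric.mem_ball_self hε, rfl⟩
  exact hreg.2 x (by rw [h2.deriv_eq, deriv_const])

end CurveFamily

/-- An immersion has a dense set of points over simple points of the curve. -/
lemma mem_closure_simple {W : Set (EuclideanSpace ℝ (Fin 2))}
    {G : EuclideanSpace ℝ (Fin 2) → ℍ[ℝ]} (hW : IsOpen W) (hG : ContDiffOn ℝ ∞ G W)
    (hnorm : ∀ p ∈ W, ‖G p‖ = 1) (hinj : ∀ p ∈ W, Injective (fderiv ℝ G p)) {c : Circle → ℍ[ℝ]}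
    (honce : CoversOnce 1 c) (hrange : ∀ p ∈ W, hopf (G p) ∈ range c)
    {p : EuclideanSpace ℝ (Fin 2)} (hp : p ∈ W) :
    p ∈ closure {p | p ∈ W ∧ ∃! z, c z = hopf (G p)} := by
  rw [Metric.mem_closure_iff]
  by_contra! h
  obtain ⟨ε, hε, h⟩ := h
  obtain ⟨δ, hδ, hδW⟩ := Metric.isOpen_iff.1 hW p hp
  have hB : Metric.ball p (min ε δ) ⊆ W :=
    (Metric.ball_subset_ball (min_le_right _ _)).trans hδW
  have h1 := subsingleton_image_of_coversOnce honce (f := fun p => hopf (G p))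
    (convex_ball p (min ε δ)).isPreconnected
    (contDiff_hopf.continuous.comp_continuousOn (hG.continuousOn.mono hB)) fun y hy =>
      ⟨hrange y (hB hy), fun hy' => (h y ⟨hB hy, hy'⟩).not_gt (by
        rw [dist_comm, ← Metric.mem_ball]
        exact Metric.ball_subset_ball (min_le_left _ _) hy)⟩
  have h2 : (fun p => hopf (G p)) =ᶠ[𝓝 p] fun _ => hopf (G p) := by
    filter_upwards [Metric.ball_mem_nhds p (lt_min hε hδ)] with y hy
    exact h1 ⟨y, hy, rfl⟩ ⟨p, Metric.mem_ball_self (lt_min hε hδ), rfl⟩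
  -- A locally constant Hopf projection confines the range of the differential to the
  -- one-dimensional fibre direction, which injectivity on the plane excludes.
  have h3 := (hasFDerivAt_hopf (G p)).comp p (differentiableAt_of_contDiffOn hW hG hp).hasFDerivAt
  have h4 := h3.unique ((hasFDerivAt_const (hopf (G p)) p).congr_of_eventuallyEq h2)
  have h5 : ∀ v, ∃ r : ℝ, fderiv ℝ G p v = r • (twist (G p) * unitI) := fun v =>
    eq_smul_of_hopfDeriv_eq_zero (hnorm p hp) (DFunLike.congr_fun h4 v)
  obtain ⟨r, hr⟩ := h5 (EuclideanSpace.single 0 1)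
  obtain ⟨r', hr'⟩ := h5 (EuclideanSpace.single 1 1)
  have h6 : r' • EuclideanSpace.single (0 : Fin 2) (1 : ℝ)
      - r • EuclideanSpace.single (1 : Fin 2) (1 : ℝ) = 0 :=
    hinj p hp (by rw [map_sub, map_smul, map_smul, hr, hr', map_zero, smul_smul, smul_smul,
      mul_comm, sub_self])
  have h7 : r = 0 := by simpa using congrArg (fun v : EuclideanSpace ℝ (Fin 2) => v 1) h6
  rw [h7, zero_smul] at hr
  have h8 : EuclideanSpace.single (0 : Fin 2) (1 : ℝ) = 0 := hinj p hp (by rw [hr, map_zero])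
  simpa using congrArg (fun v : EuclideanSpace ℝ (Fin 2) => v 0) h8

end

end HopfWillmore

namespace HopfWillmore

noncomputable section

open Filter Topology Function NNReal TimeODE

/-! ### Normal velocities of a family of Hopf tori and of its profile curves -/

/-- A smooth family of immersions onto the Hopf tori of a family of regular curves which cover
their traces once. -/
structure IsHopfFamily {M : Type*} [TopologicalSpace M]
    [ChartedSpace (EuclideanSpace ℝ (Fin 2)) M] (T : ℝ) (γ : ℝ → Circle → ℍ[ℝ])
    (F : ℝ → M → ℍ[ℝ]) : Prop where
  smooth_curve : SmoothFamily (𝓡 1) 𝓘(ℝ, ℍ[ℝ]) T γ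
  regular : ∀ t ∈ Icc 0 T, IsRegularCurve (γ t)
  once : ∀ t ∈ Icc 0 T, CoversOnce 1 (γ t)
  smooth : SmoothFamily (𝓡 2) 𝓘(ℝ, ℍ[ℝ]) T F
  isImm : ∀ t ∈ Icc 0 T, IsImm (F t)
  range_eq : ∀ t ∈ Icc 0 T, range (F t) = hopfTorus (γ t)

/-- The normal component of the deviation from the elastic flow. -/
def curveDefect (T : ℝ) (γ : ℝ → Circle → ℍ[ℝ]) (t x : ℝ) : ℝ :=
  inner ℝ (timeDeriv T (fun s => lift (γ s)) t x + (4 : ℝ) • Curve.elasticGrad (lift (γ t)) x)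
    (Curve.unitNormal (lift (γ t)) x)

/-- The normal component of the deviation from the Willmore flow. -/
def surfaceDefect {M : Type*} [TopologicalSpace M]
    [ChartedSpace (EuclideanSpace ℝ (Fin 2)) M] (T : ℝ) (F : ℝ → M → ℍ[ℝ]) (t : ℝ) (q : M)
    (p : EuclideanSpace ℝ (Fin 2)) : ℍ[ℝ] :=
  Surface.perp (F t ∘ (extChartAt (𝓡 2) q).symm) p
    (velocity T F t ((extChartAt (𝓡 2) q).symm p)
      + Surface.willmoreGrad (F t ∘ (extChartAt (𝓡 2) q).symm) p)

namespace IsHopfFamily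

variable {M : Type*} [TopologicalSpace M] [ChartedSpace (EuclideanSpace ℝ (Fin 2)) M]
  {T : ℝ} {γ : ℝ → Circle → ℍ[ℝ]} {F : ℝ → M → ℍ[ℝ]}
  (h : IsHopfFamily T γ F) {t : ℝ} (ht : t ∈ Icc 0 T) (q : M)
include h ht

lemma mem_hopfTorus (m : M) : F t m ∈ hopfTorus (γ t) := by
  rw [← h.range_eq t ht]; exact mem_range_self m

lemma norm_eq_one (m : M) : ‖F t m‖ = 1 := (h.mem_hopfTorus ht m).1

lemma isSphereCurve : IsSphereCurve (lift (γ t)) :=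
  isSphereCurve_lift h.smooth_curve ht (h.regular t ht)

lemma contMDiff : ContMDiff (𝓡 2) 𝓘(ℝ, ℍ[ℝ]) ∞ (F t) := h.smooth.slice ht

lemma continuous_curveDefect (hT : 0 < T) : Continuous (curveDefect T γ t) := by
  have hc := h.isSphereCurve ht
  have h1 := contDiff_slice
    (contDiffOn_timeDeriv hT (contDiffOn_lift_family h.smooth_curve)) ht
  exact (h1.continuous.add (hc.contDiff_elasticGrad.continuous.const_smul (4 : ℝ))).inner
    hc.contDiff_unitNormal.continuous

variable [IsManifold (𝓡 2) ∞ M]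

lemma contDiffOn_chart : ContDiffOn ℝ ∞ (F t ∘ (extChartAt (𝓡 2) q).symm)
    (extChartAt (𝓡 2) q).target :=
  HopfWillmore.contDiffOn_chart (h.contMDiff ht) q

lemma injective_fderiv {p : EuclideanSpace ℝ (Fin 2)} (hp : p ∈ (extChartAt (𝓡 2) q).target) :
    Injective (fderiv ℝ (F t ∘ (extChartAt (𝓡 2) q).symm) p) :=
  injective_fderiv_chart (h.contMDiff ht) q hp (h.isImm t ht _)

lemma det_ne_zero {p : EuclideanSpace ℝ (Fin 2)} (hp : p ∈ (extChartAt (𝓡 2) q).target) :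
    (Surface.metric (F t ∘ (extChartAt (𝓡 2) q).symm) p).det ≠ 0 :=
  Surface.det_metric_ne_zero (h.injective_fderiv ht q hp)

lemma continuousOn_surfaceDefect {P : EuclideanSpace ℝ (Fin 2) → M}
    (hP : IsLatticeCover (𝓡 2) P) (hT : 0 < T) :
    ContinuousOn (surfaceDefect T F t q) (extChartAt (𝓡 2) q).target :=
  (Surface.contDiffOn_perp (isOpen_extChartAt_target q) (h.contDiffOn_chart ht q)
    (fun _ => h.det_ne_zero ht q)
    ((HopfWillmore.contDiffOn_chart (contMDiff_velocity hP h.smooth hT ht) q).add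
      (Surface.contDiffOn_willmoreGrad (isOpen_extChartAt_target q) (h.contDiffOn_chart ht q)
        fun _ => h.det_ne_zero ht q))).continuousOn

/-- The two deviations agree over simple points of the curve. -/
lemma surfaceDefect_eq {P : EuclideanSpace ℝ (Fin 2) → M} (hP : IsLatticeCover (𝓡 2) P)
    (hT : 0 < T) {p : EuclideanSpace ℝ (Fin 2)} (hp : p ∈ (extChartAt (𝓡 2) q).target) {x : ℝ}
    (hx : lift (γ t) x = hopf (F t ((extChartAt (𝓡 2) q).symm p)))
    (hsimple : ∃! z, γ t z = lift (γ t) x) :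
    ∃ ν : ℍ[ℝ], ν ≠ 0 ∧ surfaceDefect T F t q p = curveDefect T γ t x • ν := by
  set m := (extChartAt (𝓡 2) q).symm p with hm
  have hc := h.isSphereCurve ht
  have hparam := fun N hN => eventually_param_mem h.smooth_curve ht hsimple (N := N) hN
  have hlift : ∀ s, range (γ s) = range (lift (γ s)) := fun s =>
    (Circle.exp_surjective.range_comp (γ s)).symm
  obtain ⟨W, φ, hpW, hφ, hS⟩ := exists_isHopfSurface (isOpen_extChartAt_target q)
    (h.contDiffOn_chart ht q) (fun p _ => h.norm_eq_one ht _) (fun _ => h.det_ne_zero ht q) hc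
    (fun p _ => by rw [← hlift t]; exact (h.mem_hopfTorus ht _).2) hp hx (fun N hN => by
      have h1 : Tendsto (fun w => (t, w)) (𝓝 (lift (γ t) x)) (𝓝 (t, lift (γ t) x)) :=
        (Continuous.prodMk_right t).tendsto (lift (γ t) x)
      filter_upwards [h1.eventually (hparam N hN)] with w hw
      rintro ⟨y, rfl⟩
      obtain ⟨y', hy', hyy'⟩ := hw ht (Circle.exp y) rfl
      exact ⟨y', hy', by rw [lift, lift, hyy']⟩)
  have hn : (Curve.unitNormal (lift (γ t)) x).imI = 0 := (hc.isFrame x).binormal_imI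
  have hL : ‖twist (F t m)‖ = 1 := by rw [norm_twist, h.norm_eq_one ht]
  have hvel : inner ℝ (hopfDeriv (F t m) (velocity T F t m)) (Curve.unitNormal (lift (γ t)) x)
      = (inner ℝ (timeDeriv T (fun s => lift (γ s)) t x) (Curve.unitNormal (lift (γ t)) x) : ℝ) := by
    -- At each time some parameter of the curve lies under the point `m`. The choice need not be
    -- continuous in `s`, and 1 is a default value outside `[0, T]`.
    have hz : ∀ s, ∃ z, s ∈ Icc 0 T → γ s z = hopf (F s m) := by
      intro s
      by_cases hs : s ∈ Icc 0 T
      · obtain ⟨z, hz⟩ := (h.mem_hopfTorus hs m).2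
        exact ⟨z, fun _ => hz⟩
      · exact ⟨1, fun h => absurd h hs⟩
    choose z hz using hz
    obtain ⟨sec, -, -, -, hsec⟩ := isLatticeCover_circle.exists_section x
    have hF := hasDerivWithinAt_velocity hP h.smooth ht m
    have hh : HasDerivWithinAt (fun s => hopf (F s m)) (hopfDeriv (F t m) (velocity T F t m))
        (Icc 0 T) t := (hasFDerivAt_hopf _).comp_hasDerivWithinAt t hF
    have hlim : Tendsto (fun s => (s, hopf (F s m))) (𝓝[Icc 0 T] t) (𝓝 (t, lift (γ t) x)) := by
      have h1 := (hh.continuousWithinAt).tendsto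
      rw [← hx] at h1
      exact (tendsto_id'.2 nhdsWithin_le_nhds).prodMk_nhds h1
    -- Simplicity at time `t` forces the chosen parameters to approach `x`.
    have hev : ∀ N ∈ 𝓝 x, ∀ᶠ s in 𝓝[Icc 0 T] t, ∃ y ∈ N, Circle.exp y = z s := fun N hN => by
      filter_upwards [hlim.eventually (hparam N hN), self_mem_nhdsWithin] with s hs1 hs2
      exact hs1 hs2 (z s) (hz s hs2)
    have hg := hasFDerivWithinAt_total (contDiffOn_lift_family h.smooth_curve) ht x
    have hfd : (fderiv ℝ (lift (γ t)) x).comp (ContinuousLinearMap.snd ℝ ℝ ℝ)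
        = (ContinuousLinearMap.snd ℝ ℝ ℝ).smulRight (deriv (lift (γ t)) x) := by
      ext <;> simp
    rw [hfd] at hg
    have : (𝓝[Icc 0 T \ {t}] t).NeBot := accPt_principal_iff_nhdsWithin.1
      (uniqueDiffWithinAt_iff_accPt.1 (uniqueDiffOn_Icc hT t ht))
    refine inner_velocity_eq hg (hc.deriv_ne_zero x) hh (y := fun s => sec (z s)) ?_ ?_ hx ?_
    · intro N hN
      change ∀ᶠ s in 𝓝[Icc 0 T] t, sec (z s) ∈ N
      filter_upwards [hev _ (inter_mem hN hsec)] with s ⟨y, ⟨hyN, hys⟩, hyz⟩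
      rw [← hyz, show sec (Circle.exp y) = y from hys]
      exact hyN
    · filter_upwards [hev _ hsec, self_mem_nhdsWithin] with s ⟨y, hys, hyz⟩ hs
      rw [← hyz, show sec (Circle.exp y) = y from hys, ← hz s hs, ← hyz]
      rfl
    · rw [hc.deriv_eq, real_inner_smul_left, Curve.unitNormal,
        (hc.isFrame x).inner_binormal_right, mul_zero]
  rw [inner_hopfDeriv _ _ hn] at hvel
  have hν : Surface.normal (F t ∘ (extChartAt (𝓡 2) q).symm) (lift (γ t)) φ p
      = twist (F t m) * Curve.unitNormal (lift (γ t)) x := by rw [Surface.normal, hφ]; rfl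
  -- The surface velocity has half the normal component of the curve velocity, and twice the elastic
  -- gradient is half of four times it; this is the factor ½.
  refine ⟨(1 / 2 : ℝ) • (twist (F t m) * Curve.unitNormal (lift (γ t)) x), ?_, ?_⟩
  · rw [← norm_ne_zero_iff, norm_smul, norm_mul, hL, Curve.unitNormal, (hc.isFrame x).norm_binormal]
    norm_num
  · rw [surfaceDefect, hS.perp_eq hpW, hS.willmoreGrad_eq hpW, hν, hφ, smul_smul, inner_add_left]
    congr 1
    rw [comp_apply, ← hm, inner_mul_left_of_norm hL, curveDefect, inner_add_left, ← hvel,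
      real_inner_smul_left, real_inner_smul_left]
    ring

/-- A family of Hopf tori evolves in normal direction by the Willmore flow if and only if the family
of its profile curves evolves in normal direction by the elastic flow. -/
theorem surfaceDefect_eq_zero_iff {P : EuclideanSpace ℝ (Fin 2) → M}
    (hP : IsLatticeCover (𝓡 2) P) (hT : 0 < T) :
    (∀ q, surfaceDefect T F t q (extChartAt (𝓡 2) q q) = 0) ↔ ∀ x, curveDefect T γ t x = 0 := by
  constructor
  · intro hA
    have hd := dense_simple_param h.smooth_curve ht (h.regular t ht) (h.once t ht)
    have h0 : curveDefect T γ t = fun _ => 0 := by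
      refine (h.continuous_curveDefect ht hT).ext_on hd continuous_const fun x hx => ?_
      -- Surjectivity of the Hopf map, with F t onto the Hopf torus, places a point of the surface
      -- over every point of the curve.
      obtain ⟨w, hw, hwx⟩ := exists_hopf_eq ((h.regular t ht).1 (Circle.exp x))
      have hmem : w ∈ range (F t) := by
        rw [h.range_eq t ht]
        exact ⟨hw, by rw [hwx]; exact mem_range_self _⟩
      obtain ⟨q, rfl⟩ := hmem
      have hq : (extChartAt (𝓡 2) q).symm (extChartAt (𝓡 2) q q) = q := extChartAt_to_inv q
      obtain ⟨ν, hν, hνq⟩ := h.surfaceDefect_eq ht q hP hT (mem_extChartAt_target q) (x := x)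
        (by rw [hq, hwx]; rfl) hx
      rw [hA q] at hνq
      exact (smul_eq_zero.1 hνq.symm).resolve_right hν
    exact fun x => congrFun h0 x
  · intro hB q
    have hcl := mem_closure_simple (isOpen_extChartAt_target q) (h.contDiffOn_chart ht q)
      (fun p _ => h.norm_eq_one ht _) (fun _ => h.injective_fderiv ht q) (h.once t ht)
      (fun p _ => (h.mem_hopfTorus ht _).2) (mem_extChartAt_target q)
    have hcont := (h.continuousOn_surfaceDefect ht q hP hT) _ (mem_extChartAt_target q)
    -- The defect is continuous and vanishes over simple points, which accumulate at `q`.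
    have h1 : surfaceDefect T F t q (extChartAt (𝓡 2) q q) ∈ closure ({0} : Set ℍ[ℝ]) := by
      refine (hcont.mono (sep_subset _ _)).mem_closure hcl ?_
      rintro p ⟨hp, hsimple⟩
      obtain ⟨z, hz⟩ := (h.mem_hopfTorus ht ((extChartAt (𝓡 2) q).symm p)).2
      obtain ⟨x, rfl⟩ := Circle.exp_surjective z
      obtain ⟨ν, -, hν⟩ := h.surfaceDefect_eq ht q hP hT hp (x := x) hz (by
        rw [lift, hz]; exact hsimple)
      rw [mem_singleton_iff, hν, hB, zero_smul]
    simpa using h1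

end IsHopfFamily

end

end HopfWillmore

namespace HopfWillmore

noncomputable section

open Filter Topology Function NNReal TimeODE

/-! ### Invariance under reparametrization -/

lemma CoversOnce.comp_bijective {d : ℝ} {X Y : Type*} {f : Y → ℍ[ℝ]} (hf : CoversOnce d f)
    {σ : X → Y} (hσ : Bijective σ) : CoversOnce d (fun x => f (σ x)) := by
  have h1 : range (fun x => f (σ x)) = range f := hσ.surjective.range_comp f
  have h2 : ∀ z, (∃! x, f (σ x) = z) ↔ ∃! y, f y = z := fun z =>
    (hσ.existsUnique_iff (p := fun y => f y = z)).symm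
  unfold CoversOnce
  simp only [h1, h2]
  exact hf

lemma hopfTorus_comp {γ : Circle → ℍ[ℝ]} {σ : Circle → Circle} (hσ : Surjective σ) :
    hopfTorus (fun z => γ (σ z)) = hopfTorus γ := by
  have h1 : range (fun x => γ (σ x)) = range γ := hσ.range_comp γ
  simp only [hopfTorus, h1]

lemma injective_fderiv_iff_deriv_ne_zero {V : Type*} [NormedAddCommGroup V] [NormedSpace ℝ V]
    {f : ℝ → V} {x : ℝ} : Injective (fderiv ℝ f x) ↔ deriv f x ≠ 0 := by
  constructor
  · intro h h0
    have h1 : (1 : ℝ) = 0 := h (by rw [fderiv_eq_smul_deriv, h0, smul_zero, map_zero])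
    exact one_ne_zero h1
  · intro h v w hvw
    rw [fderiv_eq_smul_deriv, fderiv_eq_smul_deriv] at hvw
    exact smul_left_injective ℝ h hvw

lemma injective_mfderiv_comp_diffeomorph {E' H M V : Type*} [NormedAddCommGroup E']
    [NormedSpace ℝ E'] [TopologicalSpace H] {I : ModelWithCorners ℝ E' H} [TopologicalSpace M]
    [ChartedSpace H M] [NormedAddCommGroup V] [NormedSpace ℝ V] {f : M → V}
    (hf : ContMDiff I 𝓘(ℝ, V) ∞ f) (hinj : ∀ m, Injective (mfderiv I 𝓘(ℝ, V) f m))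
    (σ : Diffeomorph I I M M ∞) (m : M) :
    Injective (mfderiv I 𝓘(ℝ, V) (fun m => f (σ m)) m) := by
  have h1 : mfderiv I 𝓘(ℝ, V) (fun m => f (σ m)) m = _ :=
    mfderiv_comp m ((hf _).mdifferentiableAt (by simp))
      ((σ.contMDiff m).mdifferentiableAt (by simp))
  rw [h1]
  exact (hinj _).comp (σ.mfderivToContinuousLinearEquiv (by simp) m).injective

lemma IsRegularCurve.comp_diffeomorph {γ : Circle → ℍ[ℝ]} (hγ : IsRegularCurve γ)
    (hsm : ContMDiff (𝓡 1) 𝓘(ℝ, ℍ[ℝ]) ∞ γ) (σ : Diffeomorph (𝓡 1) (𝓡 1) Circle Circle ∞) :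
    IsRegularCurve (fun z => γ (σ z)) := by
  refine ⟨fun z => hγ.1 _, fun x => injective_fderiv_iff_deriv_ne_zero.1 ?_⟩
  refine isLatticeCover_circle.injective_fderiv_lift
    (((hsm.comp σ.contMDiff) _).mdifferentiableAt (by simp))
    (injective_mfderiv_comp_diffeomorph hsm (fun z => ?_) σ _)
  obtain ⟨y, rfl⟩ := Circle.exp_surjective z
  exact isLatticeCover_circle.injective_mfderiv ((hsm _).mdifferentiableAt (by simp))
    (injective_fderiv_iff_deriv_ne_zero.2 (hγ.2 y))

section Family

variable {M : Type*} [TopologicalSpace M] [ChartedSpace (EuclideanSpace ℝ (Fin 2)) M]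
  {T : ℝ} {γ : ℝ → Circle → ℍ[ℝ]} {F : ℝ → M → ℍ[ℝ]}

/-- Allows the two sides to be reparametrized independently before their defects are compared. -/
lemma IsHopfFamily.comp (h : IsHopfFamily T γ F)
    {σ : ℝ → Diffeomorph (𝓡 1) (𝓡 1) Circle Circle ∞}
    (hσ : SmoothFamily (𝓡 1) (𝓡 1) T (fun t => σ t)) {Φ : ℝ → Diffeomorph (𝓡 2) (𝓡 2) M M ∞}
    (hΦ : SmoothFamily (𝓡 2) (𝓡 2) T (fun t => Φ t)) :
    IsHopfFamily T (fun t z => γ t (σ t z)) (fun t m => F t (Φ t m)) where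
  smooth_curve := h.smooth_curve.comp hσ
  regular t ht := (h.regular t ht).comp_diffeomorph (h.smooth_curve.slice ht) (σ t)
  once t ht := (h.once t ht).comp_bijective (σ t).bijective
  smooth := h.smooth.comp hΦ
  isImm t ht := injective_mfderiv_comp_diffeomorph (h.contMDiff ht) (h.isImm t ht) (Φ t)
  range_eq t ht := ((Φ t).surjective.range_comp (F t)).trans
    ((h.range_eq t ht).trans (hopfTorus_comp (γ := γ t) (σ t).surjective).symm)

/-! ### Normal velocities determine the flows -/

lemma inner_deriv_eq_zero_of_norm_within {S : Set ℝ} {u : ℝ → ℍ[ℝ]} {u' : ℍ[ℝ]} {t : ℝ}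
    (hS : UniqueDiffWithinAt ℝ S t) (ht : t ∈ S) (hu : ∀ s ∈ S, ‖u s‖ = 1)
    (h : HasDerivWithinAt u u' S t) : inner ℝ u' (u t) = (0 : ℝ) := by
  have h1 := h.inner ℝ h
  have h2 : HasDerivWithinAt (fun s => inner ℝ (u s) (u s) : ℝ → ℝ) 0 S t :=
    (hasDerivWithinAt_const t S (1 : ℝ)).congr
      (fun s hs => by rw [real_inner_self_eq_norm_sq, hu s hs, one_pow])
      (by rw [real_inner_self_eq_norm_sq, hu t ht, one_pow])
  have h3 := hS.eq_deriv S h1 h2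
  rw [real_inner_comm] at h3
  linarith

lemma imI_deriv_eq_zero_within {S : Set ℝ} {u : ℝ → ℍ[ℝ]} {u' : ℍ[ℝ]} {t : ℝ}
    (hS : UniqueDiffWithinAt ℝ S t) (ht : t ∈ S) (hu : ∀ s ∈ S, (u s).imI = 0)
    (h : HasDerivWithinAt u u' S t) : u'.imI = 0 := by
  have h1 := h.inner ℝ (hasDerivWithinAt_const t S unitI)
  have h2 : HasDerivWithinAt (fun s => inner ℝ (u s) unitI : ℝ → ℝ) 0 S t :=
    (hasDerivWithinAt_const t S (0 : ℝ)).congr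
      (fun s hs => by rw [inner_eq]; simp [hu s hs]) (by rw [inner_eq]; simp [hu t ht])
  have h3 := hS.eq_deriv S h1 h2
  rw [inner_eq] at h3
  simpa [inner_eq] using h3

/-- A vector tangent to the two-sphere and orthogonal to the curve is a multiple of the unit normal,
the only direction that `curveDefect` tests. -/
lemma IsHopfFamily.eq_neg_elasticGrad (h : IsHopfFamily T γ F) (hT : 0 < T) {t : ℝ}
    (ht : t ∈ Icc 0 T) {x : ℝ} {d : ℍ[ℝ]}
    (hd : HasDerivWithinAt (fun s => lift (γ s) x) d (Icc 0 T) t)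
    (hperp : inner ℝ d (deriv (lift (γ t)) x) = (0 : ℝ)) (hdef : curveDefect T γ t x = 0) :
    d = -((4 : ℝ) • Curve.elasticGrad (lift (γ t)) x) := by
  have hc := h.isSphereCurve ht
  have hF := hc.isFrame x
  have hu := uniqueDiffOn_Icc hT t ht
  have htd : timeDeriv T (fun s => lift (γ s)) t x = d := hd.derivWithin hu
  have hn : inner ℝ (Curve.unitNormal (lift (γ t)) x) (lift (γ t) x) = (0 : ℝ) := by
    rw [real_inner_comm]; exact hF.inner_binormal
  have hn' : inner ℝ (Curve.unitNormal (lift (γ t)) x) (Curve.tangent (lift (γ t)) x)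
      = (0 : ℝ) := by
    rw [real_inner_comm]; exact hF.inner_binormal_right
  have h1 : inner ℝ d (lift (γ t) x) = (0 : ℝ) :=
    inner_deriv_eq_zero_of_norm_within (u := fun s => lift (γ s) x) hu ht
      (fun s hs => ((h.regular s hs).1 _).1) hd
  have h2 : d.imI = 0 :=
    imI_deriv_eq_zero_within (u := fun s => lift (γ s) x) hu ht (fun s hs => ((h.regular s hs).1 _).2) hd
  have h3 : inner ℝ d (Curve.tangent (lift (γ t)) x) = (0 : ℝ) := by
    rw [hc.deriv_eq, real_inner_smul_right] at hperp
    exact (mul_eq_zero.1 hperp).resolve_left (hc.speed_pos x).ne'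
  rw [curveDefect, htd] at hdef
  rw [← sub_eq_zero, sub_neg_eq_add,
    hc.expand x (w := d + (4 : ℝ) • Curve.elasticGrad (lift (γ t)) x), hdef]
  · simp only [hc.elasticGrad_eq, inner_add_left, real_inner_smul_left, h1, h3, hn, hn', mul_zero,
      add_zero, zero_smul]
  · rw [hc.elasticGrad_eq]
    simp [h2, Curve.unitNormal, hF.binormal_imI]

variable [IsManifold (𝓡 2) ∞ M]

/-- Both `d` and the Willmore gradient lie in the normal space, so the projection in `surfaceDefect`
does nothing to their sum. -/
lemma IsHopfFamily.eq_neg_willmoreGradient (h : IsHopfFamily T γ F) (hT : 0 < T) {t : ℝ}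
    (ht : t ∈ Icc 0 T) {q : M} {d : ℍ[ℝ]} (hd : HasDerivWithinAt (fun s => F s q) d (Icc 0 T) t)
    (hperp : ∀ v, inner ℝ d (mfderiv (𝓡 2) 𝓘(ℝ, ℍ[ℝ]) (F t) q v : ℍ[ℝ]) = (0 : ℝ))
    (hdef : surfaceDefect T F t q (extChartAt (𝓡 2) q q) = 0) :
    d = -willmoreGradient (F t) q := by
  have hu := uniqueDiffOn_Icc hT t ht
  have hv : velocity T F t q = d := hd.derivWithin hu
  have hq : (extChartAt (𝓡 2) q).symm (extChartAt (𝓡 2) q q) = q := extChartAt_to_inv q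
  have hmem := mem_extChartAt_target (I := 𝓡 2) q
  set G := F t ∘ (extChartAt (𝓡 2) q).symm with hG
  set p := extChartAt (𝓡 2) q q with hp
  have hGp : G p = F t q := by rw [hG, comp_apply, hq]
  have hdG : inner ℝ d (G p) = (0 : ℝ) := by
    rw [hGp]
    exact inner_deriv_eq_zero_of_norm_within hu ht (fun s hs => h.norm_eq_one hs q) hd
  -- The chart returns a point that is only propositionally `q`; generalizing the base point
  -- transports the tangent space.
  have hperp' : ∀ m, m = q → ∀ v,
      inner ℝ d (mfderiv (𝓡 2) 𝓘(ℝ, ℍ[ℝ]) (F t) m v : ℍ[ℝ]) = (0 : ℝ) := by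
    rintro _ rfl
    exact hperp
  have hdt : ∀ i, inner ℝ d (Surface.pd i G p) = (0 : ℝ) := by
    intro i
    have h1 := fderiv_chart_apply (h.contMDiff ht) q hmem (EuclideanSpace.single i (1 : ℝ))
    rw [Surface.pd, h1]
    exact hperp' _ hq _
  have hdet := h.det_ne_zero ht q hmem
  have hnorm : ‖G p‖ = 1 := h.norm_eq_one ht _
  have htan := fun i => Surface.inner_pd_eq_zero (isOpen_extChartAt_target q) hmem
    (differentiableAt_of_contDiffOn (isOpen_extChartAt_target q) (h.contDiffOn_chart ht q) hmem)
    (fun p _ => h.norm_eq_one ht _) i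
  have h2 : Surface.perp G p (d + Surface.willmoreGrad G p) = d + Surface.willmoreGrad G p :=
    Surface.perp_eq_self
      (by rw [inner_add_left, hdG,
        Surface.inner_willmoreGrad (Surface.inner_perp_self hnorm htan), add_zero])
      fun i => by rw [inner_add_left, hdt,
        Surface.inner_willmoreGrad (Surface.inner_perp_pd hdet i), add_zero]
  rw [surfaceDefect, hq, hv, h2] at hdef
  exact eq_neg_of_add_eq_zero_left hdef

omit [IsManifold (𝓡 2) ∞ M] in
lemma SolvesElasticFlow.curveDefect_eq_zero (h : SolvesElasticFlow 4 T γ) (hT : 0 < T) {t : ℝ}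
    (ht : t ∈ Icc 0 T) (x : ℝ) : curveDefect T γ t x = 0 := by
  have h1 : timeDeriv T (fun s => lift (γ s)) t x = _ :=
    (h t ht x).derivWithin (uniqueDiffOn_Icc hT t ht)
  rw [curveDefect, h1, neg_add_cancel, inner_zero_left]

omit [IsManifold (𝓡 2) ∞ M] in
lemma SolvesWillmoreFlow.surfaceDefect_eq_zero (h : SolvesWillmoreFlow T F) (hT : 0 < T) {t : ℝ}
    (ht : t ∈ Icc 0 T) (q : M) : surfaceDefect T F t q (extChartAt (𝓡 2) q q) = 0 := by
  have h1 : velocity T F t q = _ := (h t ht q).derivWithin (uniqueDiffOn_Icc hT t ht)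
  rw [surfaceDefect, extChartAt_to_inv, h1, willmoreGradient, neg_add_cancel]
  simp [Surface.perp, Surface.projS3, Surface.projTan]

end Family

end

end HopfWillmore

theorem proposition3p3
    {M : Type u} [TopologicalSpace M] [ChartedSpace (EuclideanSpace ℝ (Fin 2)) M]
    [IsManifold (𝓡 2) ∞ M] (hM : HopfWillmore.IsSmoothTorus M)
    (T : ℝ) (hT : 0 < T)
    (γ : ℝ → Circle → ℍ[ℝ])
    (hγ_smooth : HopfWillmore.SmoothFamily (𝓡 1) 𝓘(ℝ, ℍ[ℝ]) T γ)
    (hγ_regular : ∀ t ∈ Icc 0 T, HopfWillmore.IsRegularCurve (γ t))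
    (hγ_once : ∀ t ∈ Icc 0 T, HopfWillmore.CoversOnce 1 (γ t))
    (F : ℝ → M → ℍ[ℝ])
    (hF_smooth : HopfWillmore.SmoothFamily (𝓡 2) 𝓘(ℝ, ℍ[ℝ]) T F)
    (hF_imm : ∀ t ∈ Icc 0 T, HopfWillmore.IsImm (F t))
    (hF_onto : ∀ t ∈ Icc 0 T, range (F t) = HopfWillmore.hopfTorus (γ t))
    (hF_simple : ∀ t ∈ Icc 0 T, HopfWillmore.IsSimpleOntoImage (F t)) :
    (∃ Φ : ℝ → Diffeomorph (𝓡 2) (𝓡 2) M M ∞,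
        HopfWillmore.SmoothFamily (𝓡 2) (𝓡 2) T (fun t => Φ t) ∧
        (∀ x, Φ 0 x = x) ∧
        HopfWillmore.SolvesWillmoreFlow T (fun t x => F t (Φ t x))) ↔
    (∃ σ : ℝ → Diffeomorph (𝓡 1) (𝓡 1) Circle Circle ∞,
        HopfWillmore.SmoothFamily (𝓡 1) (𝓡 1) T (fun t => σ t) ∧
        (∀ z, σ 0 z = z) ∧
        HopfWillmore.SolvesElasticFlow 4 T (fun t z => γ t (σ t z))) := by
  obtain ⟨e⟩ := hM
  have hP := HopfWillmore.isLatticeCover_torus e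
  have hC := HopfWillmore.isLatticeCover_circle
  have h : HopfWillmore.IsHopfFamily T γ F :=
    ⟨hγ_smooth, hγ_regular, hγ_once, hF_smooth, hF_imm, hF_onto⟩
  constructor
  · rintro ⟨Φ, hΦ, -, hflow⟩
    -- The curves are made to move normally. Paired with the given Willmore solution they form a
    -- Hopf family with zero surface defect, hence zero curve defect, so their normal velocity is
    -- the required one.
    obtain ⟨σ, hσ, hσ0, hσn⟩ := hC.exists_normal_reparametrization hT hγ_smooth fun t ht x =>
      HopfWillmore.injective_fderiv_iff_deriv_ne_zero.2 ((hγ_regular t ht).2 x)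
    refine ⟨σ, hσ, hσ0, fun t ht x => ?_⟩
    have hf := h.comp hσ hΦ
    obtain ⟨-, d, hd, hperp⟩ := hσn t ht x
    have hdef := (hf.surfaceDefect_eq_zero_iff ht hP hT).1
      (fun q => hflow.surfaceDefect_eq_zero hT ht q) x
    rw [← hf.eq_neg_elasticGrad hT ht hd (hperp 1) hdef]
    exact hd
  · rintro ⟨σ, hσ, -, hflow⟩
    -- Now the tori are made to move normally, against the given elastic solution.
    obtain ⟨Φ, hΦ, hΦ0, hΦn⟩ := hP.exists_normal_reparametrization hT hF_smooth fun t ht x =>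
      hP.injective_fderiv_lift ((h.contMDiff ht _).mdifferentiableAt (by simp)) (hF_imm t ht _)
    refine ⟨Φ, hΦ, hΦ0, fun t ht m => ?_⟩
    have hf := h.comp hσ hΦ
    obtain ⟨x, rfl⟩ := hP.surjective m
    obtain ⟨-, d, hd, hperp⟩ := hΦn t ht x
    have hdef := (hf.surfaceDefect_eq_zero_iff ht hP hT).2
      (fun x => hflow.curveDefect_eq_zero hT ht x) (HopfWillmore.torusCover e x)
    rw [← hf.eq_neg_willmoreGradient hT ht hd (hP.inner_mfderiv_eq_zero
      ((hf.contMDiff ht _).mdifferentiableAt (by simp)) hperp) hdef]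
    exact hd
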